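/- Let $n\ge 3$, let $\sigma$ be the surface measure on the unit sphere $\mathbb S^{n-1}\subset\mathbb R^n$ normalized by $\sigma(\mathbb S^{n-1})=1$, let $\mathbb B^n$ be the open unit ball, $|\cdot|$ the Euclidean norm and $e_n=(0,\dots,0,1)$. For $x\in\mathbb B^n$ and $\zeta\in\mathbb S^{n-1}$ put $$P_h(x,\zeta)=\left(\frac{1-|x|^2}{|x-\zeta|^2}\right)^{n-1},\qquad P_h[\phi](x)=\int_{\mathbb S^{n-1}}P_h(x,\zeta)\,\phi(\zeta)\,d\sigma(\zeta)$$ for integrable $\phi$ on $\mathbb S^{n-1}$ (real- or vector-valued). Let $p\in[1,\infty]$ and let $q$ be its conjugate exponent, $\frac1p+\frac1q=1$. For $r\in[0,1)$ define $$G_p(r)=\begin{cases}\displaystyle\inf_{a\in[0,\infty)}\ \sup_{\eta\in\mathbb S^{n-1}}|P_h(re_n,\eta)-a|,& q=\infty,\\[2mm] \displaystyle\inf_{a\in[0,\infty)}\left(\int_{\mathbb S^{n-1}}|P_h(re_n,\eta)-a|^q\,d\sigma(\eta)\right)^{1/q},& q\in[1,\infty),\end{cases}$$ and $$C_p=2(n-1)\left(\frac{\Gamma\left(\frac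 n2\right)\Gamma\left(\frac{1+q}2\right)}{\sqrt\pi\,\Gamma\left(\frac{n+q}2\right)}\right)^{1/q}\ (q<\infty),\qquad C_1=2(n-1)\ (\text{the limit as } q\to\infty).$$ 1. Let $\phi\in L^p(\mathbb S^{n-1},\mathbb R^n)$ and suppose that $u=P_h[\phi]$ satisfies $u(0)=0$. Then $$|u(x)|\le G_p(|x|)\,\|\phi\|_{L^p}\quad\text{for all }x\in\mathbb B^n,$$ and $u$ is differentiable at $0$ with $$\|Du(0)\|\le C_p\,\|\phi\|_{L^p},$$ where $\|A\|=\sup_{|\xi|=1}|A\xi|$. 2. Both inequalities are sharp: for every $x\in\mathbb B^n$, $G_p(|x|)$ is the smallest constant $C$ such that $|u(x)|\le C\|\phi\|_{L^p}$ for all $\phi$ as in 1, and $C_p$ is the smallest constant $C$ such that $\|Du(0)\|\le C\|\phi\|_{L^p}$ for all such $\phi$. If $p>1$, then for every $x\in\mathbb B^n$ equality holds in the first inequality at $x$ for some such $\phi$ with $\|\phi\|_{L^p}\neq0$, and equality holds in the second inequality for some such $\phi$ with $\|\phi\|_{L^p}\ne 0$. 3. If $p<\infty$, then $G_p(0)=0$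 and $G_p$ is an increasing $C^\infty$ diffeomorphism of $[0,1)$ onto $[0,\infty)$ (strictly increasing and bijective, with $G_p$ and its inverse $C^\infty$, one-sidedly at the end point). 4. If $p=\infty$, then $G_\infty(r)=U_h(re_n)$ for all $r\in[0,1)$, where $U_h=P_h[\chi_{\{\eta\in\mathbb S^{n-1}:\,\eta_n\ge0\}}-\chi_{\{\eta\in\mathbb S^{n-1}:\,\eta_n\le0\}}]$, and $G_\infty$ is an increasing $C^\infty$ diffeomorphism of $[0,1)$ onto $[0,1)$. -/

import Mathlib

open MeasureTheory Metric
open scoped ENNReal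

namespace HypPoisson

noncomputable section

/-- The Euclidean space `ℝⁿ`. -/
abbrev E (n : ℕ) : Type := EuclideanSpace ℝ (Fin n)

/-- The unit sphere `𝕊ⁿ⁻¹` of `ℝⁿ`. -/
abbrev S (n : ℕ) : Type := sphere (0 : E n) 1

/-- The surface measure of the unit sphere, normalized to total mass one. -/
def σ (n : ℕ) : Measure (S n) :=
  ((volume : Measure (E n)).toSphere Set.univ)⁻¹ • (volume : Measure (E n)).toSphere

/-- The last vector `eₙ = (0, …, 0, 1)` of the standard basis. -/
def e (n : ℕ) : E n := WithLp.toLp 2 fun i => if (i : ℕ) + 1 = n then 1 else 0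

/-- The Poisson–Szegő kernel `((1 - |x|²) / |x - ζ|²)ⁿ⁻¹` of the hyperbolic Laplacian. -/
def kernel (n : ℕ) (x : E n) (ζ : S n) : ℝ :=
  ((1 - ‖x‖ ^ 2) / ‖x - (ζ : E n)‖ ^ 2) ^ (n - 1)

/-- The invariant Poisson integral `P_h[φ]` of a (scalar or vector valued) function `φ`. -/
def poisson (n : ℕ) {F : Type*} [NormedAddCommGroup F] [NormedSpace ℝ F]
    (φ : S n → F) (x : E n) : F :=
  ∫ ζ, kernel n x ζ • φ ζ ∂(σ n)

/-- The closed upper half sphere `{η : ηₙ ≥ 0}`. -/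
def upper (n : ℕ) : Set (S n) := {η | 0 ≤ inner ℝ (η : E n) (e n)}

/-- The closed lower half sphere `{η : ηₙ ≤ 0}`. -/
def lower (n : ℕ) : Set (S n) := {η | inner ℝ (η : E n) (e n) ≤ 0}

/-- `U_h`, the invariant Poisson integral of the difference of the indicator functions of the
two half spheres. -/
def U (n : ℕ) : E n → ℝ :=
  poisson n fun η => (upper n).indicator (fun _ => (1 : ℝ)) η
    - (lower n).indicator (fun _ => (1 : ℝ)) η

/-- The function `G_p`, written in terms of the exponent `q` conjugate to `p`. -/
def G (n : ℕ) (q : ℝ≥0∞) (r : ℝ) : ℝ :=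
  if q = ⊤ then
    ⨅ a : Set.Ici (0 : ℝ), ⨆ η : S n, |kernel n (r • e n) η - a|
  else
    ⨅ a : Set.Ici (0 : ℝ),
      (∫ η, |kernel n (r • e n) η - a| ^ q.toReal ∂(σ n)) ^ (1 / q.toReal)

/-- The constant in the gradient estimate, written in terms of the exponent `q` conjugate to `p`.
For `q = ∞` the power is read as its limit, which is `1`. -/
def gradConst (n : ℕ) (q : ℝ≥0∞) : ℝ :=
  if q = ⊤ then 2 * ((n : ℝ) - 1)
  else
    2 * ((n : ℝ) - 1) *
      (Real.Gamma ((n : ℝ) / 2) * Real.Gamma ((1 + q.toReal) / 2)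
        / (Real.sqrt Real.pi * Real.Gamma (((n : ℝ) + q.toReal) / 2))) ^ (1 / q.toReal)

/-- `f` restricts to an increasing (`C^∞`) diffeomorphism of the interval `s` onto the
interval `t`. Smoothness at an end point that belongs to the interval is one-sided. -/
def IsIncreasingDiffeo (f : ℝ → ℝ) (s t : Set ℝ) : Prop :=
  StrictMonoOn f s ∧ Set.BijOn f s t ∧ ContDiffOn ℝ ((⊤ : ℕ∞) : WithTop ℕ∞) f s ∧
    ∃ g : ℝ → ℝ, Set.InvOn g f s t ∧ ContDiffOn ℝ ((⊤ : ℕ∞) : WithTop ℕ∞) g t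

/-- `φ` is an `L^p` function on the sphere with values in `ℝⁿ`, and its invariant Poisson integral
vanishes at the origin. -/
def Admissible (n : ℕ) (p : ℝ≥0∞) (φ : S n → E n) : Prop :=
  MemLp φ p (σ n) ∧ poisson n φ 0 = 0

/-- The `L^p` norm with respect to the normalized surface measure, as a real number. -/
def normLp (n : ℕ) (p : ℝ≥0∞) (φ : S n → E n) : ℝ := (eLpNorm φ p (σ n)).toReal

end

end HypPoisson

open HypPoisson

namespace HypPoisson

/-! Write `n = m + 1` and let `s` be the hyperbolic distance of `x` from the origin, so that `x =
tanh (s / 2) • v` with `‖v‖ = 1`. The kernel at `x` is then the `m`-th power of `ratio s t = 1 /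
(cosh s - t sinh s)`, where `t` is the height of `ζ` over the equator orthogonal to `v`
(`kernel_tanh_smul`). With `t = tanh y`, the law `zonal m` of the height has density proportional to
`(cosh y)⁻ᵐ`, so Möbius transformations of the height become translations of the line. The whole
problem thus lives on `[-1, 1]`.

A boundary function with `u(0) = 0` has mean zero, so any constant `a` may be subtracted from the
kernel before Hölder's inequality is applied. The best `a` gives `G_p`. For `q < ∞` it is found from
the Euler-Lagrange equation: the signed power `sign · |·|^(q-1)` of kernel minus `a` has mean zero.
By convexity this suffices for minimality (`distPow_le_integral`). It also says that the field in
direction `v` with this signed power as its length is admissible, and for this field Hölder is an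
equality (`exists_norm_poisson_eq`). For `q = ∞` the best constant is the midpoint of the range of
the kernel, and pairs of small opposite polar caps show sharpness. The gradient is treated in the
same way: the kernel has derivative `2m⟪·, ζ⟫` at the origin, and the norm of `t` in `L^q` is a
ratio of Gaussian integrals.

The difficult point is the regularity of `G_p` for `1 < q < ∞`: `|·|^q` is not smooth at zero, and
the height `t₀` at which the kernel equals the best constant moves with `s`. The Möbius map taking
`0` to `t₀ = tanh b` pins this zero at `τ = 0`: the difference becomes `sinh s` times `τ` times a
positive factor smooth in `(s, b)` (`diffQuot_moeb`). The singular power then acts on `τ` alone, so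
the integrals are smooth in `(s, b)`, and the implicit function theorem gives a smooth `b(s)`
(`contDiff_critPoint`). Splitting off `sinh s` keeps everything nondegenerate at `s = 0`.

Strict monotonicity is an envelope argument: the derivative of `G_p^q` is the derivative in `s` with
`a` frozen at its optimal value, and the Euler-Lagrange equation turns that into the integral of an
almost everywhere positive function (`integral_distIntegrandDeriv_pos`). For `q = 1` the optimal
height is `0` and `G_∞` is an explicit integral; for `q = ∞`, `G_1` is `sinh (m s)`. The smooth
increasing change `r = tanh (s / 2)` carries all this back to `[0, 1)`. -/

/-! ### Polar and cylindrical coordinates; the law of the height on the sphere -/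

/-- Polar coordinates for a product of a function of the height of the direction and a function
of the radius. -/
theorem lintegral_direction_mul_norm {n : ℕ} (hn : 0 < n) (v : E n) {f g : ℝ → ℝ≥0∞}
    (hf : Measurable f) (hg : Measurable g) :
    ∫⁻ x : E n, f (inner ℝ v (‖x‖⁻¹ • x)) * g ‖x‖ =
      (∫⁻ ζ : S n, f (inner ℝ v (ζ : E n)) ∂(volume : Measure (E n)).toSphere) *
        ∫⁻ r in Set.Ioi (0 : ℝ), ENNReal.ofReal (r ^ (n - 1)) * g r := by
  have : Nonempty (Fin n) := ⟨⟨0, hn⟩⟩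
  have h1 := (volume : Measure (E n)).measurePreserving_homeomorphUnitSphereProd.lintegral_comp_emb
    (Homeomorph.measurableEmbedding _)
    (fun z : S n × Set.Ioi (0 : ℝ) => f (inner ℝ v (z.1 : E n)) * g z.2)
  simp only [homeomorphUnitSphereProd_apply_snd_coe, homeomorphUnitSphereProd_apply_fst_coe] at h1
  rw [lintegral_subtype_comap (measurableSet_singleton _).compl
    (fun x : E n => f (inner ℝ v (‖x‖⁻¹ • x)) * g ‖x‖),
    restrict_compl_singleton] at h1
  rw [h1, lintegral_prod_mul (f := fun ζ : S n => f (inner ℝ v (ζ : E n)))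
    (g := fun r : Set.Ioi (0 : ℝ) => g r) (by fun_prop) (by fun_prop)]
  congr 1
  rw [Measure.volumeIoiPow, lintegral_withDensity_eq_lintegral_mul _ (by fun_prop) (by fun_prop)]
  rw [← lintegral_subtype_comap measurableSet_Ioi
    (fun r : ℝ => ENNReal.ofReal (r ^ (n - 1)) * g r)]
  simp

theorem norm_e {n : ℕ} (hn : 0 < n) : ‖e n‖ = 1 := by
  obtain ⟨m, rfl⟩ : ∃ m, n = m + 1 := ⟨n - 1, by omega⟩
  have : ‖e (m + 1)‖ ^ 2 = 1 := by
    rw [EuclideanSpace.norm_sq_eq, Fin.sum_univ_castSucc]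
    have : ∀ i : Fin m, (i : ℕ) ≠ m := fun i => i.2.ne
    simp [e, this]
  nlinarith [norm_nonneg (e (m + 1))]

theorem inner_e {m : ℕ} (x : E (m + 1)) : inner ℝ (e (m + 1)) x = x (Fin.last m) := by
  rw [PiLp.inner_apply, Fin.sum_univ_castSucc]
  have : ∀ i : Fin m, (i : ℕ) ≠ m := fun i => i.2.ne
  simp [e, this]

/-- The reflection that exchanges the two unit vectors preserves Lebesgue measure and norms. -/
theorem lintegral_direction_eq_e {n : ℕ} (hn : 0 < n) {v : E n} (hv : ‖v‖ = 1)
    (f g : ℝ → ℝ≥0∞) :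
    ∫⁻ x : E n, f (inner ℝ v (‖x‖⁻¹ • x)) * g ‖x‖ =
      ∫⁻ x : E n, f (inner ℝ (e n) (‖x‖⁻¹ • x)) * g ‖x‖ := by
  let R := (Submodule.span ℝ {v - e n})ᗮ.reflection
  have hR : R v = e n := Submodule.reflection_sub (by rw [hv, norm_e hn])
  rw [← (R.measurePreserving).lintegral_comp_emb R.toHomeomorph.measurableEmbedding
    (fun x => f (inner ℝ (e n) (‖x‖⁻¹ • x)) * g ‖x‖)]
  refine lintegral_congr fun x => ?_
  rw [R.norm_map, ← R.map_smul, ← hR, R.inner_map_map]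

/-- Lebesgue measure on `ℝᵐ⁺¹` as a product of the last coordinate and the others. -/
theorem lintegral_last_norm {m : ℕ} {F : ℝ → ℝ → ℝ≥0∞} (hF : Measurable (Function.uncurry F)) :
    ∫⁻ x : E (m + 1), F (x (Fin.last m)) ‖x‖ =
      ∫⁻ t : ℝ, ∫⁻ y : E m, F t (Real.sqrt (t ^ 2 + ‖y‖ ^ 2)) := by
  have h1 := (EuclideanSpace.volume_preserving_symm_measurableEquiv_toLp
    (Fin (m + 1))).lintegral_comp_emb (MeasurableEquiv.measurableEmbedding _)
    (fun x => F (x (Fin.last m)) ‖(WithLp.toLp 2 x : E (m + 1))‖)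
  have h2 := (volume_preserving_piFinSuccAbove (fun _ : Fin (m + 1) => ℝ)
    (Fin.last m)).lintegral_comp_emb (MeasurableEquiv.measurableEmbedding _)
    (fun z : ℝ × (Fin m → ℝ) => F z.1 (Real.sqrt (z.1 ^ 2 + ‖(WithLp.toLp 2 z.2 : E m)‖ ^ 2)))
  have h4 : Measurable fun z : ℝ × (Fin m → ℝ) =>
      F z.1 (Real.sqrt (z.1 ^ 2 + ‖(WithLp.toLp 2 z.2 : E m)‖ ^ 2)) := by
    apply hF.comp (f := fun z : ℝ × (Fin m → ℝ) =>
      (z.1, Real.sqrt (z.1 ^ 2 + ‖(WithLp.toLp 2 z.2 : E m)‖ ^ 2)))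
    fun_prop
  have h3 : ∀ t : ℝ, ∫⁻ y : E m, F t (Real.sqrt (t ^ 2 + ‖y‖ ^ 2)) =
      ∫⁻ y : Fin m → ℝ, F t (Real.sqrt (t ^ 2 + ‖(WithLp.toLp 2 y : E m)‖ ^ 2)) := fun t =>
    (EuclideanSpace.volume_preserving_symm_measurableEquiv_toLp
      (Fin m)).lintegral_comp_emb (MeasurableEquiv.measurableEmbedding _)
      (fun y => F t (Real.sqrt (t ^ 2 + ‖(WithLp.toLp 2 y : E m)‖ ^ 2)))
  refine h1.trans ?_
  simp only [h3]
  rw [← lintegral_prod _ h4.aemeasurable]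
  refine Eq.trans (lintegral_congr fun x => ?_) h2
  have hx : ‖(WithLp.toLp 2 x : E (m + 1))‖ = Real.sqrt (x (Fin.last m) ^ 2 +
      ‖(WithLp.toLp 2 (fun j => x ((Fin.last m).succAbove j)) : E m)‖ ^ 2) := by
    rw [← Real.sqrt_sq (norm_nonneg (WithLp.toLp 2 x : E (m + 1))), EuclideanSpace.norm_sq_eq,
      EuclideanSpace.norm_sq_eq, Fin.sum_univ_succAbove _ (Fin.last m)]
    simp
  rw [hx]
  rfl

theorem lintegral_norm {m : ℕ} (hm : 0 < m) {g : ℝ → ℝ≥0∞} (hg : Measurable g) :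
    ∫⁻ x : E m, g ‖x‖ = (volume : Measure (E m)).toSphere Set.univ *
        ∫⁻ r in Set.Ioi (0 : ℝ), ENNReal.ofReal (r ^ (m - 1)) * g r := by
  simpa using lintegral_direction_mul_norm hm 0 (f := fun _ => 1) measurable_const hg

theorem lintegral_mul_sinh (f : ℝ → ℝ≥0∞) {ρ : ℝ} (hρ : 0 < ρ) :
    ∫⁻ t : ℝ, f t = ∫⁻ y : ℝ, ENNReal.ofReal (ρ * Real.cosh y) * f (ρ * Real.sinh y) := by
  have h := lintegral_image_eq_lintegral_abs_deriv_mul (s := Set.univ)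
    (f := fun y => ρ * Real.sinh y) (f' := fun y => ρ * Real.cosh y) MeasurableSet.univ
    (fun y _ => ((Real.hasDerivAt_sinh y).const_mul ρ).hasDerivWithinAt)
    (fun a _ b _ hab => Real.sinh_injective (mul_left_cancel₀ hρ.ne' hab)) f
  have h2 : (fun y => ρ * Real.sinh y) '' Set.univ = Set.univ := by
    rw [Set.image_univ, Set.range_eq_univ]
    intro t
    obtain ⟨y, hy⟩ := Real.sinh_surjective (t / ρ)
    exact ⟨y, by simp only [hy]; field_simp⟩
  rw [h2] at h
  simp only [Measure.restrict_univ] at h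
  rw [h]
  refine lintegral_congr fun y => ?_
  rw [abs_of_pos (by positivity)]

theorem lintegral_Ioi_div (f : ℝ → ℝ≥0∞) {c : ℝ} (hc : 0 < c) :
    ∫⁻ ρ in Set.Ioi (0 : ℝ), f ρ = ∫⁻ r in Set.Ioi (0 : ℝ), ENNReal.ofReal c⁻¹ * f (r / c) := by
  have h := lintegral_image_eq_lintegral_abs_deriv_mul (s := Set.Ioi (0 : ℝ))
    (f := fun r => r / c) (f' := fun _ => c⁻¹) measurableSet_Ioi
    (fun y _ => by simpa using ((hasDerivAt_id y).div_const c).hasDerivWithinAt)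
    (fun a _ b _ hab => by field_simp at hab; exact hab) f
  have h2 : (fun r => r / c) '' Set.Ioi 0 = Set.Ioi 0 := by
    ext x
    constructor
    · rintro ⟨r, hr, rfl⟩
      exact div_pos hr hc
    · intro hx
      exact ⟨x * c, mul_pos hx hc, by field_simp⟩
  rw [h2, abs_of_pos (by positivity)] at h
  exact h

@[fun_prop]
theorem continuous_tanh : Continuous Real.tanh := by
  have : Real.tanh = fun y => Real.sinh y / Real.cosh y := funext Real.tanh_eq_sinh_div_cosh
  rw [this]
  exact Real.continuous_sinh.div Real.continuous_cosh fun y => (Real.cosh_pos y).ne'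

@[fun_prop]
theorem measurable_tanh : Measurable Real.tanh := continuous_tanh.measurable

theorem hasDerivAt_tanh (y : ℝ) : HasDerivAt Real.tanh (1 / Real.cosh y ^ 2) y := by
  have := (Real.hasDerivAt_sinh y).div (Real.hasDerivAt_cosh y) (Real.cosh_pos y).ne'
  rw [← pow_two, ← pow_two, Real.cosh_sq_sub_sinh_sq] at this
  exact this.congr_of_eventuallyEq (Filter.Eventually.of_forall Real.tanh_eq_sinh_div_cosh)

/-- The integral of a zonal function against the surface measure, in the coordinate
`⟪e, ζ⟫ = tanh y`. -/
theorem lintegral_zonal_mul_radial {m : ℕ} (hm : 0 < m) {f g : ℝ → ℝ≥0∞}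
    (hf : Measurable f) (hg : Measurable g) :
    ∫⁻ x : E (m + 1), f (inner ℝ (e (m + 1)) (‖x‖⁻¹ • x)) * g ‖x‖ =
      (volume : Measure (E m)).toSphere Set.univ *
      ((∫⁻ y : ℝ, ENNReal.ofReal ((Real.cosh y ^ m)⁻¹) * f (Real.tanh y)) *
        ∫⁻ r in Set.Ioi (0 : ℝ), ENNReal.ofReal (r ^ m) * g r) := by
  simp only [inner_smul_right, inner_e]
  rw [lintegral_last_norm (F := fun t r => f (r⁻¹ * t) * g r) (by
    unfold Function.uncurry; fun_prop)]
  have h1 : ∀ t : ℝ, ∫⁻ y : E m, f ((Real.sqrt (t ^ 2 + ‖y‖ ^ 2))⁻¹ * t)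
        * g (Real.sqrt (t ^ 2 + ‖y‖ ^ 2)) = (volume : Measure (E m)).toSphere Set.univ *
        ∫⁻ r in Set.Ioi (0 : ℝ), ENNReal.ofReal (r ^ (m - 1)) *
          (f ((Real.sqrt (t ^ 2 + r ^ 2))⁻¹ * t) * g (Real.sqrt (t ^ 2 + r ^ 2))) := fun t =>
    lintegral_norm hm (g := fun r => f ((Real.sqrt (t ^ 2 + r ^ 2))⁻¹ * t)
        * g (Real.sqrt (t ^ 2 + r ^ 2))) (by fun_prop)
  simp only [h1]
  rw [lintegral_const_mul' _ _ (measure_ne_top _ _)]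
  congr 1
  rw [lintegral_lintegral_swap (by
    apply Measurable.aemeasurable
    unfold Function.uncurry
    fun_prop)]
  -- At distance `ρ` from the axis put `t = ρ sinh y`: the radius becomes `ρ cosh y` and the height
  -- of the direction `tanh y`.
  have h2 : ∀ ρ ∈ Set.Ioi (0 : ℝ), (∫⁻ t : ℝ, ENNReal.ofReal (ρ ^ (m - 1)) *
      (f ((Real.sqrt (t ^ 2 + ρ ^ 2))⁻¹ * t) * g (Real.sqrt (t ^ 2 + ρ ^ 2)))) =
      ∫⁻ y : ℝ, ENNReal.ofReal (ρ ^ m * Real.cosh y) *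
        (f (Real.tanh y) * g (ρ * Real.cosh y)) := by
    intro ρ hρ
    have hρ : 0 < ρ := hρ
    rw [lintegral_mul_sinh _ hρ]
    refine lintegral_congr fun y => ?_
    have hs : Real.sqrt ((ρ * Real.sinh y) ^ 2 + ρ ^ 2) = ρ * Real.cosh y := by
      rw [← Real.sqrt_sq (by positivity : 0 ≤ ρ * Real.cosh y)]
      congr 1
      nlinarith [Real.cosh_sq y]
    have hc := Real.cosh_pos y
    have ht : (ρ * Real.cosh y)⁻¹ * (ρ * Real.sinh y) = Real.tanh y := by
      rw [Real.tanh_eq_sinh_div_cosh]; field_simp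
    rw [hs, ht, ← mul_assoc, ← ENNReal.ofReal_mul (by positivity)]
    congr 2
    obtain ⟨k, rfl⟩ : ∃ k, m = k + 1 := ⟨m - 1, by omega⟩
    simp only [Nat.add_sub_cancel]
    ring
  rw [setLIntegral_congr_fun measurableSet_Ioi h2, lintegral_lintegral_swap (by
    apply Measurable.aemeasurable
    unfold Function.uncurry
    fun_prop)]
  rw [← lintegral_mul_const _ (by fun_prop)]
  refine lintegral_congr fun y => ?_
  have hc := Real.cosh_pos y
  -- Substituting `ρ = r / cosh y` turns the radius into the free variable `r`, and the double
  -- integral splits.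
  rw [lintegral_Ioi_div _ hc, ← lintegral_const_mul _ (by fun_prop)]
  refine setLIntegral_congr_fun measurableSet_Ioi fun r hr => ?_
  have hr : 0 < r := hr
  have h3 : r / Real.cosh y * Real.cosh y = r := by field_simp
  have h4 : (Real.cosh y)⁻¹ * ((r / Real.cosh y) ^ m * Real.cosh y) =
      (Real.cosh y ^ m)⁻¹ * r ^ m := by
    rw [div_pow]
    field_simp
  rw [h3, ← mul_assoc, ← ENNReal.ofReal_mul (by positivity), h4,
    ENNReal.ofReal_mul (by positivity)]
  ring

/-- The total mass of the weight `(cosh y)⁻ᵐ`. -/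
noncomputable def sechMass (m : ℕ) : ℝ := ∫ y : ℝ, (Real.cosh y ^ m)⁻¹

theorem continuous_sech_pow (m : ℕ) : Continuous fun y : ℝ => (Real.cosh y ^ m)⁻¹ :=
  (Real.continuous_cosh.pow m).inv₀ fun y => (pow_pos (Real.cosh_pos y) m).ne'

theorem integrable_sech_pow {m : ℕ} (hm : 2 ≤ m) :
    Integrable fun y : ℝ => (Real.cosh y ^ m)⁻¹ := by
  refine integrable_inv_one_add_sq.mono' (continuous_sech_pow m).aestronglyMeasurable
    (Filter.Eventually.of_forall fun y => ?_)
  rw [Real.norm_of_nonneg (by have := Real.cosh_pos y; positivity)]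
  have h1 : 1 + y ^ 2 ≤ Real.cosh y ^ 2 := by
    rw [Real.cosh_sq]
    have : |y| ≤ |Real.sinh y| := by
      rw [Real.abs_sinh]
      exact Real.self_le_sinh_iff.2 (abs_nonneg y)
    linarith [sq_le_sq.2 this]
  exact inv_anti₀ (by positivity)
    (h1.trans (pow_le_pow_right₀ (Real.one_le_cosh y) hm))

theorem sechMass_pos {m : ℕ} (hm : 2 ≤ m) : 0 < sechMass m := by
  refine (integral_pos_iff_support_of_nonneg (fun y => ?_) (integrable_sech_pow hm)).2 ?_
  · have := Real.cosh_pos y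
    simp only [Pi.zero_apply]
    positivity
  · have : Function.support (fun y : ℝ => (Real.cosh y ^ m)⁻¹) = Set.univ := by
      ext y
      simp [(Real.cosh_pos y).ne']
    rw [this]
    simp

/-- The law of the height function on the sphere of dimension `m`. -/
noncomputable def zonal (m : ℕ) : Measure ℝ :=
  ((volume : Measure ℝ).withDensity
    fun y => ENNReal.ofReal ((sechMass m)⁻¹ * (Real.cosh y ^ m)⁻¹)).map Real.tanh

theorem measurable_zonal_density (m : ℕ) :
    Measurable fun y : ℝ => ENNReal.ofReal ((sechMass m)⁻¹ * (Real.cosh y ^ m)⁻¹) := by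
  fun_prop

theorem lintegral_zonal (m : ℕ) {f : ℝ → ℝ≥0∞} (hf : Measurable f) :
    ∫⁻ t, f t ∂(zonal m) =
      ∫⁻ y : ℝ, ENNReal.ofReal ((sechMass m)⁻¹ * (Real.cosh y ^ m)⁻¹) * f (Real.tanh y) := by
  rw [zonal, lintegral_map hf measurable_tanh,
    lintegral_withDensity_eq_lintegral_mul _ (measurable_zonal_density m) (by fun_prop)]
  rfl

theorem isProbabilityMeasure_zonal {m : ℕ} (hm : 2 ≤ m) : IsProbabilityMeasure (zonal m) := by
  constructor
  rw [← lintegral_one, lintegral_zonal m measurable_const]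
  simp only [mul_one]
  have h2 := sechMass_pos hm
  rw [← ofReal_integral_eq_lintegral_ofReal ((integrable_sech_pow hm).const_mul _)
    (Filter.Eventually.of_forall fun y => ?_), integral_const_mul]
  · rw [← sechMass, inv_mul_cancel₀ h2.ne', ENNReal.ofReal_one]
  · have h1 := Real.cosh_pos y
    simp only [Pi.zero_apply]
    positivity

/-! ### Gaussian integrals: identification of the zonal law and its moments -/

theorem lintegral_rpow_mul_exp_neg_sq {a : ℝ} (ha : -1 < a) :
    ∫⁻ r in Set.Ioi (0 : ℝ), ENNReal.ofReal (r ^ a * Real.exp (-r ^ (2 : ℝ))) =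
      ENNReal.ofReal (1 / 2 * Real.Gamma ((a + 1) / 2)) := by
  rw [← integral_rpow_mul_exp_neg_rpow (by norm_num : (0 : ℝ) < 2) ha,
    ofReal_integral_eq_lintegral_ofReal]
  · exact integrableOn_rpow_mul_exp_neg_rpow ha (by norm_num)
  · filter_upwards [ae_restrict_mem measurableSet_Ioi] with r hr
    have : (0 : ℝ) < r := hr
    simp only [Pi.zero_apply]
    positivity

theorem lintegral_pow_mul_gaussian (k : ℕ) {a : ℝ} (ha : 0 ≤ a) :
    ∫⁻ r in Set.Ioi (0 : ℝ), ENNReal.ofReal (r ^ k) *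
      ENNReal.ofReal (r ^ a * Real.exp (-r ^ (2 : ℝ))) =
      ENNReal.ofReal (1 / 2 * Real.Gamma ((k + 1 + a) / 2)) := by
  have h := lintegral_rpow_mul_exp_neg_sq (a := k + a) 
    (by linarith [k.cast_nonneg (α := ℝ)])
  rw [show (k : ℝ) + 1 + a = k + a + 1 by ring, ← h]
  refine setLIntegral_congr_fun measurableSet_Ioi fun r hr => ?_
  have hr : (0 : ℝ) < r := hr
  rw [← ENNReal.ofReal_mul (by positivity), Real.rpow_add hr, Real.rpow_natCast, mul_assoc]

theorem toSphere_univ_ne_zero (m : ℕ) :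
    (volume : Measure (E (m + 1))).toSphere Set.univ ≠ 0 := by
  rw [Measure.toSphere_apply_univ]
  exact mul_ne_zero (by simp) (measure_ball_pos _ _ one_pos).ne'

/-- The same integral, weighted by a Gaussian in the radius, is computed in polar and in cylindrical
coordinates. The radial factor is finite and nonzero, so it cancels; the remaining constant is fixed
by `f = 1`, both measures having mass one, without knowing the area of the sphere. -/
theorem lintegral_sphere_zonal {m : ℕ} (hm : 2 ≤ m) {v : E (m + 1)} (hv : ‖v‖ = 1)
    {f : ℝ → ℝ≥0∞} (hf : Measurable f) :
    ∫⁻ ζ : S (m + 1), f (inner ℝ v (ζ : E (m + 1))) ∂(σ (m + 1)) = ∫⁻ t, f t ∂(zonal m) := by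
  set τ := (volume : Measure (E (m + 1))).toSphere with hτ
  have hA := lintegral_pow_mul_gaussian m (le_refl (0 : ℝ))
  set A := ENNReal.ofReal (1 / 2 * Real.Gamma (((m : ℝ) + 1 + 0) / 2))
  have hA0 : A ≠ 0 := by
    have : 0 < Real.Gamma (((m : ℝ) + 1 + 0) / 2) := Real.Gamma_pos_of_pos (by positivity)
    simp only [A, ne_eq, ENNReal.ofReal_eq_zero, not_le]
    positivity
  have hAt : A ≠ ⊤ := ENNReal.ofReal_ne_top
  have key : ∀ f : ℝ → ℝ≥0∞, Measurable f →
      ∫⁻ ζ : S (m + 1), f (inner ℝ v (ζ : E (m + 1))) ∂τ =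
      (volume : Measure (E m)).toSphere Set.univ * (ENNReal.ofReal (sechMass m) *
        ∫⁻ t, f t ∂(zonal m)) := by
    intro f hf
    have h1 := lintegral_direction_mul_norm (by omega : 0 < m + 1) v hf
      (g := fun r => ENNReal.ofReal (r ^ (0 : ℝ) * Real.exp (-r ^ (2 : ℝ)))) (by fun_prop)
    rw [lintegral_direction_eq_e (by omega : 0 < m + 1) hv f
      (fun r => ENNReal.ofReal (r ^ (0 : ℝ) * Real.exp (-r ^ (2 : ℝ)))),
      lintegral_zonal_mul_radial (by omega) hf
      (g := fun r => ENNReal.ofReal (r ^ (0 : ℝ) * Real.exp (-r ^ (2 : ℝ))))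
      (by fun_prop)] at h1
    simp only [Nat.add_sub_cancel] at h1
    rw [hA, ← mul_assoc] at h1
    rw [← (ENNReal.mul_left_inj hA0 hAt).1 h1, lintegral_zonal m hf]
    congr 1
    rw [← lintegral_const_mul _ (by fun_prop)]
    refine lintegral_congr fun y => ?_
    have h2 := sechMass_pos hm
    rw [← mul_assoc, ← ENNReal.ofReal_mul h2.le, mul_inv_cancel_left₀ h2.ne']
  have := isProbabilityMeasure_zonal hm
  have h1 := key (fun _ => 1) measurable_const
  simp only [lintegral_one, measure_univ, mul_one] at h1
  have hne : τ Set.univ ≠ 0 := toSphere_univ_ne_zero m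
  rw [σ, lintegral_smul_measure, key f hf, ← mul_assoc, ← h1, smul_eq_mul, ← mul_assoc,
    ENNReal.inv_mul_cancel hne (measure_ne_top _ _), one_mul]

theorem map_inner_eq_zonal {m : ℕ} (hm : 2 ≤ m) {v : E (m + 1)} (hv : ‖v‖ = 1) :
    (σ (m + 1)).map (fun ζ : S (m + 1) => inner ℝ v (ζ : E (m + 1))) = zonal m := by
  have hmeas : Measurable fun ζ : S (m + 1) => inner ℝ v (ζ : E (m + 1)) := by fun_prop
  ext s hs
  rw [← lintegral_indicator_one hs, lintegral_map (measurable_one.indicator hs) hmeas,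
    lintegral_sphere_zonal hm hv (measurable_one.indicator hs), lintegral_indicator_one hs]

theorem isProbabilityMeasure_sigma (m : ℕ) : IsProbabilityMeasure (σ (m + 1)) := by
  constructor
  rw [σ, Measure.smul_apply, smul_eq_mul]
  exact ENNReal.inv_mul_cancel (toSphere_univ_ne_zero m) (measure_ne_top _ _)

/-- The integral of `|x_last|^q exp(-‖x‖²)` is evaluated twice: polar coordinates give the moment
times a Gamma value, and the product structure gives a one-dimensional Gamma integral times the
Gaussian integral `B` of the other coordinates. Dividing by the case `q = 0` eliminates `B`. -/
theorem lintegral_abs_rpow_zonal {m : ℕ} (hm : 2 ≤ m) {q : ℝ} (hq : 0 ≤ q) :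
    ∫⁻ t, ENNReal.ofReal (|t| ^ q) ∂(zonal m) = ENNReal.ofReal
      (Real.Gamma (((m : ℝ) + 1) / 2) * Real.Gamma ((1 + q) / 2) /
        (Real.sqrt Real.pi * Real.Gamma (((m : ℝ) + 1 + q) / 2))) := by
  have he := norm_e (by omega : 0 < m + 1)
  set τ := (volume : Measure (E (m + 1))).toSphere with hτ
  set B := ∫⁻ y : E m, ENNReal.ofReal (Real.exp (-‖y‖ ^ (2 : ℝ))) with hB
  have key : ∀ q : ℝ, 0 ≤ q →
      (∫⁻ ζ : S (m + 1), ENNReal.ofReal (|inner ℝ (e (m + 1)) (ζ : E (m + 1))| ^ q) ∂τ) *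
        ENNReal.ofReal (1 / 2 * Real.Gamma (((m : ℝ) + 1 + q) / 2)) =
      ENNReal.ofReal (Real.Gamma ((1 + q) / 2)) * B := by
    intro q hq
    have h1 := lintegral_direction_mul_norm (by omega : 0 < m + 1) (e (m + 1))
      (f := fun t => ENNReal.ofReal (|t| ^ q))
      (g := fun r => ENNReal.ofReal (r ^ q * Real.exp (-r ^ (2 : ℝ)))) (by fun_prop) (by fun_prop)
    simp only [Nat.add_sub_cancel] at h1
    rw [lintegral_pow_mul_gaussian m hq] at h1
    rw [← h1]
    have h2 : ∀ᵐ x : E (m + 1), ENNReal.ofReal (|inner ℝ (e (m + 1)) (‖x‖⁻¹ • x)| ^ q) *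
        ENNReal.ofReal (‖x‖ ^ q * Real.exp (-‖x‖ ^ (2 : ℝ))) =
        ENNReal.ofReal (|x (Fin.last m)| ^ q * Real.exp (-‖x‖ ^ (2 : ℝ))) := by
      have : ∀ᵐ x : E (m + 1), x ≠ 0 := by
        simp [ae_iff]
      filter_upwards [this] with x hx
      have hx := norm_pos_iff.2 hx
      rw [← ENNReal.ofReal_mul (by positivity), ← mul_assoc,
        ← Real.mul_rpow (abs_nonneg _) hx.le, inner_smul_right, inner_e, abs_mul, abs_inv,
        abs_norm, mul_right_comm, inv_mul_cancel₀ hx.ne', one_mul]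
    rw [lintegral_congr_ae h2, lintegral_last_norm
      (F := fun t r => ENNReal.ofReal (|t| ^ q * Real.exp (-r ^ (2 : ℝ))))
      (by unfold Function.uncurry; fun_prop)]
    have h3 : ∀ (t : ℝ) (y : E m), ENNReal.ofReal (|t| ^ q *
        Real.exp (-Real.sqrt (t ^ 2 + ‖y‖ ^ 2) ^ (2 : ℝ))) =
        ENNReal.ofReal (|t| ^ q * Real.exp (-|t| ^ (2 : ℝ))) *
          ENNReal.ofReal (Real.exp (-‖y‖ ^ (2 : ℝ))) := by
      intro t y
      rw [← ENNReal.ofReal_mul (by positivity), mul_assoc, ← Real.exp_add]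
      congr 4
      rw [Real.rpow_two, Real.rpow_two, Real.rpow_two, Real.sq_sqrt (by positivity), sq_abs]
      ring
    simp only [h3]
    simp_rw [lintegral_const_mul' _ _ ENNReal.ofReal_ne_top]
    rw [← hB, lintegral_mul_const _ (by fun_prop)]
    congr 1
    have h5 := integral_comp_abs (f := fun t => t ^ q * Real.exp (-t ^ (2 : ℝ)))
    rw [integral_rpow_mul_exp_neg_rpow (by norm_num : (0 : ℝ) < 2) (by linarith)] at h5
    have h7 : 0 < Real.Gamma ((q + 1) / 2) := Real.Gamma_pos_of_pos (by positivity)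
    -- A nonintegrable function has Bochner integral `0` by convention, while the value in `h5` is
    -- positive.
    have h6 : Integrable fun t : ℝ => |t| ^ q * Real.exp (-|t| ^ (2 : ℝ)) := by
      by_contra h
      rw [integral_undef h] at h5
      linarith
    rw [← ofReal_integral_eq_lintegral_ofReal h6 (Filter.Eventually.of_forall fun t => by
      simp only [Pi.zero_apply]; positivity), h5]
    congr 1
    rw [add_comm q 1]
    ring
  have hne : τ Set.univ ≠ 0 := toSphere_univ_ne_zero m
  have hnt : τ Set.univ ≠ ⊤ := measure_ne_top _ _
  have k0 := key 0 le_rfl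
  have k1 := key q hq
  simp only [Real.rpow_zero, ENNReal.ofReal_one, lintegral_one, add_zero] at k0
  rw [← lintegral_sphere_zonal hm he (by fun_prop), σ, lintegral_smul_measure, smul_eq_mul, ← hτ]
  rw [Real.Gamma_one_half_eq] at k0
  have g1 : 0 < Real.Gamma (((m : ℝ) + 1) / 2) := Real.Gamma_pos_of_pos (by positivity)
  have g2 : 0 < Real.Gamma (((m : ℝ) + 1 + q) / 2) := Real.Gamma_pos_of_pos (by positivity)
  have g3 : 0 < Real.Gamma ((1 + q) / 2) := Real.Gamma_pos_of_pos (by positivity)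
  have g4 : 0 < Real.sqrt Real.pi := Real.sqrt_pos.2 Real.pi_pos
  have hBt : B ≠ ⊤ := by
    intro h
    rw [h, ENNReal.mul_top (by simpa using g4)] at k0
    exact ENNReal.mul_ne_top hnt ENNReal.ofReal_ne_top k0
  have hB0 : B ≠ 0 := by
    intro h
    rw [h, mul_zero, mul_eq_zero] at k0
    rcases k0 with h | h
    · exact hne h
    · rw [ENNReal.ofReal_eq_zero] at h
      linarith
  set I := ∫⁻ ζ : S (m + 1), ENNReal.ofReal (|inner ℝ (e (m + 1)) (ζ : E (m + 1))| ^ q) ∂τ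
  have hIt : I ≠ ⊤ := by
    intro h
    rw [h, ENNReal.top_mul (by simpa using g2)] at k1
    exact ENNReal.mul_ne_top ENNReal.ofReal_ne_top hBt k1.symm
  have k0' := congrArg ENNReal.toReal k0
  have k1' := congrArg ENNReal.toReal k1
  rw [ENNReal.toReal_mul, ENNReal.toReal_mul, ENNReal.toReal_ofReal (by positivity),
    ENNReal.toReal_ofReal (by positivity)] at k0' k1'
  rw [← ENNReal.ofReal_toReal (ENNReal.mul_ne_top (ENNReal.inv_ne_top.2 hne) hIt),
    ENNReal.toReal_mul, ENNReal.toReal_inv]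
  congr 1
  have b0 : 0 < B.toReal := ENNReal.toReal_pos hB0 hBt
  have t0 : 0 < (τ Set.univ).toReal := ENNReal.toReal_pos hne hnt
  rw [inv_mul_eq_div, div_eq_div_iff t0.ne' (by positivity)]
  have : B.toReal * (I.toReal * (Real.sqrt Real.pi * Real.Gamma (((m : ℝ) + 1 + q) / 2))) =
      B.toReal * (Real.Gamma (((m : ℝ) + 1) / 2) * Real.Gamma ((1 + q) / 2)
        * (τ Set.univ).toReal) := by
    linear_combination (2 * Real.sqrt Real.pi * B.toReal) * k1'
      - (2 * Real.Gamma ((1 + q) / 2) * B.toReal) * k0'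
  exact mul_left_cancel₀ b0.ne' this

/-! ### The zonal measure on the interval -/

variable {m : ℕ} [Fact (2 ≤ m)]

instance : IsProbabilityMeasure (zonal m) := isProbabilityMeasure_zonal Fact.out

theorem tanh_mem_Ioo (y : ℝ) : Real.tanh y ∈ Set.Ioo (-1 : ℝ) 1 :=
  Real.tanh_bijOn.mapsTo (Set.mem_univ y)

theorem ae_zonal_mem_Ioo (m : ℕ) : ∀ᵐ t ∂(zonal m), t ∈ Set.Ioo (-1 : ℝ) 1 := by
  refine (ae_map_iff measurable_tanh.aemeasurable measurableSet_Ioo).2 ?_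
  exact Filter.Eventually.of_forall tanh_mem_Ioo

theorem ae_zonal_mem_Icc (m : ℕ) : ∀ᵐ t ∂(zonal m), t ∈ Set.Icc (-1 : ℝ) 1 :=
  (ae_zonal_mem_Ioo m).mono fun _ h => Set.Ioo_subset_Icc_self h

theorem restrict_zonal_Icc (m : ℕ) : (zonal m).restrict (Set.Icc (-1) 1) = zonal m :=
  Measure.restrict_eq_self_of_ae_mem (ae_zonal_mem_Icc m)

theorem integrable_zonal_of_continuousOn {f : ℝ → ℝ} (hf : ContinuousOn f (Set.Icc (-1) 1)) :
    Integrable f (zonal m) := by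
  rw [← restrict_zonal_Icc]
  exact hf.integrableOn_compact isCompact_Icc

theorem integral_zonal {f : ℝ → ℝ} (hf : AEStronglyMeasurable f (zonal m)) :
    ∫ t, f t ∂(zonal m) =
      (sechMass m)⁻¹ * ∫ y : ℝ, (Real.cosh y ^ m)⁻¹ * f (Real.tanh y) := by
  rw [zonal, integral_map measurable_tanh.aemeasurable hf,
    integral_withDensity_eq_integral_toReal_smul (measurable_zonal_density m)
      (Filter.Eventually.of_forall fun _ => ENNReal.ofReal_lt_top), ← integral_const_mul]
  congr 1
  ext y
  have h1 := Real.cosh_pos y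
  have h2 := sechMass_pos (m := m) Fact.out
  rw [ENNReal.toReal_ofReal (by positivity), smul_eq_mul, mul_assoc]

theorem zonal_null_iff {s : Set ℝ} (hs : MeasurableSet s) :
    zonal m s = 0 ↔ volume (Real.tanh ⁻¹' s) = 0 := by
  rw [zonal, Measure.map_apply measurable_tanh hs,
    withDensity_apply_eq_zero' (measurable_zonal_density m).aemeasurable]
  have h2 := sechMass_pos (m := m) Fact.out
  have : {y : ℝ | ENNReal.ofReal ((sechMass m)⁻¹ * (Real.cosh y ^ m)⁻¹) ≠ 0} = Set.univ := by
    ext y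
    have h1 := Real.cosh_pos y
    simp only [ne_eq, ENNReal.ofReal_eq_zero, not_le, Set.mem_ofPred_eq, Set.mem_univ, iff_true]
    positivity
  rw [this, Set.univ_inter]

instance : NullSingletonClass (zonal m) := by
  constructor
  intro t
  rw [zonal_null_iff (measurableSet_singleton t)]
  refine Set.Subsingleton.measure_zero ?_ _
  intro a ha b hb
  exact Real.tanh_injective (ha.trans hb.symm)

theorem zonal_Ioo_pos {a b : ℝ} (hab : a < b) (ha : -1 ≤ a) (hb : b ≤ 1) :
    0 < zonal m (Set.Ioo a b) := by
  rw [pos_iff_ne_zero, ne_eq, zonal_null_iff measurableSet_Ioo]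
  refine ((isOpen_Ioo.preimage continuous_tanh).measure_pos _ ?_).ne'
  obtain ⟨y, -, hy⟩ := Real.tanh_surjOn (show (a + b) / 2 ∈ Set.Ioo (-1 : ℝ) 1 by
    constructor <;> linarith)
  exact ⟨y, by rw [Set.mem_preimage, hy]; constructor <;> linarith⟩

theorem map_neg_zonal {m : ℕ} : (zonal m).map Neg.neg = zonal m := by
  ext s hs
  have hf := measurable_one.indicator (β := ℝ≥0∞) hs
  rw [← lintegral_indicator_one hs, lintegral_map hf measurable_neg,
    lintegral_zonal m (f := fun t => s.indicator 1 (-t)) (hf.comp measurable_neg)]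
  rw [← lintegral_neg_eq_self]
  rw [← lintegral_indicator_one hs, lintegral_zonal m hf]
  refine lintegral_congr fun y => ?_
  rw [Real.cosh_neg, Real.tanh_neg, neg_neg]

theorem measurePreserving_neg_zonal {m : ℕ} : MeasurePreserving Neg.neg (zonal m) (zonal m) :=
  ⟨measurable_neg, map_neg_zonal⟩

theorem integral_zonal_neg {m : ℕ} (f : ℝ → ℝ) : ∫ t, f (-t) ∂(zonal m) = ∫ t, f t ∂(zonal m) :=
  measurePreserving_neg_zonal.integral_comp (MeasurableEquiv.neg ℝ).measurableEmbedding f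

/-! ### Möbius transformations of the height -/

/-- The factor `cosh b + t sinh b` of a Möbius transformation of the interval. -/
noncomputable def moebDen (b t : ℝ) : ℝ := Real.cosh b + Real.sinh b * t

/-- The Möbius transformation of the interval that maps `0` to `tanh b`. -/
noncomputable def moeb (b t : ℝ) : ℝ := (Real.cosh b * t + Real.sinh b) / moebDen b t

/-- The factor is the convex combination of `exp b` and `exp (-b)` with weights `(1 + t) / 2` and
`(1 - t) / 2`. -/
theorem moebDen_pos (b : ℝ) {t : ℝ} (ht : t ∈ Set.Icc (-1 : ℝ) 1) : 0 < moebDen b t := by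
  have h1 := Real.exp_pos b
  have h2 := Real.exp_pos (-b)
  rw [moebDen, Real.cosh_eq, Real.sinh_eq]
  rcases le_or_gt t 0 with h | h
  · nlinarith [ht.1]
  · nlinarith [ht.2]

theorem moebDen_tanh (b y : ℝ) : moebDen b (Real.tanh y) = Real.cosh (y + b) / Real.cosh y := by
  have := Real.cosh_pos y
  rw [moebDen, Real.tanh_eq_sinh_div_cosh, Real.cosh_add]
  field_simp

/-- The reason for the coordinate `y`: the transformation is a translation there, and `moebDen` is
the change of `cosh`. -/
theorem moeb_tanh (b y : ℝ) : moeb b (Real.tanh y) = Real.tanh (y + b) := by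
  have h1 := Real.cosh_pos y
  have h2 := Real.cosh_pos (y + b)
  rw [moeb, moebDen_tanh, Real.tanh_eq_sinh_div_cosh, Real.tanh_eq_sinh_div_cosh, Real.sinh_add]
  field_simp

theorem moeb_mem_Icc (b : ℝ) {t : ℝ} (ht : t ∈ Set.Icc (-1 : ℝ) 1) :
    moeb b t ∈ Set.Icc (-1 : ℝ) 1 := by
  have h := moebDen_pos b ht
  have h1 := Real.exp_pos b
  have h2 := Real.exp_pos (-b)
  rw [moeb, Set.mem_Icc, le_div_iff₀ h, div_le_iff₀ h, moebDen, Real.cosh_eq, Real.sinh_eq]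
  constructor
  · nlinarith [ht.1]
  · nlinarith [ht.2]

theorem continuousOn_moebDen (b : ℝ) (s : Set ℝ) : ContinuousOn (moebDen b) s := by
  unfold moebDen
  fun_prop

theorem continuousOn_moeb (b : ℝ) : ContinuousOn (moeb b) (Set.Icc (-1) 1) := by
  unfold moeb
  exact ContinuousOn.div (by fun_prop) (continuousOn_moebDen b _) fun t ht => (moebDen_pos b ht).ne'

/-- Change of variables for the zonal measure under a Möbius transformation. -/
theorem integral_zonal_moeb (b : ℝ) {f : ℝ → ℝ} (hf : ContinuousOn f (Set.Icc (-1) 1)) :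
    ∫ t, f t ∂(zonal m) = ∫ t, f (moeb b t) * (moebDen b t ^ m)⁻¹ ∂(zonal m) := by
  have h1 : ContinuousOn (fun t => f (moeb b t) * (moebDen b t ^ m)⁻¹) (Set.Icc (-1) 1) :=
    (hf.comp (continuousOn_moeb b) fun t ht => moeb_mem_Icc b ht).mul
      (((continuousOn_moebDen b _).pow m).inv₀ fun t ht => (pow_pos (moebDen_pos b ht) m).ne')
  rw [integral_zonal (integrable_zonal_of_continuousOn hf).1,
    integral_zonal (integrable_zonal_of_continuousOn h1).1]
  congr 1
  rw [← integral_add_right_eq_self _ b]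
  congr 1
  ext y
  have h1 := Real.cosh_pos y
  have h2 := Real.cosh_pos (y + b)
  rw [moeb_tanh, moebDen_tanh, div_pow]
  field_simp

/-! ### Signed powers -/

/-- The odd power `sign x · |x|^(q-1)`; it is `sign x` for `q = 1`. -/
noncomputable def signedPow (q x : ℝ) : ℝ := |x| ^ (q - 2) * x

theorem signedPow_mul_self {q : ℝ} (hq : q ≠ 0) (x : ℝ) : signedPow q x * x = |x| ^ q := by
  rcases eq_or_ne x 0 with rfl | hx
  · simp [hq]
  · have h : 0 < |x| := abs_pos.2 hx
    rw [signedPow, mul_assoc, ← abs_mul_abs_self x, ← pow_two, ← Real.rpow_natCast,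
      ← Real.rpow_add h]
    congr 1
    norm_num

theorem signedPow_neg (q x : ℝ) : signedPow q (-x) = -signedPow q x := by
  simp [signedPow]

theorem signedPow_zero (q : ℝ) : signedPow q 0 = 0 := by simp [signedPow]

theorem signedPow_of_pos (q : ℝ) {x : ℝ} (hx : 0 < x) : signedPow q x = x ^ (q - 1) := by
  rw [signedPow, abs_of_pos hx]
  nth_rw 2 [← Real.rpow_one x]
  rw [← Real.rpow_add hx]
  congr 1
  ring

theorem signedPow_pos (q : ℝ) {x : ℝ} (hx : 0 < x) : 0 < signedPow q x := by
  rw [signedPow_of_pos q hx]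
  positivity

theorem signedPow_neg_of_neg (q : ℝ) {x : ℝ} (hx : x < 0) : signedPow q x < 0 := by
  have := signedPow_pos q (neg_pos.2 hx)
  rw [signedPow_neg] at this
  linarith

theorem signedPow_mul (q : ℝ) {c : ℝ} (hc : 0 < c) (x : ℝ) :
    signedPow q (c * x) = c ^ (q - 1) * signedPow q x := by
  have : c ^ (q - 1) = c ^ (q - 2) * c := by
    nth_rw 3 [← Real.rpow_one c]
    rw [← Real.rpow_add hc]
    congr 1
    ring
  rw [signedPow, signedPow, abs_mul, abs_of_pos hc, Real.mul_rpow hc.le (abs_nonneg x), this]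
  ring

theorem abs_signedPow (q : ℝ) {x : ℝ} (hx : x ≠ 0) : |signedPow q x| = |x| ^ (q - 1) := by
  have h : 0 < |x| := abs_pos.2 hx
  rw [signedPow, abs_mul, abs_of_nonneg (by positivity)]
  nth_rw 2 [← Real.rpow_one |x|]
  rw [← Real.rpow_add h]
  congr 1
  ring

theorem signedPow_eq {q : ℝ} (hq : 1 < q) (x : ℝ) :
    signedPow q x = max x 0 ^ (q - 1) - max (-x) 0 ^ (q - 1) := by
  have h0 : (0 : ℝ) ^ (q - 1) = 0 := Real.zero_rpow (by linarith)
  rcases lt_trichotomy x 0 with h | rfl | h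
  · have := signedPow_of_pos q (neg_pos.2 h)
    rw [signedPow_neg] at this
    rw [max_eq_right h.le, max_eq_left (by linarith), h0]
    linarith
  · simp [signedPow_zero]
  · rw [max_eq_left h.le, max_eq_right (by linarith), h0, signedPow_of_pos q h, sub_zero]

theorem continuous_signedPow {q : ℝ} (hq : 1 < q) : Continuous (signedPow q) := by
  rw [funext (signedPow_eq hq)]
  have h : 0 ≤ q - 1 := by linarith
  exact ((continuous_id.max continuous_const).rpow_const fun _ => Or.inr h).sub
    ((continuous_neg.max continuous_const).rpow_const fun _ => Or.inr h)

theorem signedPow_strictMono {q : ℝ} (hq : 1 < q) : StrictMono (signedPow q) := by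
  intro x y hxy
  rcases lt_or_ge 0 y with hy | hy
  · rcases lt_or_ge 0 x with hx | hx
    · rw [signedPow_of_pos q hx, signedPow_of_pos q hy]
      exact Real.rpow_lt_rpow hx.le hxy (by linarith)
    · refine lt_of_le_of_lt ?_ (signedPow_pos q hy)
      rcases hx.eq_or_lt with rfl | hx
      · rw [signedPow_zero]
      · exact (signedPow_neg_of_neg q hx).le
  · have hx : 0 < -x := by linarith
    have h1 := signedPow_neg q x
    rw [signedPow_of_pos q hx] at h1
    rcases hy.eq_or_lt with rfl | hy
    · rw [signedPow_zero]
      exact signedPow_neg_of_neg q hxy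
    · have h2 := signedPow_neg q y
      rw [signedPow_of_pos q (neg_pos.2 hy)] at h2
      have := Real.rpow_lt_rpow (by linarith) (neg_lt_neg hxy) (show 0 < q - 1 by linarith)
      linarith

@[fun_prop]
theorem measurable_signedPow (q : ℝ) : Measurable (signedPow q) := by
  unfold signedPow
  fun_prop

/-- Mean value inequality on `[δ / 2, R]`, where the derivative `(q - 1) x^(q-2)` has a positive
minimum. Staying away from zero matters, as the derivative degenerates there for `q > 2`. -/
theorem exists_signedPow_sub_ge {q δ R : ℝ} (hq : 1 < q) (hδ : 0 < δ) (hR : δ ≤ R) :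
    ∃ c > 0, ∀ x ∈ Set.Icc δ R, ∀ h ∈ Set.Icc 0 (δ / 2),
      c * h ≤ signedPow q x - signedPow q (x - h) := by
  have hcont : ContinuousOn (fun x : ℝ => (q - 1) * x ^ (q - 1 - 1)) (Set.Icc (δ / 2) R) :=
    continuousOn_const.mul (continuousOn_id.rpow_const fun x hx =>
      Or.inl (by simp only [id]; linarith [hx.1]))
  obtain ⟨x₀, hx₀, hmin⟩ := isCompact_Icc.exists_isMinOn
    (Set.nonempty_Icc.2 (by linarith : δ / 2 ≤ R)) hcont
  refine ⟨(q - 1) * x₀ ^ (q - 1 - 1), ?_, ?_⟩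
  · have : 0 < x₀ := by linarith [hx₀.1]
    have : 0 < q - 1 := by linarith
    positivity
  · intro x hx h hh
    have h1 : 0 < x - h := by linarith [hx.1, hh.2]
    rw [signedPow_of_pos q (by linarith [hx.1]), signedPow_of_pos q h1]
    have hd : ∀ y ∈ Set.Icc (δ / 2) R, HasDerivAt (fun x : ℝ => x ^ (q - 1))
        ((q - 1) * y ^ (q - 1 - 1)) y := fun y hy =>
      Real.hasDerivAt_rpow_const (Or.inl (by linarith [hy.1]))
    have := (convex_Icc (δ / 2) R).mul_sub_le_image_sub_of_le_deriv
      (f := fun x : ℝ => x ^ (q - 1)) (C := (q - 1) * x₀ ^ (q - 1 - 1))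
      (fun y hy => (hd y hy).continuousAt.continuousWithinAt)
      (fun y hy => (hd y (interior_subset hy)).differentiableAt.differentiableWithinAt)
      (fun y hy => by
        rw [(hd y (interior_subset hy)).deriv]
        exact hmin (interior_subset hy))
      (x - h) ⟨by linarith [hx.1, hh.2], by linarith [hx.2, hh.1]⟩
      x ⟨by linarith [hx.1], hx.2⟩ (by linarith [hh.1])
    simpa using this

/-! ### The kernel as a function of the height, and its difference quotient -/

/-- The value of the kernel of order one at the point at hyperbolic distance `s` from the origin,
as a function of the height `t`. -/
noncomputable def ratio (s t : ℝ) : ℝ := (moebDen (-s) t)⁻¹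

theorem ratio_pos (s : ℝ) {t : ℝ} (ht : t ∈ Set.Icc (-1 : ℝ) 1) : 0 < ratio s t :=
  inv_pos.2 (moebDen_pos _ ht)

theorem ratio_zero (t : ℝ) : ratio 0 t = 1 := by simp [ratio, moebDen]

theorem continuousOn_ratio (s : ℝ) : ContinuousOn (ratio s) (Set.Icc (-1) 1) :=
  (continuousOn_moebDen _ _).inv₀ fun _ ht => (moebDen_pos _ ht).ne'

theorem ratio_mono {s : ℝ} (hs : 0 ≤ s) {t t' : ℝ}
    (ht' : t' ∈ Set.Icc (-1 : ℝ) 1) (h : t ≤ t') : ratio s t ≤ ratio s t' := by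
  refine inv_anti₀ (moebDen_pos _ ht') ?_
  have : 0 ≤ Real.sinh s := Real.sinh_nonneg_iff.2 hs
  simp only [moebDen, Real.sinh_neg, Real.cosh_neg]
  nlinarith

/-- The positive factor in `diffQuot`. -/
noncomputable def diffFactor (m : ℕ) (x x₀ : ℝ) : ℝ :=
  x * x₀ * ∑ i ∈ Finset.range m, x ^ i * x₀ ^ (m - 1 - i)

/-- The difference quotient `(ratio s t ^ m - ratio s t₀ ^ m) / sinh s`, extended continuously to
`s = 0`. -/
noncomputable def diffQuot (m : ℕ) (s t₀ t : ℝ) : ℝ :=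
  (t - t₀) * diffFactor m (ratio s t) (ratio s t₀)

theorem diffFactor_pos {m : ℕ} (hm : 0 < m) {x x₀ : ℝ} (hx : 0 < x) (hx₀ : 0 < x₀) :
    0 < diffFactor m x x₀ :=
  mul_pos (mul_pos hx hx₀)
    (Finset.sum_pos (fun i _ => by positivity) (Finset.nonempty_range_iff.2 hm.ne'))

/-- The reciprocal of `ratio s` is affine in `t` with slope `-sinh s`, so a difference of ratios
contains `sinh s * (t - t₀)`; the geometric sum passes to `m`-th powers. -/
theorem sinh_mul_diffQuot (m : ℕ) (s : ℝ) {t t₀ : ℝ} (ht : t ∈ Set.Icc (-1 : ℝ) 1)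
    (ht₀ : t₀ ∈ Set.Icc (-1 : ℝ) 1) :
    Real.sinh s * diffQuot m s t₀ t = ratio s t ^ m - ratio s t₀ ^ m := by
  have h1 := moebDen_pos (-s) ht
  have h2 := moebDen_pos (-s) ht₀
  have h3 : ratio s t - ratio s t₀ = Real.sinh s * (t - t₀) * (ratio s t * ratio s t₀) := by
    unfold ratio
    field_simp
    simp only [moebDen, Real.sinh_neg, Real.cosh_neg]
    ring
  rw [← geom_sum₂_mul, h3, diffQuot, diffFactor]
  ring

/-- Changing the reference height changes the subtracted constant only, hence shifts the quotient by
a number. At `s = 0` one cannot divide by `sinh s`, and the formula is checked directly. -/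
theorem diffQuot_sub (m : ℕ) (s : ℝ) {t t₀ t₁ : ℝ} (ht : t ∈ Set.Icc (-1 : ℝ) 1)
    (ht₀ : t₀ ∈ Set.Icc (-1 : ℝ) 1) (ht₁ : t₁ ∈ Set.Icc (-1 : ℝ) 1) :
    diffQuot m s t₁ t = diffQuot m s t₀ t - diffQuot m s t₀ t₁ := by
  rcases eq_or_ne s 0 with rfl | hs
  · simp only [diffQuot, ratio_zero]
    ring
  · have h : Real.sinh s ≠ 0 := by simpa using hs
    refine mul_left_cancel₀ h ?_
    rw [mul_sub, sinh_mul_diffQuot m s ht ht₁, sinh_mul_diffQuot m s ht ht₀,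
      sinh_mul_diffQuot m s ht₁ ht₀]
    ring

theorem continuousOn_diffQuot₂ (m : ℕ) (s : ℝ) :
    ContinuousOn (fun z : ℝ × ℝ => diffQuot m s z.1 z.2) (Set.Icc (-1) 1 ×ˢ Set.Icc (-1) 1) := by
  have h1 : ContinuousOn (fun z : ℝ × ℝ => ratio s z.1) (Set.Icc (-1) 1 ×ˢ Set.Icc (-1) 1) :=
    (continuousOn_ratio s).comp continuousOn_fst fun z hz => hz.1
  have h2 : ContinuousOn (fun z : ℝ × ℝ => ratio s z.2) (Set.Icc (-1) 1 ×ˢ Set.Icc (-1) 1) :=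
    (continuousOn_ratio s).comp continuousOn_snd fun z hz => hz.2
  unfold diffQuot diffFactor
  fun_prop

theorem continuousOn_diffQuot (m : ℕ) (s : ℝ) {t₀ : ℝ} (ht₀ : t₀ ∈ Set.Icc (-1 : ℝ) 1) :
    ContinuousOn (diffQuot m s t₀) (Set.Icc (-1) 1) :=
  (continuousOn_diffQuot₂ m s).comp (by fun_prop : ContinuousOn (fun t => (t₀, t)) _)
    fun _ ht => ⟨ht₀, ht⟩

@[fun_prop]
theorem measurable_diffQuot (m : ℕ) (s t₀ : ℝ) : Measurable (diffQuot m s t₀) := by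
  unfold diffQuot diffFactor ratio moebDen
  fun_prop

theorem diffQuot_pos {m : ℕ} (hm : 0 < m) (s : ℝ) {t t₀ : ℝ} (ht : t ∈ Set.Icc (-1 : ℝ) 1)
    (ht₀ : t₀ ∈ Set.Icc (-1 : ℝ) 1) (h : t₀ < t) : 0 < diffQuot m s t₀ t :=
  mul_pos (by linarith) (diffFactor_pos hm (ratio_pos s ht) (ratio_pos s ht₀))

theorem diffQuot_neg {m : ℕ} (hm : 0 < m) (s : ℝ) {t t₀ : ℝ} (ht : t ∈ Set.Icc (-1 : ℝ) 1)
    (ht₀ : t₀ ∈ Set.Icc (-1 : ℝ) 1) (h : t < t₀) : diffQuot m s t₀ t < 0 :=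
  mul_neg_of_neg_of_pos (by linarith) (diffFactor_pos hm (ratio_pos s ht) (ratio_pos s ht₀))

theorem diffQuot_ne_zero {m : ℕ} (hm : 0 < m) (s : ℝ) {t t₀ : ℝ} (ht : t ∈ Set.Icc (-1 : ℝ) 1)
    (ht₀ : t₀ ∈ Set.Icc (-1 : ℝ) 1) (h : t ≠ t₀) : diffQuot m s t₀ t ≠ 0 := by
  rcases lt_or_gt_of_ne h with h | h
  · exact (diffQuot_neg hm s ht ht₀ h).ne
  · exact (diffQuot_pos hm s ht ht₀ h).ne'

theorem diffFactor_ratio_mono {m : ℕ} {s : ℝ} (hs : 0 ≤ s) {t₀ t t' : ℝ}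
    (ht₀ : t₀ ∈ Set.Icc (-1 : ℝ) 1) (ht : t ∈ Set.Icc (-1 : ℝ) 1) (ht' : t' ∈ Set.Icc (-1 : ℝ) 1)
    (h : t ≤ t') : diffFactor m (ratio s t) (ratio s t₀) ≤ diffFactor m (ratio s t') (ratio s t₀) := by
  have h1 := ratio_mono hs ht' h
  have h2 := ratio_pos s ht
  have h3 := ratio_pos s ht₀
  have h4 := ratio_pos s ht'
  unfold diffFactor
  gcongr

theorem integral_pos_of_ae_pos {α : Type*} [MeasurableSpace α] {μ : Measure α} [NeZero μ]
    {f : α → ℝ} (hf : Integrable f μ) (h : ∀ᵐ x ∂μ, 0 < f x) : 0 < ∫ x, f x ∂μ := by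
  rw [integral_pos_iff_support_of_nonneg_ae (h.mono fun x hx => hx.le) hf]
  have : Function.support f =ᵐ[μ] Set.univ := by
    filter_upwards [h] with x hx
    exact propext ⟨fun _ => trivial, fun _ => hx.ne'⟩
  rw [measure_congr this]
  exact NeZero.pos _

theorem ae_zonal_ne (t₀ : ℝ) : ∀ᵐ t ∂(zonal m), t ≠ t₀ := by
  simp [ae_iff]

/-! ### The Euler-Lagrange equation and its unique solution -/

/-- The Euler-Lagrange expression of the problem of approximating the kernel by constants. -/
noncomputable def eulerLagrange (m : ℕ) (q s t₀ : ℝ) : ℝ :=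
  ∫ t, signedPow q (diffQuot m s t₀ t) ∂(zonal m)

theorem continuousOn_signedPow_diffQuot {m : ℕ} {q : ℝ} (hq : 1 < q) (s : ℝ) {t₀ : ℝ}
    (ht₀ : t₀ ∈ Set.Icc (-1 : ℝ) 1) :
    ContinuousOn (fun t => signedPow q (diffQuot m s t₀ t)) (Set.Icc (-1) 1) :=
  (continuous_signedPow hq).comp_continuousOn (continuousOn_diffQuot m s ht₀)

theorem integrable_signedPow_diffQuot {q : ℝ} (hq : 1 < q) (s : ℝ) {t₀ : ℝ}
    (ht₀ : t₀ ∈ Set.Icc (-1 : ℝ) 1) :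
    Integrable (fun t => signedPow q (diffQuot m s t₀ t)) (zonal m) :=
  integrable_zonal_of_continuousOn (continuousOn_signedPow_diffQuot hq s ht₀)

theorem continuousOn_eulerLagrange {q : ℝ} (hq : 1 < q) (s : ℝ) :
    ContinuousOn (eulerLagrange m q s) (Set.Icc (-1) 1) := by
  have hc : ContinuousOn (fun z : ℝ × ℝ => signedPow q (diffQuot m s z.1 z.2))
      (Set.Icc (-1) 1 ×ˢ Set.Icc (-1) 1) :=
    (continuous_signedPow hq).comp_continuousOn (continuousOn_diffQuot₂ m s)
  obtain ⟨R, hR⟩ := (isCompact_Icc.prod isCompact_Icc).exists_bound_of_continuousOn hc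
  refine continuousOn_of_dominated (bound := fun _ => R)
    (fun t₀ ht₀ => (integrable_signedPow_diffQuot hq s ht₀).1) (fun t₀ ht₀ => ?_)
    (integrable_const R) ?_
  · filter_upwards [ae_zonal_mem_Icc m] with t ht
    exact hR (t₀, t) ⟨ht₀, ht⟩
  · filter_upwards [ae_zonal_mem_Icc m] with t ht
    exact ContinuousOn.comp (f := fun t₀ : ℝ => (t₀, t)) (s := Set.Icc (-1) 1) hc
      (by fun_prop) fun _ h => ⟨h, ht⟩

theorem two_le_fact : 2 ≤ m := Fact.out

theorem dim_pos : 0 < m := by have := two_le_fact (m := m); omega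

/-- Raising the reference height lowers `diffQuot` by a positive constant, and the signed power is
strictly increasing. -/
theorem eulerLagrange_strictAntiOn {q : ℝ} (hq : 1 < q) (s : ℝ) :
    StrictAntiOn (eulerLagrange m q s) (Set.Icc (-1) 1) := by
  intro t₀ ht₀ t₁ ht₁ h
  have h1 : 0 < ∫ t, (signedPow q (diffQuot m s t₀ t) - signedPow q (diffQuot m s t₁ t))
      ∂(zonal m) := by
    refine integral_pos_of_ae_pos ((integrable_signedPow_diffQuot hq s ht₀).sub
      (integrable_signedPow_diffQuot hq s ht₁)) ?_
    filter_upwards [ae_zonal_mem_Icc m] with t ht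
    rw [diffQuot_sub m s ht ht₀ ht₁, sub_pos]
    exact signedPow_strictMono hq (sub_lt_self _ (diffQuot_pos dim_pos s ht₁ ht₀ h))
  rw [integral_sub (integrable_signedPow_diffQuot hq s ht₀)
    (integrable_signedPow_diffQuot hq s ht₁)] at h1
  exact sub_pos.1 h1

theorem eulerLagrange_one_neg {q : ℝ} (hq : 1 < q) (s : ℝ) : eulerLagrange m q s 1 < 0 := by
  have h1 : (1 : ℝ) ∈ Set.Icc (-1 : ℝ) 1 := by norm_num
  have := integral_pos_of_ae_pos (integrable_signedPow_diffQuot (m := m) hq s h1).neg (by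
    filter_upwards [ae_zonal_mem_Ioo m] with t ht
    simpa using signedPow_neg_of_neg q
      (diffQuot_neg (m := m) dim_pos s (Set.Ioo_subset_Icc_self ht) h1 ht.2))
  simp only [Pi.neg_apply, integral_neg] at this
  simpa [eulerLagrange] using this

theorem eulerLagrange_neg_one_pos {q : ℝ} (hq : 1 < q) (s : ℝ) : 0 < eulerLagrange m q s (-1) := by
  have h1 : (-1 : ℝ) ∈ Set.Icc (-1 : ℝ) 1 := by norm_num
  refine integral_pos_of_ae_pos (integrable_signedPow_diffQuot (m := m) hq s h1) ?_
  filter_upwards [ae_zonal_mem_Ioo m] with t ht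
  exact signedPow_pos q (diffQuot_pos (m := m) dim_pos s (Set.Ioo_subset_Icc_self ht) h1 ht.1)

/-- Pair `t` with `-t`: for `s ≥ 0` the positive factor in `diffQuot` grows with the height, so the
positive half outweighs the negative one. Hence the critical height is nonnegative, which the
monotonicity of the distance requires. -/
theorem eulerLagrange_zero_nonneg {q : ℝ} (hq : 1 < q) {s : ℝ} (hs : 0 ≤ s) :
    0 ≤ eulerLagrange m q s 0 := by
  have h0 : (0 : ℝ) ∈ Set.Icc (-1 : ℝ) 1 := by norm_num
  have hi := integrable_signedPow_diffQuot (m := m) hq s h0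
  have h1 : ∫ t, signedPow q (diffQuot m s 0 (-t)) ∂(zonal m) = eulerLagrange m q s 0 :=
    integral_zonal_neg (fun t => signedPow q (diffQuot m s 0 t))
  have hi' : Integrable (fun t => signedPow q (diffQuot m s 0 (-t))) (zonal m) :=
    (measurePreserving_neg_zonal.integrable_comp_emb
      (MeasurableEquiv.neg ℝ).measurableEmbedding).2 hi
  have h2 : 0 ≤ ∫ t, (signedPow q (diffQuot m s 0 t) + signedPow q (diffQuot m s 0 (-t)))
      ∂(zonal m) := by
    refine integral_nonneg_of_ae ?_
    filter_upwards [ae_zonal_mem_Icc m] with t ht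
    have ht' : -t ∈ Set.Icc (-1 : ℝ) 1 := ⟨by linarith [ht.2], by linarith [ht.1]⟩
    have h3 : -diffQuot m s 0 (-t) ≤ diffQuot m s 0 t := by
      simp only [diffQuot, sub_zero]
      rcases le_total 0 t with h | h
      · have := diffFactor_ratio_mono (m := m) hs h0 ht' ht (by linarith)
        nlinarith
      · have := diffFactor_ratio_mono (m := m) hs h0 ht ht' (by linarith)
        nlinarith
    have h4 := (signedPow_strictMono hq).monotone h3
    rw [signedPow_neg] at h4
    simp only [Pi.zero_apply]
    linarith
  rw [integral_add hi hi', h1] at h2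
  have : eulerLagrange m q s 0 = ∫ t, signedPow q (diffQuot m s 0 t) ∂(zonal m) := rfl
  linarith

/-- Intermediate values. The strict signs at `±1` keep the zero off the end points, where it would
have no coordinate `b`. -/
theorem exists_eulerLagrange_eq_zero {q : ℝ} (hq : 1 < q) (s : ℝ) :
    ∃ b : ℝ, eulerLagrange m q s (Real.tanh b) = 0 := by
  obtain ⟨t₀, ht₀, h⟩ := intermediate_value_Icc' (by norm_num : (-1 : ℝ) ≤ 1)
    (continuousOn_eulerLagrange (m := m) hq s)
    ⟨(eulerLagrange_one_neg hq s).le, (eulerLagrange_neg_one_pos hq s).le⟩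
  have h1 : t₀ ∈ Set.Ioo (-1 : ℝ) 1 := by
    refine ⟨lt_of_le_of_ne ht₀.1 ?_, lt_of_le_of_ne ht₀.2 ?_⟩
    · rintro rfl
      exact (eulerLagrange_neg_one_pos (m := m) hq s).ne' h
    · rintro rfl
      exact (eulerLagrange_one_neg (m := m) hq s).ne h
  obtain ⟨b, -, rfl⟩ := Real.tanh_surjOn h1
  exact ⟨b, h⟩

theorem tanh_mem_Icc (y : ℝ) : Real.tanh y ∈ Set.Icc (-1 : ℝ) 1 :=
  Set.Ioo_subset_Icc_self (tanh_mem_Ioo y)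

/-- The solution `b` of the Euler-Lagrange equation at height `tanh b`. -/
noncomputable def critPoint (m : ℕ) [Fact (2 ≤ m)] {q : ℝ} (hq : 1 < q) (s : ℝ) : ℝ :=
  (exists_eulerLagrange_eq_zero (m := m) hq s).choose

theorem eulerLagrange_critPoint {q : ℝ} (hq : 1 < q) (s : ℝ) :
    eulerLagrange m q s (Real.tanh (critPoint m hq s)) = 0 :=
  (exists_eulerLagrange_eq_zero (m := m) hq s).choose_spec

theorem eq_critPoint {q : ℝ} (hq : 1 < q) {s b : ℝ} (h : eulerLagrange m q s (Real.tanh b) = 0) :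
    b = critPoint m hq s :=
  Real.tanh_injective ((eulerLagrange_strictAntiOn (m := m) hq s).injOn (tanh_mem_Icc _)
    (tanh_mem_Icc _) (h.trans (eulerLagrange_critPoint hq s).symm))

theorem tanh_critPoint_nonneg {q : ℝ} (hq : 1 < q) {s : ℝ} (hs : 0 ≤ s) :
    0 ≤ Real.tanh (critPoint m hq s) := by
  by_contra h
  have := eulerLagrange_strictAntiOn (m := m) hq s (tanh_mem_Icc (critPoint m hq s))
    (by norm_num) (not_le.1 h)
  rw [eulerLagrange_critPoint] at this
  exact absurd this (eulerLagrange_zero_nonneg hq hs).not_gt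

/-- A quantitative form of the monotonicity of the Euler-Lagrange expression. -/
theorem exists_eulerLagrange_sub_ge {q : ℝ} (hq : 1 < q) (s : ℝ) {t₀ : ℝ}
    (ht₀ : t₀ ∈ Set.Ioo (-1 : ℝ) 1) : ∃ c > 0, ∀ᶠ t₁ in nhdsWithin t₀ (Set.Ioi t₀),
      c * (t₁ - t₀) ≤ eulerLagrange m q s t₀ - eulerLagrange m q s t₁ := by
  have ht₀' := Set.Ioo_subset_Icc_self ht₀
  -- On `[a, 1]`, beyond the midpoint of `t₀` and `1`, the quotient stays in a compact subset of
  -- `(0, ∞)`, where the signed power has a lower slope bound; elsewhere monotonicity suffices.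
  set a := (1 + t₀) / 2 with ha_def
  have ha : a ∈ Set.Icc (-1 : ℝ) 1 := ⟨by linarith [ht₀.1], by linarith [ht₀.2]⟩
  have hta : t₀ < a := by linarith [ht₀.2]
  have hsub : Set.Icc a 1 ⊆ Set.Icc (-1 : ℝ) 1 := Set.Icc_subset_Icc_left ha.1
  have hc := continuousOn_diffQuot m s ht₀'
  obtain ⟨y, hy, hmin⟩ := isCompact_Icc.exists_isMinOn (Set.nonempty_Icc.2 ha.2) (hc.mono hsub)
  obtain ⟨z, hz, hmax⟩ := isCompact_Icc.exists_isMaxOn (Set.nonempty_Icc.2 ha.2) (hc.mono hsub)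
  set δ := diffQuot m s t₀ y
  set R := diffQuot m s t₀ z
  have hδ : 0 < δ := diffQuot_pos dim_pos s (hsub hy) ht₀' (by linarith [hy.1])
  obtain ⟨c, hc0, hcc⟩ := exists_signedPow_sub_ge hq hδ (show δ ≤ R from hmin hz)
  -- the lower bound for the factor relating `diffQuot m s t₀ t₁` to `t₁ - t₀`
  have hK : ContinuousOn (fun t => diffFactor m (ratio s t) (ratio s t₀)) (Set.Icc (-1) 1) := by
    have := continuousOn_ratio s
    unfold diffFactor
    fun_prop
  obtain ⟨w, hw, hwmin⟩ := isCompact_Icc.exists_isMinOn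
    (Set.nonempty_Icc.2 (by norm_num : (-1 : ℝ) ≤ 1)) hK
  set k := diffFactor m (ratio s w) (ratio s t₀)
  have hk : 0 < k := diffFactor_pos dim_pos (ratio_pos s hw) (ratio_pos s ht₀')
  have hA : 0 < (zonal m).real (Set.Ioo a 1) :=
    ENNReal.toReal_pos (zonal_Ioo_pos (by linarith [ht₀.2]) ha.1 le_rfl).ne' (measure_ne_top _ _)
  refine ⟨c * k * (zonal m).real (Set.Ioo a 1), by positivity, ?_⟩
  have h1 : ∀ᶠ t₁ in nhdsWithin t₀ (Set.Ioi t₀), diffQuot m s t₀ t₁ < δ / 2 := by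
    have hca : ContinuousAt (diffQuot m s t₀) t₀ :=
      hc.continuousAt (Icc_mem_nhds ht₀.1 ht₀.2)
    have h2 : diffQuot m s t₀ t₀ < δ / 2 := by
      simp only [diffQuot, sub_self, zero_mul]
      linarith
    exact (hca.eventually (gt_mem_nhds h2)).filter_mono nhdsWithin_le_nhds
  filter_upwards [h1, self_mem_nhdsWithin, mem_nhdsWithin_of_mem_nhds (Iio_mem_nhds hta)]
    with t₁ h1 (h2 : t₀ < t₁) (h3 : t₁ < a)
  have ht₁ : t₁ ∈ Set.Icc (-1 : ℝ) 1 := ⟨by linarith [ht₀.1], by linarith [ha.2]⟩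
  have hd : 0 < diffQuot m s t₀ t₁ := diffQuot_pos dim_pos s ht₁ ht₀' h2
  have h4 : (t₁ - t₀) * k ≤ diffQuot m s t₀ t₁ :=
    mul_le_mul_of_nonneg_left (hwmin ht₁) (by linarith)
  have hi₀ := integrable_signedPow_diffQuot (m := m) hq s ht₀'
  have hi₁ := integrable_signedPow_diffQuot (m := m) hq s ht₁
  rw [eulerLagrange, eulerLagrange, ← integral_sub hi₀ hi₁]
  calc c * k * (zonal m).real (Set.Ioo a 1) * (t₁ - t₀)
      ≤ (zonal m).real (Set.Ioo a 1) * (c * diffQuot m s t₀ t₁) := by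
        have := mul_le_mul_of_nonneg_left h4 (mul_pos hA hc0).le
        linarith
    _ = ∫ t in Set.Ioo a 1, c * diffQuot m s t₀ t₁ ∂(zonal m) := by
        rw [setIntegral_const, smul_eq_mul]
    _ ≤ ∫ t in Set.Ioo a 1, (signedPow q (diffQuot m s t₀ t) - signedPow q (diffQuot m s t₁ t))
          ∂(zonal m) := by
        refine setIntegral_mono_on (integrable_const _).integrableOn (hi₀.sub hi₁).integrableOn
          measurableSet_Ioo fun t ht => ?_
        have ht' := Set.Ioo_subset_Icc_self ht
        rw [diffQuot_sub m s (hsub ht') ht₀' ht₁]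
        exact hcc _ ⟨hmin ht', hmax ht'⟩ _ ⟨hd.le, h1.le⟩
    _ ≤ _ := by
        refine setIntegral_le_integral (hi₀.sub hi₁) ?_
        filter_upwards [ae_zonal_mem_Icc m] with t ht
        simp only [Pi.zero_apply]
        rw [diffQuot_sub m s ht ht₀' ht₁, sub_nonneg]
        exact (signedPow_strictMono hq).monotone (by linarith)

/-! ### Smooth dependence on the parameters -/

open scoped ContDiff in
/-- Smooth dependence on the parameter of an integral over `[-1, 1]`, with a merely integrable
weight. -/
theorem contDiff_integral_mul {P : Type*} [NormedAddCommGroup P] [NormedSpace ℝ P]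
    {μ : Measure ℝ} (hμ : ∀ᵐ t ∂μ, t ∈ Set.Icc (-1 : ℝ) 1) {f : ℝ → ℝ} (hf : Integrable f μ)
    {g : P → ℝ → ℝ} {W : Set (P × ℝ)} (hW : IsOpen W) (hg : ContDiffOn ℝ ∞ (Function.uncurry g) W)
    (hgW : ∀ p, ∀ t ∈ Set.Icc (-1 : ℝ) 1, (p, t) ∈ W) :
    ContDiff ℝ ∞ fun p => ∫ t, f t * g p t ∂μ := by
  rw [contDiff_iff_contDiffAt]
  intro p₀
  obtain ⟨u, v, hu, hv, hpu, hcv, huv⟩ := generalized_tube_lemma (isCompact_singleton (x := p₀))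
    (isCompact_Icc (a := (-1 : ℝ)) (b := 1)) hW (by
      rintro ⟨p, t⟩ ⟨hp, ht⟩
      exact hgW p t ht)
  have hIcc : Set.Icc (-1 : ℝ) 1 = closedBall 0 1 := by
    rw [Real.closedBall_eq_Icc]
    norm_num
  obtain ⟨δ, hδ, hδv⟩ := (isCompact_Icc (a := (-1 : ℝ)) (b := 1)).exists_cthickening_subset_open
    hv hcv
  rw [hIcc, cthickening_closedBall hδ.le zero_le_one] at hδv
  let χ : ContDiffBump (0 : ℝ) := ⟨1, δ + 1, one_pos, by linarith⟩
  -- The integral is the convolution of `f` with `G p` at the point `0`, whence the reflection `-t`.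
  -- The cutoff `χ` gives compact support and equals `1` on `[-1, 1]`.
  let G : P → ℝ → ℝ := fun p t => χ (-t) * g p (-t)
  have hG : ContDiffOn ℝ ∞ (Function.uncurry G) (u ×ˢ Set.univ) := by
    rintro ⟨p, t⟩ ⟨hp, -⟩
    apply ContDiffAt.contDiffWithinAt
    by_cases ht : -t ∈ closedBall (0 : ℝ) (δ + 1)
    · have h1 : ContDiffAt ℝ ∞ (Function.uncurry g) (p, -t) :=
        hg.contDiffAt (hW.mem_nhds (huv ⟨hp, hδv ht⟩))
      have h2 : ContDiffAt ℝ ∞ (fun z : P × ℝ => Function.uncurry g (z.1, -z.2)) (p, t) :=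
        ContDiffAt.comp (p, t) (f := fun z : P × ℝ => (z.1, -z.2)) h1
          (contDiff_fst.prodMk contDiff_snd.neg).contDiffAt
      have h3 : ContDiff ℝ ∞ fun z : P × ℝ => χ (-z.2) :=
        χ.contDiff.comp (by fun_prop)
      exact h3.contDiffAt.mul h2
    · have hev : Function.uncurry G =ᶠ[nhds (p, t)] fun _ => 0 := by
        have hopen : IsOpen {z : P × ℝ | -z.2 ∉ closedBall (0 : ℝ) (δ + 1)} :=
          isClosed_closedBall.isOpen_compl.preimage (by fun_prop)
        filter_upwards [hopen.mem_nhds ht] with z hz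
        have : χ (-z.2) = 0 := χ.zero_of_le_dist (by
          simp only [mem_closedBall, not_le] at hz
          exact hz.le)
        simp [Function.uncurry, G, this]
      exact contDiffAt_const.congr_of_eventuallyEq hev
  have hsupp : ∀ p, ∀ t, p ∈ u → t ∉ closedBall (0 : ℝ) (δ + 1) → G p t = 0 := by
    intro p t _ ht
    have : χ (-t) = 0 := χ.zero_of_le_dist (by
      simp only [mem_closedBall, not_le, dist_zero_right, norm_neg] at ht ⊢
      exact ht.le)
    simp [G, this]
  have hconv := contDiffOn_convolution_right_with_param_comp (μ := μ) (n := ⊤)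
    (ContinuousLinearMap.mul ℝ ℝ) (v := fun _ : P => (0 : ℝ)) contDiffOn_const hu
    (isCompact_closedBall (0 : ℝ) (δ + 1)) hsupp hf.locallyIntegrable hG
  refine (hconv.contDiffAt (hu.mem_nhds (hpu rfl))).congr_of_eventuallyEq
    (Filter.Eventually.of_forall fun p => ?_)
  refine integral_congr_ae ?_
  filter_upwards [hμ] with t ht
  have : χ t = 1 := χ.one_of_mem_closedBall (by rwa [← hIcc])
  simp [G, this]

/-- The quotient of `diffQuot m s (tanh b) t` by `τ`, where `t` is the Möbius image of `τ`. -/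
noncomputable def moebFactor (m : ℕ) (s b τ : ℝ) : ℝ :=
  (Real.cosh b * moebDen b τ)⁻¹ *
    diffFactor m (moebDen b τ / moebDen (b - s) τ) (Real.cosh b / Real.cosh (b - s))

/-- The cocycle identity of the Möbius factors: in the coordinate `y` the numbers `b` and `-s` are
successive translations. -/
theorem moebDen_neg_moeb (s b : ℝ) {τ : ℝ} (hτ : moebDen b τ ≠ 0) :
    moebDen (-s) (moeb b τ) = moebDen (b - s) τ / moebDen b τ := by
  rw [eq_div_iff hτ]
  nth_rw 1 [moebDen]
  rw [moeb]
  field_simp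
  rw [moebDen, moebDen, Real.cosh_sub, Real.sinh_sub, Real.sinh_neg, Real.cosh_neg]
  ring

/-- The zero of the quotient sits at `τ = 0` for all parameters. Powers of `|diffQuot|` therefore
split into a fixed power of `|τ|` and a power of a smooth positive factor. -/
theorem diffQuot_moeb (m : ℕ) (s b : ℝ) {τ : ℝ} (hτ : τ ∈ Set.Icc (-1 : ℝ) 1) :
    diffQuot m s (Real.tanh b) (moeb b τ) = τ * moebFactor m s b τ := by
  have h1 := moebDen_pos b hτ
  have h2 := moebDen_pos (b - s) hτ
  have h3 := Real.cosh_pos b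
  have h4 := Real.cosh_pos (b - s)
  have h5 : ratio s (moeb b τ) = moebDen b τ / moebDen (b - s) τ := by
    rw [ratio, moebDen_neg_moeb s b h1.ne', inv_div]
  have h6 : ratio s (Real.tanh b) = Real.cosh b / Real.cosh (b - s) := by
    rw [ratio, moebDen_tanh, inv_div, sub_eq_add_neg]
  have h7 : moeb b τ - Real.tanh b = τ * (Real.cosh b * moebDen b τ)⁻¹ := by
    rw [moeb, Real.tanh_eq_sinh_div_cosh]
    field_simp
    rw [moebDen]
    linear_combination τ * Real.cosh_sq_sub_sinh_sq b
  rw [diffQuot, h5, h6, h7, moebFactor]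
  ring

theorem moebFactor_pos {m : ℕ} (hm : 0 < m) {s b τ : ℝ} (h1 : 0 < moebDen b τ)
    (h2 : 0 < moebDen (b - s) τ) : 0 < moebFactor m s b τ := by
  have h3 := Real.cosh_pos b
  have h4 := Real.cosh_pos (b - s)
  exact mul_pos (by positivity) (diffFactor_pos hm (by positivity) (by positivity))

/-- The domain of smoothness of `moebFactor`. -/
def moebDomain : Set ((ℝ × ℝ) × ℝ) :=
  {z | 0 < moebDen z.1.2 z.2} ∩ {z | 0 < moebDen (z.1.2 - z.1.1) z.2}

open scoped ContDiff in
theorem contDiff_moebDen {P : Type*} [NormedAddCommGroup P] [NormedSpace ℝ P] {f g : P → ℝ}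
    (hf : ContDiff ℝ ∞ f) (hg : ContDiff ℝ ∞ g) : ContDiff ℝ ∞ fun z => moebDen (f z) (g z) := by
  unfold moebDen
  fun_prop

theorem isOpen_moebDomain : IsOpen moebDomain :=
  (isOpen_lt continuous_const
    (contDiff_moebDen (by fun_prop) (by fun_prop)).continuous).inter (isOpen_lt continuous_const
    (contDiff_moebDen (by fun_prop) (by fun_prop)).continuous)

open scoped ContDiff in
theorem contDiffOn_moebFactor (m : ℕ) :
    ContDiffOn ℝ ∞ (fun z : (ℝ × ℝ) × ℝ => moebFactor m z.1.1 z.1.2 z.2) moebDomain := by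
  have h1 : ContDiff ℝ ∞ fun z : (ℝ × ℝ) × ℝ => moebDen z.1.2 z.2 :=
    contDiff_moebDen (by fun_prop) (by fun_prop)
  have h2 : ContDiff ℝ ∞ fun z : (ℝ × ℝ) × ℝ => moebDen (z.1.2 - z.1.1) z.2 :=
    contDiff_moebDen (by fun_prop) (by fun_prop)
  have h3 : ContDiff ℝ ∞ fun z : (ℝ × ℝ) × ℝ => Real.cosh z.1.2 := by fun_prop
  have h4 : ContDiff ℝ ∞ fun z : (ℝ × ℝ) × ℝ => Real.cosh (z.1.2 - z.1.1) := by fun_prop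
  have h5 : ContDiffOn ℝ ∞ (fun z : (ℝ × ℝ) × ℝ =>
      moebDen z.1.2 z.2 / moebDen (z.1.2 - z.1.1) z.2) moebDomain :=
    h1.contDiffOn.div h2.contDiffOn fun z hz =>
      (show 0 < moebDen (z.1.2 - z.1.1) z.2 from hz.2).ne'
  have h6 : ContDiffOn ℝ ∞ (fun z : (ℝ × ℝ) × ℝ =>
      Real.cosh z.1.2 / Real.cosh (z.1.2 - z.1.1)) moebDomain :=
    h3.contDiffOn.div h4.contDiffOn fun z _ => (Real.cosh_pos _).ne'
  have h7 : ContDiffOn ℝ ∞ (fun z : (ℝ × ℝ) × ℝ =>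
      (Real.cosh z.1.2 * moebDen z.1.2 z.2)⁻¹) moebDomain :=
    (h3.mul h1).contDiffOn.inv fun z hz =>
      (mul_pos (Real.cosh_pos _) (show 0 < moebDen z.1.2 z.2 from hz.1)).ne'
  unfold moebFactor diffFactor
  exact h7.mul ((h5.mul h6).mul (ContDiffOn.sum fun i _ => (h5.pow i).mul (h6.pow _)))

/-- The integral `∫ f(τ) κ(s, b, τ)^a (cosh b + τ sinh b)⁻ᵐ dν(τ)`, the common form of the
Euler-Lagrange expression and of the distance of the kernel to the constants. -/
noncomputable def moebIntegral (m : ℕ) (f : ℝ → ℝ) (a : ℝ) (p : ℝ × ℝ) : ℝ :=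
  ∫ τ, f τ * (moebFactor m p.1 p.2 τ ^ a * (moebDen p.2 τ ^ m)⁻¹) ∂(zonal m)

open scoped ContDiff in
theorem contDiff_moebIntegral {f : ℝ → ℝ} (hf : Integrable f (zonal m)) (a : ℝ) :
    ContDiff ℝ ∞ (moebIntegral m f a) := by
  have h1 : ContDiff ℝ ∞ fun z : (ℝ × ℝ) × ℝ => moebDen z.1.2 z.2 :=
    contDiff_moebDen (by fun_prop) (by fun_prop)
  have h2 : ContDiffOn ℝ ∞ (fun z : (ℝ × ℝ) × ℝ => moebFactor m z.1.1 z.1.2 z.2 ^ a)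
      moebDomain :=
    (contDiffOn_moebFactor m).rpow_const_of_ne fun z hz => (moebFactor_pos dim_pos hz.1 hz.2).ne'
  have h3 : ContDiffOn ℝ ∞ (fun z : (ℝ × ℝ) × ℝ => (moebDen z.1.2 z.2 ^ m)⁻¹) moebDomain :=
    (h1.pow m).contDiffOn.inv fun z hz => (pow_pos (show 0 < moebDen z.1.2 z.2 from hz.1) m).ne'
  let g : ℝ × ℝ → ℝ → ℝ := fun p τ => moebFactor m p.1 p.2 τ ^ a * (moebDen p.2 τ ^ m)⁻¹
  have h4 : ContDiffOn ℝ ∞ (Function.uncurry g) moebDomain := h2.mul h3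
  have h5 : ∀ p : ℝ × ℝ, ∀ t ∈ Set.Icc (-1 : ℝ) 1, (p, t) ∈ moebDomain :=
    fun p t ht => ⟨moebDen_pos _ ht, moebDen_pos _ ht⟩
  exact contDiff_integral_mul (ae_zonal_mem_Icc m) hf isOpen_moebDomain h4 h5

theorem eulerLagrange_eq_moebIntegral {q : ℝ} (hq : 1 < q) (s b : ℝ) :
    eulerLagrange m q s (Real.tanh b) = moebIntegral m (signedPow q) (q - 1) (s, b) := by
  rw [eulerLagrange, integral_zonal_moeb b (continuousOn_signedPow_diffQuot hq s (tanh_mem_Icc b))]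
  refine integral_congr_ae ?_
  filter_upwards [ae_zonal_mem_Icc m] with τ hτ
  rw [diffQuot_moeb m s b hτ, mul_comm τ, signedPow_mul q
    (moebFactor_pos dim_pos (moebDen_pos _ hτ) (moebDen_pos _ hτ))]
  ring

/-- The distance in `L^q` of `ratio s · ^ m` to the constant `ratio s t₀ ^ m`, to the power `q` and
divided by `(sinh s)^q`. -/
noncomputable def distPow (m : ℕ) (q s t₀ : ℝ) : ℝ := ∫ t, |diffQuot m s t₀ t| ^ q ∂(zonal m)

theorem continuousOn_abs_diffQuot_rpow {m : ℕ} {q : ℝ} (hq : 0 ≤ q) (s : ℝ) {t₀ : ℝ}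
    (ht₀ : t₀ ∈ Set.Icc (-1 : ℝ) 1) :
    ContinuousOn (fun t => |diffQuot m s t₀ t| ^ q) (Set.Icc (-1) 1) :=
  (continuousOn_diffQuot m s ht₀).abs.rpow_const fun _ _ => Or.inr hq

theorem distPow_pos {q : ℝ} (hq : 0 ≤ q) (s : ℝ) {t₀ : ℝ} (ht₀ : t₀ ∈ Set.Icc (-1 : ℝ) 1) :
    0 < distPow m q s t₀ := by
  refine integral_pos_of_ae_pos
    (integrable_zonal_of_continuousOn (continuousOn_abs_diffQuot_rpow hq s ht₀)) ?_
  filter_upwards [ae_zonal_mem_Icc m, ae_zonal_ne t₀] with t ht h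
  exact Real.rpow_pos_of_pos (abs_pos.2 (diffQuot_ne_zero dim_pos s ht ht₀ h)) q

theorem distPow_eq_moebIntegral {q : ℝ} (hq : 0 ≤ q) (s b : ℝ) :
    distPow m q s (Real.tanh b) = moebIntegral m (fun τ => |τ| ^ q) q (s, b) := by
  rw [distPow, integral_zonal_moeb b (continuousOn_abs_diffQuot_rpow hq s (tanh_mem_Icc b))]
  refine integral_congr_ae ?_
  filter_upwards [ae_zonal_mem_Icc m] with τ hτ
  have h := moebFactor_pos (dim_pos (m := m)) (moebDen_pos b hτ) (moebDen_pos (b - s) hτ)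
  rw [diffQuot_moeb m s b hτ, abs_mul, abs_of_pos h, Real.mul_rpow (abs_nonneg _) h.le]
  ring

/-- By the quantitative decrease, `eulerLagrange ∘ tanh + c * tanh` has nonpositive slopes to the
right of `b`, so `d ≤ -c / cosh² b`. This avoids differentiating the signed power, which is singular
at zero for `q < 2`. -/
theorem deriv_eulerLagrange_ne_zero {q : ℝ} (hq : 1 < q) (s b : ℝ) {d : ℝ}
    (hd : HasDerivAt (fun b => eulerLagrange m q s (Real.tanh b)) d b) : d ≠ 0 := by
  obtain ⟨c, hc, h⟩ := exists_eulerLagrange_sub_ge (m := m) hq s (tanh_mem_Ioo b)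
  have hcosh := Real.cosh_pos b
  have htend : Filter.Tendsto Real.tanh (nhdsWithin b (Set.Ioi b))
      (nhdsWithin (Real.tanh b) (Set.Ioi (Real.tanh b))) := by
    refine tendsto_nhdsWithin_iff.2 ⟨(continuous_tanh.tendsto b).mono_left nhdsWithin_le_nhds, ?_⟩
    filter_upwards [self_mem_nhdsWithin] with x (hx : b < x)
    have h1 := Real.cosh_pos x
    rw [Set.mem_Ioi, Real.tanh_eq_sinh_div_cosh, Real.tanh_eq_sinh_div_cosh,
      div_lt_div_iff₀ hcosh h1]
    have := Real.sinh_pos_iff.2 (sub_pos.2 hx)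
    rw [Real.sinh_sub] at this
    linarith
  have h2 := htend.eventually h
  have h3 : HasDerivAt (fun x => eulerLagrange m q s (Real.tanh x) + c * Real.tanh x)
      (d + c * (1 / Real.cosh b ^ 2)) b := hd.add ((hasDerivAt_tanh b).const_mul c)
  have h4 := (hasDerivWithinAt_iff_tendsto_slope' (by simp)).1
    (h3.hasDerivWithinAt (s := Set.Ioi b))
  have h5 : d + c * (1 / Real.cosh b ^ 2) ≤ 0 := by
    refine le_of_tendsto h4 ?_
    filter_upwards [h2, self_mem_nhdsWithin] with x hx (hx' : b < x)
    rw [slope_def_field]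
    refine div_nonpos_of_nonpos_of_nonneg ?_ (by linarith)
    linarith
  have h6 : 0 < c * (1 / Real.cosh b ^ 2) := by positivity
  linarith

theorem integrable_signedPow {q : ℝ} (hq : 1 < q) : Integrable (signedPow q) (zonal m) :=
  integrable_zonal_of_continuousOn (continuous_signedPow hq).continuousOn

open scoped ContDiff in
-- Implicit function theorem for the integral `Φ`, smooth in `(s, b)`. Uniqueness of the critical
-- point identifies the local implicit function with the globally chosen solution.
theorem contDiff_critPoint {q : ℝ} (hq : 1 < q) : ContDiff ℝ ∞ (critPoint m hq) := by
  rw [contDiff_iff_contDiffAt]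
  intro s
  set Φ := moebIntegral m (signedPow q) (q - 1) with hΦ
  have hsm : ContDiff ℝ ∞ Φ := contDiff_moebIntegral (integrable_signedPow hq) _
  set u : ℝ × ℝ := (s, critPoint m hq s) with hu
  have hEL : ∀ s b, eulerLagrange m q s (Real.tanh b) = Φ (s, b) :=
    eulerLagrange_eq_moebIntegral hq
  have cdf : ContDiffAt ℝ ∞ Φ u := hsm.contDiffAt
  have hd : HasDerivAt (fun b => eulerLagrange m q s (Real.tanh b)) (fderiv ℝ Φ u (0, 1))
      (critPoint m hq s) := by
    simp only [hEL]
    have h1 : HasFDerivAt Φ (fderiv ℝ Φ u) (s, critPoint m hq s) :=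
      (hsm.differentiable (by simp) u).hasFDerivAt
    exact h1.comp_hasDerivAt _ ((hasDerivAt_const _ s).prodMk (hasDerivAt_id _))
  have hne := deriv_eulerLagrange_ne_zero hq s _ hd
  have hinv : (fderiv ℝ Φ u ∘L .inr ℝ ℝ ℝ).IsInvertible := by
    refine ⟨ContinuousLinearEquiv.unitsEquivAut ℝ (Units.mk0 _ hne), ?_⟩
    ext
    simp
  have h0 : Φ u = 0 := by rw [hu, ← hEL, eulerLagrange_critPoint]
  refine (cdf.contDiffAt_implicitFunction (by simp) hinv).congr_of_eventuallyEq ?_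
  filter_upwards [cdf.eventually_apply_implicitFunction (by simp) hinv] with x hx
  refine (eq_critPoint hq ?_).symm
  rw [hEL, hx, h0]

/-- The `L^q` distance of the kernel to the constants, as a function of the hyperbolic distance
to the origin. -/
noncomputable def distConst (m : ℕ) [Fact (2 ≤ m)] {q : ℝ} (hq : 1 < q) (s : ℝ) : ℝ :=
  Real.sinh s * distPow m q s (Real.tanh (critPoint m hq s)) ^ (1 / q)

open scoped ContDiff in
theorem contDiff_distPow_critPoint {q : ℝ} (hq : 1 < q) :
    ContDiff ℝ ∞ fun s => distPow m q s (Real.tanh (critPoint m hq s)) := by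
  have h0 : 0 ≤ q := by linarith
  simp only [distPow_eq_moebIntegral h0]
  refine (contDiff_moebIntegral ?_ q).comp (contDiff_id.prodMk (contDiff_critPoint hq))
  exact integrable_zonal_of_continuousOn
    (continuous_abs.rpow_const fun _ => Or.inr h0).continuousOn

open scoped ContDiff in
-- The quantity under the root is positive even at `s = 0`, the zero there being carried by `sinh s`
-- alone.
theorem contDiff_distConst {q : ℝ} (hq : 1 < q) : ContDiff ℝ ∞ (distConst m hq) :=
  Real.contDiff_sinh.mul ((contDiff_distPow_critPoint hq).rpow_const_of_ne fun _ =>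
    (distPow_pos (by linarith) _ (tanh_mem_Icc _)).ne')

/-! ### Optimality of the critical constant -/

/-- The tangent line inequality for the convex function `|·|^q`, obtained from weighted
arithmetic-geometric means; this form includes `q = 1`, where the slope at zero is the chosen
subgradient `0`. -/
theorem signedPow_tangent {q : ℝ} (hq : 1 ≤ q) (x y : ℝ) :
    |x| ^ q + q * (signedPow q x * (y - x)) ≤ |y| ^ q := by
  have hq0 : 0 < q := by linarith
  rw [mul_sub, signedPow_mul_self hq0.ne']
  rcases eq_or_ne x 0 with rfl | hx
  · rw [signedPow_zero, abs_zero, Real.zero_rpow hq0.ne']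
    simp only [zero_mul, sub_self, mul_zero, add_zero]
    positivity
  have h1 := Real.geom_mean_le_arith_mean2_weighted (w₁ := 1 - 1 / q) (w₂ := 1 / q)
    (p₁ := |x| ^ q) (p₂ := |y| ^ q) (by rw [sub_nonneg, div_le_one hq0]; exact hq) (by positivity)
    (by positivity) (by positivity) (by ring)
  rw [← Real.rpow_mul (abs_nonneg x), ← Real.rpow_mul (abs_nonneg y),
    show q * (1 - 1 / q) = q - 1 by field_simp, show q * (1 / q) = 1 by field_simp,
    Real.rpow_one, ← abs_signedPow q hx, ← abs_mul] at h1
  have h2 := (le_abs_self _).trans h1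
  have h3 := mul_le_mul_of_nonneg_left h2 hq0.le
  have h4 : q * ((1 - 1 / q) * |x| ^ q + 1 / q * |y| ^ q) = (q - 1) * |x| ^ q + |y| ^ q := by
    field_simp
  rw [h4] at h3
  linarith

/-- The Euler-Lagrange equation characterizes the best approximation by constants. -/
theorem integral_abs_rpow_le_of_integral_signedPow_eq_zero {α : Type*} [MeasurableSpace α]
    {μ : Measure α} {q : ℝ} (hq : 1 ≤ q) {f : α → ℝ} (h0 : ∫ x, signedPow q (f x) ∂μ = 0)
    (h1 : Integrable (fun x => signedPow q (f x)) μ) (h2 : Integrable (fun x => |f x| ^ q) μ)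
    {c : ℝ} (h3 : Integrable (fun x => |f x + c| ^ q) μ) :
    ∫ x, |f x| ^ q ∂μ ≤ ∫ x, |f x + c| ^ q ∂μ := by
  have h4 : ∫ x, (|f x| ^ q + q * (signedPow q (f x) * c)) ∂μ ≤ ∫ x, |f x + c| ^ q ∂μ := by
    refine integral_mono (h2.add ((h1.mul_const c).const_mul q)) h3 fun x => ?_
    have := signedPow_tangent hq (f x) (f x + c)
    rwa [add_sub_cancel_left] at this
  rwa [integral_add h2 ((h1.mul_const c).const_mul q), integral_const_mul, integral_mul_const, h0,
    zero_mul, mul_zero, add_zero] at h4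

theorem continuousOn_abs_ratio_sub_rpow {m : ℕ} {q : ℝ} (hq : 0 ≤ q) (s a : ℝ) :
    ContinuousOn (fun t => |ratio s t ^ m - a| ^ q) (Set.Icc (-1) 1) :=
  (((continuousOn_ratio s).pow m).sub continuousOn_const).abs.rpow_const fun _ _ => Or.inr hq

theorem integral_abs_ratio_sub_rpow {m : ℕ} {q : ℝ} {s : ℝ} (hs : 0 ≤ s) {t₀ : ℝ}
    (ht₀ : t₀ ∈ Set.Icc (-1 : ℝ) 1) :
    ∫ t, |ratio s t ^ m - ratio s t₀ ^ m| ^ q ∂(zonal m) = Real.sinh s ^ q * distPow m q s t₀ := by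
  have hS : 0 ≤ Real.sinh s := Real.sinh_nonneg_iff.2 hs
  rw [distPow, ← integral_const_mul]
  refine integral_congr_ae ?_
  filter_upwards [ae_zonal_mem_Icc m] with t ht
  rw [← sinh_mul_diffQuot m s ht ht₀, abs_mul, abs_of_nonneg hS, Real.mul_rpow hS (abs_nonneg _)]

theorem integrable_signedPow_of_continuousOn {q : ℝ} (hq : 1 ≤ q) {f : ℝ → ℝ} (hfm : Measurable f)
    (hf : ContinuousOn f (Set.Icc (-1) 1)) : Integrable (fun t => signedPow q (f t)) (zonal m) := by
  refine ((integrable_zonal_of_continuousOn (m := m) (hf.abs.rpow_const (p := q - 1)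
    fun _ _ => Or.inr (by linarith)))).mono'
      ((measurable_signedPow q).comp hfm).aestronglyMeasurable (Filter.Eventually.of_forall fun t => ?_)
  rcases eq_or_ne (f t) 0 with h | h
  · rw [h, signedPow_zero]
    simp only [norm_zero, abs_zero]
    positivity
  · exact (abs_signedPow q h).le

/-- A solution of the Euler-Lagrange equation gives the best constant. -/
theorem distPow_le_integral {q : ℝ} (hq : 1 ≤ q) {s : ℝ} (hs : 0 ≤ s) {t₀ : ℝ}
    (ht₀ : t₀ ∈ Set.Icc (-1 : ℝ) 1) (h : eulerLagrange m q s t₀ = 0) (a : ℝ) :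
    Real.sinh s ^ q * distPow m q s t₀ ≤ ∫ t, |ratio s t ^ m - a| ^ q ∂(zonal m) := by
  have hq0 : 0 < q := by linarith
  rcases hs.eq_or_lt with rfl | hs'
  · rw [Real.sinh_zero, Real.zero_rpow hq0.ne', zero_mul]
    exact integral_nonneg fun t => by positivity
  have hS : 0 < Real.sinh s := Real.sinh_pos_iff.2 hs'
  rw [← integral_abs_ratio_sub_rpow hs ht₀]
  have h1 : ∀ t ∈ Set.Icc (-1 : ℝ) 1, Real.sinh s ^ (q - 1) * signedPow q (diffQuot m s t₀ t) =
      signedPow q (ratio s t ^ m - ratio s t₀ ^ m) := fun t ht => by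
    rw [← signedPow_mul q hS, sinh_mul_diffQuot m s ht ht₀]
  have h2 : ∫ t, signedPow q (ratio s t ^ m - ratio s t₀ ^ m) ∂(zonal m) = 0 := by
    rw [← mul_zero (Real.sinh s ^ (q - 1)), ← h, eulerLagrange, ← integral_const_mul]
    refine integral_congr_ae ?_
    filter_upwards [ae_zonal_mem_Icc m] with t ht
    exact (h1 t ht).symm
  have hc : ContinuousOn (fun t => ratio s t ^ m - ratio s t₀ ^ m) (Set.Icc (-1) 1) :=
    ((continuousOn_ratio s).pow m).sub continuousOn_const
  have := integral_abs_rpow_le_of_integral_signedPow_eq_zero (c := ratio s t₀ ^ m - a) hq h2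
    (integrable_signedPow_of_continuousOn hq (by unfold ratio moebDen; fun_prop) hc)
    (integrable_zonal_of_continuousOn (continuousOn_abs_ratio_sub_rpow hq0.le s _))
    (by simpa only [sub_add_sub_cancel] using
      integrable_zonal_of_continuousOn (continuousOn_abs_ratio_sub_rpow hq0.le s a))
  simpa only [sub_add_sub_cancel] using this

/-! ### Strict monotonicity of the distance -/

theorem ratio_moeb (s : ℝ) {τ : ℝ} (hτ : τ ∈ Set.Icc (-1 : ℝ) 1) :
    ratio s (moeb s τ) = moebDen s τ := by
  have h := moebDen_pos s hτ
  rw [ratio, moebDen_neg_moeb s s h.ne', sub_self]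
  simp [moebDen]

/-- In this variable the `s`-derivative of the integrand contains the factor `signedPow q (M^m - a)
* M⁻ᵐ`, `M = moebDen s τ`, which has integral zero at the optimal `a`. -/
theorem integral_abs_ratio_sub_rpow_eq {q : ℝ} (hq : 0 ≤ q) (s a : ℝ) :
    ∫ t, |ratio s t ^ m - a| ^ q ∂(zonal m) =
      ∫ τ, |moebDen s τ ^ m - a| ^ q * (moebDen s τ ^ m)⁻¹ ∂(zonal m) := by
  rw [integral_zonal_moeb s (continuousOn_abs_ratio_sub_rpow hq s a)]
  refine integral_congr_ae ?_
  filter_upwards [ae_zonal_mem_Icc m] with τ hτ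
  rw [ratio_moeb s hτ]

/-- The derivative with respect to `s` of the integrand in `integral_abs_ratio_sub_rpow_eq`. -/
noncomputable def distIntegrandDeriv (m : ℕ) (q a s τ : ℝ) : ℝ :=
  signedPow q (moebDen s τ ^ m - a) * (moebDen s τ ^ m)⁻¹ *
    (m * ((Real.sinh s + Real.cosh s * τ) / moebDen s τ * ((q - 1) * moebDen s τ ^ m + a)))

theorem hasDerivAt_distIntegrand {q : ℝ} (hq : 1 < q) (a : ℝ) {τ : ℝ}
    (hτ : τ ∈ Set.Icc (-1 : ℝ) 1) (s : ℝ) :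
    HasDerivAt (fun s => |moebDen s τ ^ m - a| ^ q * (moebDen s τ ^ m)⁻¹)
      (distIntegrandDeriv m q a s τ) s := by
  have hM := moebDen_pos s hτ
  have h1 : HasDerivAt (fun s => moebDen s τ) (Real.sinh s + Real.cosh s * τ) s :=
    (Real.hasDerivAt_cosh s).add ((Real.hasDerivAt_sinh s).mul_const τ)
  have h2 : HasDerivAt (fun s => moebDen s τ ^ m)
      (m * moebDen s τ ^ (m - 1) * (Real.sinh s + Real.cosh s * τ)) s := h1.pow m
  have h3 : HasDerivAt (fun s => |moebDen s τ ^ m - a| ^ q)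
      (q * signedPow q (moebDen s τ ^ m - a) *
        (m * moebDen s τ ^ (m - 1) * (Real.sinh s + Real.cosh s * τ))) s := by
    refine ((hasDerivAt_abs_rpow (moebDen s τ ^ m - a) hq).comp s (h2.sub_const a)).congr_deriv ?_
    rw [signedPow]
    ring
  have h4 : HasDerivAt (fun s => (moebDen s τ ^ m)⁻¹)
      (-(m * moebDen s τ ^ (m - 1) * (Real.sinh s + Real.cosh s * τ)) / (moebDen s τ ^ m) ^ 2) s :=
    h2.inv (pow_pos hM m).ne'
  refine (h3.mul h4).congr_deriv ?_
  obtain ⟨k, hk⟩ : ∃ k, m = k + 1 := ⟨m - 1, by have := dim_pos (m := m); omega⟩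
  -- Writing `|x|^q` as `signedPow q x * x` lets the signed power factor out of the product rule.
  rw [distIntegrandDeriv, ← signedPow_mul_self (show q ≠ 0 by linarith) (moebDen s τ ^ m - a)]
  generalize signedPow q (moebDen s τ ^ m - a) = w
  subst hk
  simp only [Nat.add_sub_cancel]
  push_cast
  field_simp
  ring

theorem continuousOn_distIntegrandDeriv {m : ℕ} {q : ℝ} (hq : 1 < q) (a : ℝ) :
    ContinuousOn (fun z : ℝ × ℝ => distIntegrandDeriv m q a z.1 z.2)
      (Set.univ ×ˢ Set.Icc (-1) 1) := by
  have h1 : ContinuousOn (fun z : ℝ × ℝ => moebDen z.1 z.2) (Set.univ ×ˢ Set.Icc (-1) 1) :=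
    (contDiff_moebDen contDiff_fst contDiff_snd).continuous.continuousOn
  have h2 : ∀ z ∈ Set.univ ×ˢ Set.Icc (-1 : ℝ) 1, moebDen z.1 z.2 ≠ 0 :=
    fun z hz => (moebDen_pos z.1 hz.2).ne'
  have h3 : ContinuousOn (fun z : ℝ × ℝ => Real.sinh z.1 + Real.cosh z.1 * z.2)
      (Set.univ ×ˢ Set.Icc (-1) 1) := by fun_prop
  exact (((continuous_signedPow hq).comp_continuousOn ((h1.pow m).sub continuousOn_const)).mul
    ((h1.pow m).inv₀ fun z hz => pow_ne_zero m (h2 z hz))).mul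
    (continuousOn_const.mul ((h3.div h1 h2).mul ((continuousOn_const.mul (h1.pow m)).add
      continuousOn_const)))

theorem hasDerivAt_integral_abs_ratio_sub_rpow {q : ℝ} (hq : 1 < q) (a s : ℝ) :
    HasDerivAt (fun s => ∫ t, |ratio s t ^ m - a| ^ q ∂(zonal m))
      (∫ τ, distIntegrandDeriv m q a s τ ∂(zonal m)) s := by
  have hq0 : 0 ≤ q := by linarith
  simp only [integral_abs_ratio_sub_rpow_eq hq0]
  have hc := continuousOn_distIntegrandDeriv (m := m) hq a
  have hcs : ∀ s, ContinuousOn (distIntegrandDeriv m q a s) (Set.Icc (-1) 1) := fun s =>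
    ContinuousOn.comp (f := fun τ : ℝ => (s, τ)) (s := Set.Icc (-1) 1) hc (by fun_prop)
      fun _ h => ⟨trivial, h⟩
  have hcont : ∀ s, ContinuousOn (fun τ => |moebDen s τ ^ m - a| ^ q * (moebDen s τ ^ m)⁻¹)
      (Set.Icc (-1) 1) := fun s =>
    (((((continuousOn_moebDen s _).pow m).sub continuousOn_const).abs.rpow_const
      fun _ _ => Or.inr hq0)).mul (((continuousOn_moebDen s _).pow m).inv₀
        fun t ht => (pow_pos (moebDen_pos s ht) m).ne')
  obtain ⟨R, hR⟩ := ((isCompact_closedBall s 1).prod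
    (isCompact_Icc (a := (-1 : ℝ)) (b := 1))).exists_bound_of_continuousOn
    (hc.mono (Set.prod_mono (Set.subset_univ _) subset_rfl))
  refine (hasDerivAt_integral_of_dominated_loc_of_deriv_le (bound := fun _ => R)
    (ball_mem_nhds s one_pos) (Filter.Eventually.of_forall fun s =>
      (integrable_zonal_of_continuousOn (hcont s)).1) (integrable_zonal_of_continuousOn (hcont s))
    (integrable_zonal_of_continuousOn (hcs s)).1 ?_ (integrable_const R) ?_).2
  · filter_upwards [ae_zonal_mem_Icc m] with τ hτ x hx
    exact hR (x, τ) ⟨ball_subset_closedBall hx, hτ⟩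
  · filter_upwards [ae_zonal_mem_Icc m] with τ hτ x hx
    exact hasDerivAt_distIntegrand hq a hτ x

/-- The derivative is `w` times a function of `M = moebDen s τ`. Since `∫ w = 0`, the value of that
function at `M = R` may be subtracted. The function is the product of the increasing `(cosh s - 1/M)
/ sinh s`, which at `R` is `t₀ ≥ 0`, and the positive increasing `(q - 1) M^m + R^m`; so its
deviation from the value at `R` has the sign of `M - R`, which is also the sign of `w`. -/
theorem integral_distIntegrandDeriv_pos {q : ℝ} (hq : 1 < q) {s : ℝ} (hs : 0 < s) {t₀ : ℝ}
    (ht₀ : t₀ ∈ Set.Icc (-1 : ℝ) 1) (ht₀' : 0 ≤ t₀) (h : eulerLagrange m q s t₀ = 0) :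
    0 < ∫ τ, distIntegrandDeriv m q (ratio s t₀ ^ m) s τ ∂(zonal m) := by
  have hS : 0 < Real.sinh s := Real.sinh_pos_iff.2 hs
  have hR := ratio_pos s ht₀
  set R := ratio s t₀ with hRdef
  have hRS : Real.cosh s - R⁻¹ = Real.sinh s * t₀ := by
    rw [hRdef, ratio, inv_inv, moebDen, Real.cosh_neg, Real.sinh_neg]
    ring
  have hcw : ContinuousOn (fun t => signedPow q (ratio s t ^ m - R ^ m)) (Set.Icc (-1) 1) :=
    (continuous_signedPow hq).comp_continuousOn
      (((continuousOn_ratio s).pow m).sub continuousOn_const)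
  set w := fun τ => signedPow q (moebDen s τ ^ m - R ^ m) * (moebDen s τ ^ m)⁻¹ with hw
  have hEL : ∫ τ, w τ ∂(zonal m) = 0 := by
    have h1 : ∫ t, signedPow q (ratio s t ^ m - R ^ m) ∂(zonal m) = 0 := by
      rw [← mul_zero (Real.sinh s ^ (q - 1)), ← h, eulerLagrange, ← integral_const_mul]
      refine integral_congr_ae ?_
      filter_upwards [ae_zonal_mem_Icc m] with t ht
      rw [← signedPow_mul q hS, sinh_mul_diffQuot m s ht ht₀]
    rw [integral_zonal_moeb s hcw] at h1
    rw [← h1]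
    refine integral_congr_ae ?_
    filter_upwards [ae_zonal_mem_Icc m] with τ hτ
    rw [ratio_moeb s hτ]
  have hwi : Integrable w (zonal m) := by
    refine integrable_zonal_of_continuousOn ?_
    exact ((continuous_signedPow hq).comp_continuousOn
      (((continuousOn_moebDen s _).pow m).sub continuousOn_const)).mul
      (((continuousOn_moebDen s _).pow m).inv₀ fun t ht => (pow_pos (moebDen_pos s ht) m).ne')
  set B₀ := (m : ℝ) * ((Real.cosh s - R⁻¹) / Real.sinh s * ((q - 1) * R ^ m + R ^ m)) with hB₀
  have hdi : Integrable (distIntegrandDeriv m q (R ^ m) s) (zonal m) :=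
    integrable_zonal_of_continuousOn (ContinuousOn.comp (f := fun τ : ℝ => (s, τ))
      (s := Set.Icc (-1) 1) (continuousOn_distIntegrandDeriv (m := m) hq (R ^ m)) (by fun_prop)
      fun _ h => ⟨trivial, h⟩)
  have hpos : 0 < ∫ τ, (distIntegrandDeriv m q (R ^ m) s τ - w τ * B₀) ∂(zonal m) := by
    refine integral_pos_of_ae_pos (hdi.sub (hwi.mul_const B₀)) ?_
    filter_upwards [ae_zonal_mem_Icc m, ae_zonal_ne ((R - Real.cosh s) / Real.sinh s)] with τ hτ hne
    have hM := moebDen_pos s hτ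
    have hm0 : (0 : ℝ) < m := by exact_mod_cast dim_pos (m := m)
    have hMR : moebDen s τ ≠ R := by
      intro h
      apply hne
      rw [← h, moebDen]
      field_simp
      ring
    -- Both sides are the height `moeb s τ`, expressed on the right through `M` alone.
    have h1 : (Real.sinh s + Real.cosh s * τ) / moebDen s τ =
        (Real.cosh s - (moebDen s τ)⁻¹) / Real.sinh s := by
      rw [div_eq_div_iff hM.ne' hS.ne', sub_mul, inv_mul_cancel₀ hM.ne', moebDen]
      linear_combination -Real.cosh_sq_sub_sinh_sq s
    have h2 : distIntegrandDeriv m q (R ^ m) s τ - w τ * B₀ = w τ * (m *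
        ((Real.cosh s - (moebDen s τ)⁻¹) / Real.sinh s * ((q - 1) * moebDen s τ ^ m + R ^ m) -
        (Real.cosh s - R⁻¹) / Real.sinh s * ((q - 1) * R ^ m + R ^ m))) := by
      rw [distIntegrandDeriv, h1, hB₀, hw]
      ring
    rw [h2]
    set M := moebDen s τ
    have hu₀ : 0 ≤ (Real.cosh s - R⁻¹) / Real.sinh s := by
      rw [hRS]
      positivity
    have hq1 : 0 < q - 1 := by linarith
    have hMm : 0 < (M ^ m)⁻¹ := by positivity
    rcases lt_or_gt_of_ne hMR with hlt | hlt
    · have h3 : M ^ m < R ^ m := pow_lt_pow_left₀ hlt hM.le (dim_pos (m := m)).ne'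
      have h4 : (Real.cosh s - M⁻¹) / Real.sinh s < (Real.cosh s - R⁻¹) / Real.sinh s := by
        have := inv_strictAnti₀ hM hlt
        gcongr
      have hv : 0 < (q - 1) * M ^ m + R ^ m := by positivity
      refine mul_pos_of_neg_of_neg (mul_neg_of_neg_of_pos
        (signedPow_neg_of_neg q (by linarith)) hMm) (mul_neg_of_pos_of_neg hm0 ?_)
      rw [sub_neg]
      refine (mul_lt_mul_of_pos_right h4 hv).trans_le (mul_le_mul_of_nonneg_left ?_ hu₀)
      have := mul_le_mul_of_nonneg_left h3.le hq1.le
      linarith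
    · have h3 : R ^ m < M ^ m := pow_lt_pow_left₀ hlt hR.le (dim_pos (m := m)).ne'
      have h4 : (Real.cosh s - R⁻¹) / Real.sinh s < (Real.cosh s - M⁻¹) / Real.sinh s := by
        have := inv_strictAnti₀ hR hlt
        gcongr
      have hv : 0 < (q - 1) * M ^ m + R ^ m := by positivity
      refine mul_pos (mul_pos (signedPow_pos q (by linarith)) hMm) (mul_pos hm0 ?_)
      rw [sub_pos]
      refine lt_of_le_of_lt (mul_le_mul_of_nonneg_left ?_ hu₀) (mul_lt_mul_of_pos_right h4 hv)
      have := mul_le_mul_of_nonneg_left h3.le hq1.le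
      linarith
  rw [integral_sub hdi (hwi.mul_const B₀), integral_mul_const, hEL, zero_mul, sub_zero] at hpos
  exact hpos

theorem distConst_nonneg {q : ℝ} (hq : 1 < q) {s : ℝ} (hs : 0 ≤ s) : 0 ≤ distConst m hq s :=
  mul_nonneg (Real.sinh_nonneg_iff.2 hs)
    (Real.rpow_nonneg (distPow_pos (by linarith) _ (tanh_mem_Icc _)).le _)

theorem distConst_rpow {q : ℝ} (hq : 1 < q) {s : ℝ} (hs : 0 ≤ s) :
    distConst m hq s ^ q = Real.sinh s ^ q * distPow m q s (Real.tanh (critPoint m hq s)) := by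
  have hH := (distPow_pos (m := m) (show 0 ≤ q by linarith) s (tanh_mem_Icc (critPoint m hq s))).le
  rw [distConst, Real.mul_rpow (Real.sinh_nonneg_iff.2 hs) (Real.rpow_nonneg hH _),
    ← Real.rpow_mul hH, one_div_mul_cancel (by linarith), Real.rpow_one]

theorem distConst_rpow_le {q : ℝ} (hq : 1 < q) {s : ℝ} (hs : 0 ≤ s) (a : ℝ) :
    distConst m hq s ^ q ≤ ∫ t, |ratio s t ^ m - a| ^ q ∂(zonal m) := by
  rw [distConst_rpow hq hs]
  exact distPow_le_integral hq.le hs (tanh_mem_Icc _) (eulerLagrange_critPoint hq s) a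

theorem distConst_rpow_eq {q : ℝ} (hq : 1 < q) {s : ℝ} (hs : 0 ≤ s) :
    distConst m hq s ^ q = ∫ t, |ratio s t ^ m - ratio s (Real.tanh (critPoint m hq s)) ^ m| ^ q
      ∂(zonal m) := by
  rw [distConst_rpow hq hs, integral_abs_ratio_sub_rpow hs (tanh_mem_Icc _)]

/-- Envelope argument: with the constant frozen at its optimum for `s`, the `q`-th power of the
error dominates `distConst ^ q` and touches it at `s`, so the derivatives agree. At `s = 0` the
distance vanishes and the product rule is used instead. -/
theorem deriv_distConst_pos {q : ℝ} (hq : 1 < q) {s : ℝ} (hs : 0 ≤ s) :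
    0 < deriv (distConst m hq) s := by
  have hq0 : 0 < q := by linarith
  have hdiff : ∀ s, HasDerivAt (distConst m hq) (deriv (distConst m hq) s) s := fun s =>
    ((contDiff_distConst hq).differentiable (by simp) s).hasDerivAt
  rcases hs.eq_or_lt with rfl | hs'
  · have h1 : Differentiable ℝ fun s => distPow m q s (Real.tanh (critPoint m hq s)) ^ (1 / q) :=
      ((contDiff_distPow_critPoint (m := m) hq).rpow_const_of_ne fun _ =>
        (distPow_pos (by linarith) _ (tanh_mem_Icc _)).ne').differentiable (by simp)
    have h2 := (Real.hasDerivAt_sinh 0).mul (h1 0).hasDerivAt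
    rw [(show HasDerivAt (distConst m hq) _ 0 from h2).deriv, Real.sinh_zero, zero_mul, add_zero,
      Real.cosh_zero, one_mul]
    exact Real.rpow_pos_of_pos (distPow_pos hq0.le _ (tanh_mem_Icc _)) _
  have hpos : 0 < distConst m hq s := mul_pos (Real.sinh_pos_iff.2 hs')
    (Real.rpow_pos_of_pos (distPow_pos hq0.le _ (tanh_mem_Icc _)) _)
  set t₀ := Real.tanh (critPoint m hq s) with ht₀
  have hF := hasDerivAt_integral_abs_ratio_sub_rpow (m := m) hq (ratio s t₀ ^ m) s
  have hf : HasDerivAt (fun s => distConst m hq s ^ q)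
      (deriv (distConst m hq) s * q * distConst m hq s ^ (q - 1)) s :=
    (hdiff s).rpow_const (Or.inl hpos.ne')
  have hmin : IsLocalMin (fun s' => ∫ t, |ratio s' t ^ m - ratio s t₀ ^ m| ^ q ∂(zonal m) -
      distConst m hq s' ^ q) s := by
    filter_upwards [Ioi_mem_nhds hs'] with s' hs'
    rw [distConst_rpow_eq hq hs, sub_self, sub_nonneg]
    exact distConst_rpow_le hq (le_of_lt hs') _
  have h0 := hmin.hasDerivAt_eq_zero (hF.sub hf)
  have h1 := integral_distIntegrandDeriv_pos hq hs' (tanh_mem_Icc _) (tanh_critPoint_nonneg hq hs)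
    (eulerLagrange_critPoint (m := m) hq s)
  have h2 : 0 < deriv (distConst m hq) s * (q * distConst m hq s ^ (q - 1)) := by
    rw [← mul_assoc]
    linarith
  exact pos_of_mul_pos_left h2 (by positivity)

/-! ### Unboundedness of the distance -/

/-- Two cases for the best constant `a`. If `a ≤ cosh^m s / 2`, then in the Möbius variable `M ≥
cosh s` for `τ > 0`, so the error is at least `M^m / 2` there, and the weight `M⁻ᵐ` leaves the
divergent power `q - 1 > 0`. If `a` is larger, the kernel is at most `1` on the lower half and the
error there is at least `cosh^m s / 2 - 1`. -/
theorem exists_le_distConst {q : ℝ} (hq : 1 < q) (y : ℝ) : ∃ s, 0 ≤ s ∧ y ≤ distConst m hq s := by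
  have hq0 : 0 < q := by linarith
  have hm0 : (0 : ℝ) < m := by exact_mod_cast dim_pos (m := m)
  set κ := (zonal m).real (Set.Ioo 0 1) with hκ
  set κ' := (zonal m).real (Set.Ioo (-1) 0) with hκ'
  have hκ0 : 0 < κ := ENNReal.toReal_pos
    (zonal_Ioo_pos (by norm_num) (by norm_num) le_rfl).ne' (measure_ne_top _ _)
  have hκ0' : 0 < κ' := ENNReal.toReal_pos
    (zonal_Ioo_pos (by norm_num) le_rfl (by norm_num)).ne' (measure_ne_top _ _)
  have hcosh : Filter.Tendsto Real.cosh Filter.atTop Filter.atTop := by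
    refine Filter.tendsto_atTop_mono (fun x => ?_) 
      (Real.tendsto_exp_atTop.atTop_div_const (two_pos : (0 : ℝ) < 2))
    rw [Real.cosh_eq]
    have := Real.exp_pos (-x)
    linarith
  have hpow : Filter.Tendsto (fun s => Real.cosh s ^ m) Filter.atTop Filter.atTop :=
    (Filter.tendsto_pow_atTop (dim_pos (m := m)).ne').comp hcosh
  have h1 : Filter.Tendsto (fun s => κ * ((1 / 2) ^ q * (Real.cosh s ^ m) ^ (q - 1)))
      Filter.atTop Filter.atTop :=
    (((tendsto_rpow_atTop (by linarith : 0 < q - 1)).comp hpow).const_mul_atTop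
      (by positivity)).const_mul_atTop hκ0
  have h2 : Filter.Tendsto (fun s => κ' * (Real.cosh s ^ m / 2 - 1) ^ q)
      Filter.atTop Filter.atTop := by
    refine Filter.Tendsto.const_mul_atTop hκ0' ((tendsto_rpow_atTop hq0).comp ?_)
    exact Filter.tendsto_atTop_add_const_right _ (-1) (hpow.atTop_div_const two_pos)
  obtain ⟨s, hs0, hs1, hs2, hs3⟩ := ((Filter.eventually_ge_atTop (0 : ℝ)).and
    ((h1.eventually_ge_atTop (max y 0 ^ q)).and ((h2.eventually_ge_atTop (max y 0 ^ q)).and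
      (hpow.eventually_ge_atTop 2)))).exists
  refine ⟨s, hs0, (le_max_left y 0).trans ?_⟩
  rw [← Real.rpow_le_rpow_iff (le_max_right _ _) (distConst_nonneg hq hs0) hq0,
    distConst_rpow_eq hq hs0]
  have hS : 0 ≤ Real.sinh s := Real.sinh_nonneg_iff.2 hs0
  set a := ratio s (Real.tanh (critPoint m hq s)) ^ m
  rcases le_or_gt a (Real.cosh s ^ m / 2) with ha | ha
  · refine hs1.trans ?_
    rw [integral_abs_ratio_sub_rpow_eq hq0.le]
    have hi : Integrable (fun τ => |moebDen s τ ^ m - a| ^ q * (moebDen s τ ^ m)⁻¹) (zonal m) :=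
      integrable_zonal_of_continuousOn
        ((((((continuousOn_moebDen s _).pow m).sub continuousOn_const).abs.rpow_const
          fun _ _ => Or.inr hq0.le)).mul (((continuousOn_moebDen s _).pow m).inv₀
            fun t ht => (pow_pos (moebDen_pos s ht) m).ne'))
    calc κ * ((1 / 2) ^ q * (Real.cosh s ^ m) ^ (q - 1))
        = ∫ _ in Set.Ioo (0 : ℝ) 1, (1 / 2) ^ q * (Real.cosh s ^ m) ^ (q - 1) ∂(zonal m) := by
          rw [setIntegral_const, smul_eq_mul]
      _ ≤ ∫ τ in Set.Ioo (0 : ℝ) 1, |moebDen s τ ^ m - a| ^ q * (moebDen s τ ^ m)⁻¹ ∂(zonal m) := by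
          refine setIntegral_mono_on (integrable_const _).integrableOn hi.integrableOn
            measurableSet_Ioo fun τ hτ => ?_
          have hM := moebDen_pos s (t := τ) ⟨by linarith [hτ.1], hτ.2.le⟩
          have hMC : Real.cosh s ^ m ≤ moebDen s τ ^ m := by
            refine pow_le_pow_left₀ (Real.cosh_pos s).le ?_ m
            rw [moebDen]
            nlinarith [hτ.1]
          have hMm : 0 < moebDen s τ ^ m := by positivity
          have hC : 0 < Real.cosh s ^ m := pow_pos (Real.cosh_pos s) m
          calc (1 / 2 : ℝ) ^ q * (Real.cosh s ^ m) ^ (q - 1)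
              ≤ (1 / 2) ^ q * (moebDen s τ ^ m) ^ (q - 1) := by
                gcongr
            _ = (1 / 2 * moebDen s τ ^ m) ^ q * (moebDen s τ ^ m)⁻¹ := by
                rw [Real.mul_rpow (by norm_num) hMm.le, Real.rpow_sub hMm, Real.rpow_one,
                  div_eq_mul_inv (_ ^ q), mul_assoc]
            _ ≤ _ := by
                gcongr
                refine le_trans ?_ (le_abs_self _)
                linarith
      _ ≤ _ := by
          refine setIntegral_le_integral hi ?_
          filter_upwards [ae_zonal_mem_Icc m] with τ hτ
          have := moebDen_pos s hτ
          simp only [Pi.zero_apply]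
          positivity
  · refine hs2.trans ?_
    have hi : Integrable (fun t => |ratio s t ^ m - a| ^ q) (zonal m) :=
      integrable_zonal_of_continuousOn (continuousOn_abs_ratio_sub_rpow hq0.le s a)
    calc κ' * (Real.cosh s ^ m / 2 - 1) ^ q
        = ∫ _ in Set.Ioo (-1 : ℝ) 0, (Real.cosh s ^ m / 2 - 1) ^ q ∂(zonal m) := by
          rw [setIntegral_const, smul_eq_mul]
      _ ≤ ∫ t in Set.Ioo (-1 : ℝ) 0, |ratio s t ^ m - a| ^ q ∂(zonal m) := by
          refine setIntegral_mono_on (integrable_const _).integrableOn hi.integrableOn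
            measurableSet_Ioo fun t ht => ?_
          have hM := ratio_pos s (t := t) ⟨ht.1.le, by linarith [ht.2]⟩
          have h1 : ratio s t ^ m ≤ 1 := by
            refine pow_le_one₀ hM.le (inv_le_one_of_one_le₀ ?_)
            rw [moebDen, Real.cosh_neg, Real.sinh_neg]
            nlinarith [ht.2, Real.one_le_cosh s]
          gcongr
          · linarith
          · rw [abs_sub_comm]
            refine le_trans ?_ (le_abs_self _)
            linarith
      _ ≤ _ := setIntegral_le_integral hi (Filter.Eventually.of_forall fun t => by
          simp only [Pi.zero_apply]
          positivity)

/-! ### Diffeomorphisms of intervals and the parameter `r = tanh (s / 2)` -/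

open scoped ContDiff in
/-- A smooth function with positive derivative on `[0, ∞)` is a diffeomorphism onto its image. -/
theorem isIncreasingDiffeo_of_deriv_pos {f : ℝ → ℝ} (hf : ContDiff ℝ ∞ f)
    (hpos : ∀ x, 0 ≤ x → 0 < deriv f x) {t : Set ℝ} (ht : f '' Set.Ici 0 = t) :
    IsIncreasingDiffeo f (Set.Ici 0) t := by
  have hmono : StrictMonoOn f (Set.Ici 0) :=
    strictMonoOn_of_deriv_pos (convex_Ici 0) hf.continuous.continuousOn fun x hx =>
      hpos x (interior_subset hx)
  have hbij : Set.BijOn f (Set.Ici 0) t := ht ▸ hmono.injOn.bijOn_image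
  refine ⟨hmono, hbij, hf.contDiffOn, Function.invFunOn f (Set.Ici 0), hbij.invOn_invFunOn, ?_⟩
  have hinv := hbij.invOn_invFunOn
  have hmaps : Set.MapsTo (Function.invFunOn f (Set.Ici 0)) t (Set.Ici 0) :=
    hbij.surjOn.mapsTo_invFunOn
  set g := Function.invFunOn f (Set.Ici 0)
  -- Continuity of the global inverse, from its being an order isomorphism between intervals, is
  -- what allows it to be identified near `y` with the smooth local inverse.
  have hgc : ContinuousOn g t := by
    have hord : (f '' Set.Ici 0).OrdConnected :=
      ((isPreconnected_Ici (a := (0 : ℝ))).image f hf.continuous.continuousOn).ordConnected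
    rw [← ht] at hinv hmaps ⊢
    rw [continuousOn_iff_continuous_domRestrict]
    have h1 : (f '' Set.Ici 0).domRestrict g =
        fun y => ((hmono.orderIso f (Set.Ici 0)).symm y : ℝ) := by
      funext y
      obtain ⟨x, rfl⟩ := (hmono.orderIso f (Set.Ici 0)).surjective y
      rw [OrderIso.symm_apply_apply]
      exact hinv.1 x.2
    rw [h1]
    exact continuous_subtype_val.comp (hmono.orderIso f (Set.Ici 0)).symm.continuous
  intro y hy
  have hx : 0 ≤ g y := hmaps hy
  have hfx : f (g y) = y := hinv.2 hy
  have hd : HasFDerivAt f ((ContinuousLinearEquiv.unitsEquivAut ℝ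
      (Units.mk0 _ (hpos _ hx).ne') : ℝ ≃L[ℝ] ℝ) : ℝ →L[ℝ] ℝ) (g y) := by
    have := (hf.differentiable (by simp) (g y)).hasDerivAt.hasFDerivAt
    refine this.congr_fderiv ?_
    ext
    simp
  have hsm := hf.contDiffAt.to_localInverse hd (by simp)
  rw [hfx] at hsm
  refine hsm.contDiffWithinAt.congr_of_eventuallyEq ?_ ?_
  · have hleft := (hf.contDiffAt.hasStrictFDerivAt' hd (by simp)).eventually_left_inverse
    filter_upwards [(hgc y hy).eventually hleft, self_mem_nhdsWithin] with z hz hzt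
    rw [hinv.2 hzt] at hz
    exact hz.symm
  · have := (hf.contDiffAt.hasStrictFDerivAt' hd (by simp)).localInverse_apply_image
    rw [hfx] at this
    exact this.symm

theorem image_Ici_eq_Ici {f : ℝ → ℝ} (hf : Continuous f) (h0 : f 0 = 0)
    (hnn : ∀ x, 0 ≤ x → 0 ≤ f x) (hunb : ∀ y, ∃ x, 0 ≤ x ∧ y ≤ f x) :
    f '' Set.Ici 0 = Set.Ici 0 := by
  refine Set.Subset.antisymm (Set.image_subset_iff.2 hnn) fun y hy => ?_
  obtain ⟨x, hx, hxy⟩ := hunb y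
  obtain ⟨z, hz, rfl⟩ := intermediate_value_Icc hx hf.continuousOn ⟨h0.le.trans hy, hxy⟩
  exact ⟨z, hz.1, rfl⟩

theorem image_Ici_eq_Ico {f : ℝ → ℝ} (hf : Continuous f) (h0 : f 0 = 0)
    (hnn : ∀ x, 0 ≤ x → 0 ≤ f x) (hlt : ∀ x, f x < 1)
    (hlim : Filter.Tendsto f Filter.atTop (nhds 1)) : f '' Set.Ici 0 = Set.Ico 0 1 := by
  refine Set.Subset.antisymm (Set.image_subset_iff.2 fun x hx => ⟨hnn x hx, hlt x⟩) fun y hy => ?_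
  obtain ⟨x, hx, hxy⟩ := ((Filter.eventually_ge_atTop (0 : ℝ)).and
    (hlim.eventually (lt_mem_nhds hy.2))).exists
  obtain ⟨z, hz, rfl⟩ := intermediate_value_Icc hx hf.continuousOn ⟨h0.le.trans hy.1, hxy.le⟩
  exact ⟨z, hz.1, rfl⟩

open scoped ContDiff in
theorem contDiff_tanh : ContDiff ℝ ∞ Real.tanh := by
  have : Real.tanh = fun y => Real.sinh y / Real.cosh y := funext Real.tanh_eq_sinh_div_cosh
  rw [this]
  exact Real.contDiff_sinh.div Real.contDiff_cosh fun y => (Real.cosh_pos y).ne'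

theorem tendsto_tanh_atTop : Filter.Tendsto Real.tanh Filter.atTop (nhds 1) := by
  refine tendsto_order.2 ⟨fun a ha => ?_, fun a ha => Filter.Eventually.of_forall fun y =>
    (tanh_mem_Ioo y).2.trans ha⟩
  obtain ⟨b, -, hb⟩ := Real.tanh_surjOn (show max a 0 ∈ Set.Ioo (-1 : ℝ) 1 from
    ⟨lt_max_of_lt_right (by norm_num), max_lt ha one_pos⟩)
  have hm : StrictMono Real.tanh := strictMono_of_deriv_pos fun y => by
    rw [(hasDerivAt_tanh y).deriv]
    have := Real.cosh_pos y
    positivity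
  filter_upwards [Filter.eventually_gt_atTop b] with y hy
  exact (le_max_left a 0).trans_lt (hb ▸ hm hy)

theorem isIncreasingDiffeo_tanh_half :
    IsIncreasingDiffeo (fun s => Real.tanh (s / 2)) (Set.Ici 0) (Set.Ico 0 1) := by
  have hd : ∀ s : ℝ, HasDerivAt (fun s => Real.tanh (s / 2))
      (1 / Real.cosh (s / 2) ^ 2 * (1 / 2)) s := fun s =>
    HasDerivAt.comp (h := fun s : ℝ => s / 2) s (hasDerivAt_tanh (s / 2))
      ((hasDerivAt_id s).div_const 2)
  have hsm : ContDiff ℝ ((⊤ : ℕ∞) : WithTop ℕ∞) fun s : ℝ => Real.tanh (s / 2) :=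
    contDiff_tanh.comp (contDiff_id.div_const 2)
  refine isIncreasingDiffeo_of_deriv_pos hsm (fun s _ => ?_)
    (image_Ici_eq_Ico (by fun_prop) (by simp) (fun s hs => ?_)
      (fun s => (tanh_mem_Ioo _).2) ?_)
  · rw [(hd s).deriv]
    have := Real.cosh_pos (s / 2)
    positivity
  · rw [Real.tanh_eq_sinh_div_cosh]
    exact div_nonneg (Real.sinh_nonneg_iff.2 (by linarith)) (Real.cosh_pos _).le
  · exact tendsto_tanh_atTop.comp (Filter.tendsto_id.atTop_div_const two_pos)

/-- Transport of a diffeomorphism along the parametrization `r = tanh (s / 2)`. -/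
theorem IsIncreasingDiffeo.of_comp_tanh_half {F f : ℝ → ℝ} {t : Set ℝ}
    (hf : IsIncreasingDiffeo f (Set.Ici 0) t) (hF : ∀ s, 0 ≤ s → F (Real.tanh (s / 2)) = f s) :
    IsIncreasingDiffeo F (Set.Ico 0 1) t := by
  obtain ⟨hTm, hTb, hTs, A, hA, hAs⟩ := isIncreasingDiffeo_tanh_half
  obtain ⟨hfm, hfb, hfs, g, hg, hgs⟩ := hf
  have hAmaps : Set.MapsTo A (Set.Ico 0 1) (Set.Ici 0) := hA.1.mapsTo hTb.surjOn
  have hgmaps : Set.MapsTo g t (Set.Ici 0) := hg.1.mapsTo hfb.surjOn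
  have hAbij : Set.BijOn A (Set.Ico 0 1) (Set.Ici 0) := hA.symm.bijOn hAmaps hTb.mapsTo
  have hFA : Set.EqOn F (f ∘ A) (Set.Ico 0 1) := fun r hr => by
    rw [Function.comp_apply, ← hF _ (hAmaps hr)]
    exact congrArg F (hA.2 hr).symm
  have hAm : StrictMonoOn A (Set.Ico 0 1) := fun x hx y hy hxy => by
    have h1 := hA.2 hx
    have h2 := hA.2 hy
    refine (hTm.lt_iff_lt (hAmaps hx) (hAmaps hy)).1 ?_
    simp only at h1 h2 ⊢
    rwa [h1, h2]
  refine ⟨(hfm.comp hAm hAmaps).congr hFA.symm, (hfb.comp hAbij).congr hFA.symm,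
    (hfs.comp hAs hAmaps).congr hFA, fun y => Real.tanh (g y / 2), ⟨?_, ?_⟩, hTs.comp hgs hgmaps⟩
  · intro r hr
    simp only [hFA hr, Function.comp_apply]
    rw [hg.1 (hAmaps hr)]
    exact hA.2 hr
  · intro y hy
    simp only
    rw [hF _ (hgmaps hy), hg.2 hy]

theorem isIncreasingDiffeo_distConst {q : ℝ} (hq : 1 < q) :
    IsIncreasingDiffeo (distConst m hq) (Set.Ici 0) (Set.Ici 0) :=
  isIncreasingDiffeo_of_deriv_pos (contDiff_distConst hq) (fun _ hs => deriv_distConst_pos hq hs)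
    (image_Ici_eq_Ici (contDiff_distConst hq).continuous (by simp [distConst])
      (fun _ hs => distConst_nonneg hq hs) (exists_le_distConst hq))

theorem isIncreasingDiffeo_sinh_mul {c : ℝ} (hc : 0 < c) :
    IsIncreasingDiffeo (fun s => Real.sinh (c * s)) (Set.Ici 0) (Set.Ici 0) := by
  have hd : ∀ s : ℝ, HasDerivAt (fun s => Real.sinh (c * s)) (Real.cosh (c * s) * (c * 1)) s :=
    fun s => (Real.hasDerivAt_sinh (c * s)).comp s ((hasDerivAt_id s).const_mul c)
  refine isIncreasingDiffeo_of_deriv_pos (by fun_prop) (fun s _ => ?_)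
    (image_Ici_eq_Ici (by fun_prop) (by simp)
      (fun s hs => Real.sinh_nonneg_iff.2 (by positivity)) fun y => ?_)
  · rw [(hd s).deriv]
    have := Real.cosh_pos (c * s)
    positivity
  · refine ⟨max y 0 / c, by positivity, ?_⟩
    rw [mul_div_cancel₀ _ hc.ne']
    exact (le_max_left y 0).trans (Real.self_le_sinh_iff.2 (le_max_right y 0))

/-! ### The half-sphere integral -/

/-- The value at hyperbolic distance `s` of the invariant Poisson integral of the difference of
the indicator functions of two opposite half spheres. -/
noncomputable def halfSphereIntegral (m : ℕ) (s : ℝ) : ℝ :=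
  2 * (sechMass m)⁻¹ * ∫ y in (0 : ℝ)..s, (Real.cosh y ^ m)⁻¹

theorem integral_Ioi_sech_pow {m : ℕ} : 2 * ∫ y in Set.Ioi (0 : ℝ), (Real.cosh y ^ m)⁻¹ = sechMass m := by
  rw [sechMass, ← integral_comp_abs (f := fun y => (Real.cosh y ^ m)⁻¹)]
  simp only [Real.cosh_abs]

theorem hasDerivAt_halfSphereIntegral {m : ℕ} (s : ℝ) : HasDerivAt (halfSphereIntegral m)
    (2 * (sechMass m)⁻¹ * (Real.cosh s ^ m)⁻¹) s :=
  ((continuous_sech_pow m).integral_hasStrictDerivAt 0 s).hasDerivAt.const_mul _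

theorem deriv_halfSphereIntegral_pos (s : ℝ) : 0 < deriv (halfSphereIntegral m) s := by
  rw [(hasDerivAt_halfSphereIntegral s).deriv]
  have h1 := sechMass_pos (two_le_fact (m := m))
  have h2 := Real.cosh_pos s
  positivity

theorem isIncreasingDiffeo_halfSphereIntegral :
    IsIncreasingDiffeo (halfSphereIntegral m) (Set.Ici 0) (Set.Ico 0 1) := by
  have hd : Differentiable ℝ (halfSphereIntegral m) := fun s =>
    (hasDerivAt_halfSphereIntegral s).differentiableAt
  have h0 : halfSphereIntegral m 0 = 0 := by simp [halfSphereIntegral]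
  have hmono : StrictMono (halfSphereIntegral m) :=
    strictMono_of_deriv_pos deriv_halfSphereIntegral_pos
  have hlim : Filter.Tendsto (halfSphereIntegral m) Filter.atTop (nhds 1) := by
    have h1 := (intervalIntegral_tendsto_integral_Ioi (f := fun y => (Real.cosh y ^ m)⁻¹) 0
      (integrable_sech_pow (two_le_fact (m := m))).integrableOn Filter.tendsto_id).const_mul
      (2 * (sechMass m)⁻¹)
    have h2 : 2 * (sechMass m)⁻¹ * ∫ y in Set.Ioi (0 : ℝ), (Real.cosh y ^ m)⁻¹ = 1 := by
      rw [mul_right_comm, integral_Ioi_sech_pow,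
        mul_inv_cancel₀ (sechMass_pos (two_le_fact (m := m))).ne']
    rw [h2] at h1
    exact h1
  refine isIncreasingDiffeo_of_deriv_pos ?_ (fun s _ => deriv_halfSphereIntegral_pos s)
    (image_Ici_eq_Ico hd.continuous h0 (fun s hs => h0 ▸ hmono.monotone hs)
      (fun s => (hmono (lt_add_one s)).trans_le (hmono.monotone.ge_of_tendsto hlim _)) hlim)
  rw [contDiff_infty_iff_deriv]
  refine ⟨hd, ?_⟩
  have : deriv (halfSphereIntegral m) = fun s => 2 * (sechMass m)⁻¹ * (Real.cosh s ^ m)⁻¹ :=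
    funext fun s => (hasDerivAt_halfSphereIntegral s).deriv
  rw [this]
  exact contDiff_const.mul ((Real.contDiff_cosh.pow m).inv fun y =>
    (pow_pos (Real.cosh_pos y) m).ne')

theorem ratio_tanh (s y : ℝ) : ratio s (Real.tanh y) = Real.cosh y / Real.cosh (y - s) := by
  rw [ratio, moebDen_tanh, inv_div, sub_eq_add_neg]

theorem tanh_pos_iff (y : ℝ) : 0 < Real.tanh y ↔ 0 < y := by
  rw [Real.tanh_eq_sinh_div_cosh, div_pos_iff_of_pos_right (Real.cosh_pos y), Real.sinh_pos_iff]

/-- Translating `y` by `s` turns kernel times density into the density itself and moves the jump of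
the sign to `-s`. What remains is the mass to the right of `-s` minus the mass to its left. -/
theorem integral_sign_mul_ratio (s : ℝ) :
    ∫ t, signedPow 1 t * ratio s t ^ m ∂(zonal m) = halfSphereIntegral m s := by
  have hi := integrable_sech_pow (two_le_fact (m := m))
  have hmeas : Measurable fun t => signedPow 1 t * ratio s t ^ m := by
    unfold ratio moebDen
    fun_prop
  have h1 : ∫ y : ℝ, (Real.cosh y ^ m)⁻¹ * (signedPow 1 (Real.tanh y) * ratio s (Real.tanh y) ^ m)
      = ∫ y : ℝ, signedPow 1 (Real.tanh (y + s)) * (Real.cosh y ^ m)⁻¹ := by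
    rw [← integral_add_right_eq_self _ s]
    congr 1
    ext y
    have h2 := Real.cosh_pos (y + s)
    have h3 := Real.cosh_pos y
    rw [ratio_tanh, add_sub_cancel_right, div_pow]
    field_simp
  have hpos : ∀ y : ℝ, 0 < y + s → signedPow 1 (Real.tanh (y + s)) = 1 := fun y hy => by
    rw [signedPow_of_pos 1 ((tanh_pos_iff _).2 hy)]
    simp
  have hneg : ∀ y : ℝ, y + s < 0 → signedPow 1 (Real.tanh (y + s)) = -1 := fun y hy => by
    rw [← neg_neg (y + s), Real.tanh_neg, signedPow_neg,
      signedPow_of_pos 1 ((tanh_pos_iff _).2 (by linarith))]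
    simp
  have h2 : ∀ᵐ y : ℝ, signedPow 1 (Real.tanh (y + s)) * (Real.cosh y ^ m)⁻¹ =
      2 * (Set.Ioi (-s)).indicator (fun y => (Real.cosh y ^ m)⁻¹) y - (Real.cosh y ^ m)⁻¹ := by
    have : ∀ᵐ y : ℝ, y ≠ -s := by simp [ae_iff]
    filter_upwards [this] with y hy
    rcases lt_or_gt_of_ne hy with h | h
    · rw [hneg y (by linarith), Set.indicator_of_notMem (by simpa using h.le)]
      ring
    · rw [hpos y (by linarith), Set.indicator_of_mem (by simpa using h)]
      ring
  rw [integral_zonal hmeas.aestronglyMeasurable, h1, integral_congr_ae h2,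
    integral_sub ((hi.indicator measurableSet_Ioi).const_mul 2) hi, integral_const_mul,
    integral_indicator measurableSet_Ioi]
  have h3 : ∫ y in Set.Ioi (-s), (Real.cosh y ^ m)⁻¹ =
      (∫ y in (-s)..0, (Real.cosh y ^ m)⁻¹) + ∫ y in Set.Ioi (0 : ℝ), (Real.cosh y ^ m)⁻¹ :=
    (intervalIntegral.integral_interval_add_Ioi hi.integrableOn hi.integrableOn).symm
  have h4 : ∫ y in (-s)..0, (Real.cosh y ^ m)⁻¹ = ∫ y in (0 : ℝ)..s, (Real.cosh y ^ m)⁻¹ := by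
    have := intervalIntegral.integral_comp_neg (a := 0) (b := s) fun y => (Real.cosh y ^ m)⁻¹
    simp only [Real.cosh_neg, neg_zero] at this
    exact this.symm
  have h5 : ∫ y : ℝ, (Real.cosh y ^ m)⁻¹ = 2 * ∫ y in Set.Ioi (0 : ℝ), (Real.cosh y ^ m)⁻¹ := by
    rw [integral_Ioi_sech_pow, sechMass]
  rw [h3, h4, h5, halfSphereIntegral]
  ring

/-! ### From the sphere to the interval, and Hölder's inequality -/

instance : IsProbabilityMeasure (σ (m + 1)) := isProbabilityMeasure_sigma m

theorem measurePreserving_inner {v : E (m + 1)} (hv : ‖v‖ = 1) :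
    MeasurePreserving (fun ζ : S (m + 1) => inner ℝ v (ζ : E (m + 1))) (σ (m + 1)) (zonal m) :=
  ⟨by fun_prop, map_inner_eq_zonal two_le_fact hv⟩

theorem integral_inner {F : Type*} [NormedAddCommGroup F] [NormedSpace ℝ F] {v : E (m + 1)}
    (hv : ‖v‖ = 1) {f : ℝ → F} (hf : AEStronglyMeasurable f (zonal m)) :
    ∫ ζ : S (m + 1), f (inner ℝ v (ζ : E (m + 1))) ∂(σ (m + 1)) = ∫ t, f t ∂(zonal m) := by
  have h := measurePreserving_inner hv
  rw [← h.map_eq] at hf ⊢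
  exact (integral_map h.measurable.aemeasurable hf).symm

theorem inner_mem_Icc {m : ℕ} {v : E (m + 1)} (hv : ‖v‖ = 1) (ζ : S (m + 1)) :
    inner ℝ v (ζ : E (m + 1)) ∈ Set.Icc (-1 : ℝ) 1 := by
  have h := abs_real_inner_le_norm v (ζ : E (m + 1))
  rw [hv, norm_eq_of_mem_sphere, one_mul] at h
  exact abs_le.1 h

/-- The kernel at the point at hyperbolic distance `s` from the origin in the direction `v`. -/
theorem kernel_tanh_smul {m : ℕ} {v : E (m + 1)} (hv : ‖v‖ = 1) (s : ℝ) (ζ : S (m + 1)) :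
    kernel (m + 1) (Real.tanh (s / 2) • v) ζ = ratio s (inner ℝ v (ζ : E (m + 1))) ^ m := by
  obtain ⟨u, rfl⟩ : ∃ u, s = 2 * u := ⟨s / 2, by ring⟩
  rw [mul_div_cancel_left₀ u two_ne_zero]
  have hc := Real.cosh_pos u
  have hL := moebDen_pos (-(2 * u)) (inner_mem_Icc hv ζ)
  have h1 : ‖Real.tanh u • v - (ζ : E (m + 1))‖ ^ 2 =
      Real.tanh u ^ 2 - 2 * (Real.tanh u * inner ℝ v (ζ : E (m + 1))) + 1 := by
    rw [norm_sub_sq_real, norm_smul, hv, mul_one, norm_eq_of_mem_sphere, inner_smul_left]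
    simp
  have h2 : 1 - Real.tanh u ^ 2 = (Real.cosh u ^ 2)⁻¹ := by
    rw [Real.tanh_eq_sinh_div_cosh]
    field_simp
    linarith [Real.cosh_sq_sub_sinh_sq u]
  have h3 : Real.tanh u ^ 2 - 2 * (Real.tanh u * inner ℝ v (ζ : E (m + 1))) + 1 =
      moebDen (-(2 * u)) (inner ℝ v (ζ : E (m + 1))) * (Real.cosh u ^ 2)⁻¹ := by
    rw [moebDen, Real.cosh_neg, Real.sinh_neg, Real.cosh_two_mul, Real.sinh_two_mul,
      Real.tanh_eq_sinh_div_cosh]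
    field_simp
    ring
  rw [kernel, h1, h3, norm_smul, hv, mul_one, Real.norm_eq_abs, sq_abs, h2, Nat.add_sub_cancel,
    ratio]
  congr 1
  field_simp

theorem exists_eq_tanh_smul {m : ℕ} {x : E (m + 1)} (hx : x ∈ ball (0 : E (m + 1)) 1) :
    ∃ (s : ℝ) (v : E (m + 1)), 0 ≤ s ∧ ‖v‖ = 1 ∧ x = Real.tanh (s / 2) • v ∧
      ‖x‖ = Real.tanh (s / 2) := by
  obtain ⟨s, hs, hsx⟩ := isIncreasingDiffeo_tanh_half.2.1.surjOn
    (show ‖x‖ ∈ Set.Ico (0 : ℝ) 1 from ⟨norm_nonneg x, by simpa using hx⟩)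
  simp only at hsx
  rcases eq_or_ne x 0 with rfl | hx0
  · refine ⟨s, e (m + 1), hs, norm_e (by omega), ?_, hsx.symm⟩
    rw [hsx, norm_zero, zero_smul]
  · have h := norm_pos_iff.2 hx0
    refine ⟨s, ‖x‖⁻¹ • x, hs, ?_, ?_, hsx.symm⟩
    · rw [norm_smul, norm_inv, norm_norm, inv_mul_cancel₀ h.ne']
    · rw [hsx, smul_smul, mul_inv_cancel₀ h.ne', one_smul]

theorem memLp_of_continuousOn {f : ℝ → ℝ} (hf : ContinuousOn f (Set.Icc (-1) 1)) (p : ℝ≥0∞) :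
    MemLp f p (zonal m) := by
  obtain ⟨R, hR⟩ := isCompact_Icc.exists_bound_of_continuousOn hf
  refine MemLp.of_bound (integrable_zonal_of_continuousOn hf).1 R ?_
  filter_upwards [ae_zonal_mem_Icc m] with t ht
  exact hR t ht

theorem continuousOn_ratio_pow_sub {m : ℕ} (s a : ℝ) :
    ContinuousOn (fun t => ratio s t ^ m - a) (Set.Icc (-1) 1) :=
  ((continuousOn_ratio s).pow m).sub continuousOn_const

/-- Hölder's inequality for the integral of a scalar multiple of a vector field. -/
theorem norm_integral_smul_le {α F : Type*} [MeasurableSpace α] {μ : Measure α}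
    [NormedAddCommGroup F] [NormedSpace ℝ F] {p q : ℝ≥0∞} (hpq : ENNReal.HolderConjugate p q)
    {g : α → ℝ} {φ : α → F} (hg : MemLp g q μ) (hφ : MemLp φ p μ) :
    ‖∫ x, g x • φ x ∂μ‖ ≤ (eLpNorm g q μ).toReal * (eLpNorm φ p μ).toReal := by
  have : ENNReal.HolderTriple q p 1 := hpq.symm
  have h1 := eLpNorm_smul_le_mul_eLpNorm (p := q) (q := p) (r := 1) hφ.1 hg.1
  have h2 := (enorm_integral_le_lintegral_enorm (μ := μ) fun x => g x • φ x).trans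
    (eLpNorm_one_eq_lintegral_enorm.symm.le.trans h1)
  rw [← ENNReal.toReal_mul, ← toReal_enorm]
  exact ENNReal.toReal_mono (ENNReal.mul_ne_top hg.2.ne hφ.2.ne) h2

theorem integrable_smul_of_memLp {α F : Type*} [MeasurableSpace α] {μ : Measure α}
    [NormedAddCommGroup F] [NormedSpace ℝ F] {p q : ℝ≥0∞} (hpq : ENNReal.HolderConjugate p q)
    {g : α → ℝ} {φ : α → F} (hg : MemLp g q μ) (hφ : MemLp φ p μ) :
    Integrable (fun x => g x • φ x) μ := by
  have : ENNReal.HolderTriple q p 1 := hpq.symm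
  exact memLp_one_iff_integrable.1 (hφ.smul hg)

theorem toReal_eLpNorm_eq {α : Type*} [MeasurableSpace α] {μ : Measure α} {q : ℝ≥0∞}
    (hq0 : q ≠ 0) (hq : q ≠ ⊤) {g : α → ℝ} (hg : MemLp g q μ) :
    (eLpNorm g q μ).toReal = (∫ x, |g x| ^ q.toReal ∂μ) ^ (1 / q.toReal) := by
  rw [hg.eLpNorm_eq_integral_rpow_norm hq0 hq, ENNReal.toReal_ofReal, one_div]
  · simp only [Real.norm_eq_abs]
  · exact Real.rpow_nonneg (integral_nonneg fun x => by positivity) _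

theorem memLp_comp_inner {v : E (m + 1)} (hv : ‖v‖ = 1) {f : ℝ → ℝ} {p : ℝ≥0∞}
    (hf : MemLp f p (zonal m)) :
    MemLp (fun ζ : S (m + 1) => f (inner ℝ v (ζ : E (m + 1)))) p (σ (m + 1)) :=
  hf.comp_measurePreserving (measurePreserving_inner hv)

theorem eLpNorm_comp_inner {v : E (m + 1)} (hv : ‖v‖ = 1) {f : ℝ → ℝ} (p : ℝ≥0∞)
    (hf : AEStronglyMeasurable f (zonal m)) :
    eLpNorm (fun ζ : S (m + 1) => f (inner ℝ v (ζ : E (m + 1)))) p (σ (m + 1)) =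
      eLpNorm f p (zonal m) :=
  eLpNorm_comp_measurePreserving hf (measurePreserving_inner hv)

theorem kernel_zero {m : ℕ} (ζ : S (m + 1)) : kernel (m + 1) 0 ζ = 1 := by
  simp [kernel]

theorem poisson_zero {m : ℕ} {F : Type*} [NormedAddCommGroup F] [NormedSpace ℝ F] (φ : S (m + 1) → F) :
    poisson (m + 1) φ 0 = ∫ ζ, φ ζ ∂(σ (m + 1)) := by
  simp only [poisson, kernel_zero, one_smul]

/-- The basic estimate: a constant may be subtracted from the kernel. -/
theorem norm_poisson_le {p q : ℝ≥0∞} (hpq : ENNReal.HolderConjugate p q) {φ : S (m + 1) → E (m + 1)}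
    (hφ : Admissible (m + 1) p φ) {v : E (m + 1)} (hv : ‖v‖ = 1) (s a : ℝ) :
    ‖poisson (m + 1) φ (Real.tanh (s / 2) • v)‖ ≤
      (eLpNorm (fun t => ratio s t ^ m - a) q (zonal m)).toReal * normLp (m + 1) p φ := by
  have hc := continuousOn_ratio_pow_sub (m := m) s a
  have hg := memLp_comp_inner hv (memLp_of_continuousOn (m := m) hc q)
  have hone : MemLp (fun _ : S (m + 1) => a) q (σ (m + 1)) := memLp_const a
  have h1 : poisson (m + 1) φ (Real.tanh (s / 2) • v) =
      ∫ ζ : S (m + 1), (ratio s (inner ℝ v (ζ : E (m + 1))) ^ m - a) • φ ζ ∂(σ (m + 1)) := by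
    have h2 : ∫ ζ : S (m + 1), a • φ ζ ∂(σ (m + 1)) = 0 := by
      rw [integral_smul, ← poisson_zero, hφ.2, smul_zero]
    have h3 := integral_add (integrable_smul_of_memLp hpq hg hφ.1)
      (integrable_smul_of_memLp hpq hone hφ.1)
    rw [h2, add_zero] at h3
    rw [← h3, poisson]
    refine integral_congr_ae (Filter.Eventually.of_forall fun ζ => ?_)
    simp only [kernel_tanh_smul hv, ← add_smul, sub_add_cancel]
  rw [h1, ← eLpNorm_comp_inner hv q (memLp_of_continuousOn (m := m) hc q).1]
  exact norm_integral_smul_le hpq hg hφ.1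

/-! ### Zonal fields as candidates for equality -/

/-- The vector field in the direction `v` whose length is a function of the height over the
equator. -/
noncomputable def zonalField (v : E (m + 1)) (w : ℝ → ℝ) (ζ : S (m + 1)) : E (m + 1) :=
  w (inner ℝ v (ζ : E (m + 1))) • v

theorem memLp_zonalField {v : E (m + 1)} (hv : ‖v‖ = 1) {w : ℝ → ℝ} {p : ℝ≥0∞}
    (hw : MemLp w p (zonal m)) : MemLp (zonalField v w) p (σ (m + 1)) := by
  have h := memLp_comp_inner hv hw
  refine MemLp.of_le h (h.1.smul_const v) (Filter.Eventually.of_forall fun ζ => ?_)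
  rw [zonalField, norm_smul, hv, mul_one]

theorem normLp_zonalField {v : E (m + 1)} (hv : ‖v‖ = 1) {w : ℝ → ℝ} {p : ℝ≥0∞}
    (hw : AEStronglyMeasurable w (zonal m)) :
    normLp (m + 1) p (zonalField v w) = (eLpNorm w p (zonal m)).toReal := by
  rw [normLp, ← eLpNorm_comp_inner hv p hw]
  congr 1
  refine eLpNorm_congr_norm_ae (Filter.Eventually.of_forall fun ζ => ?_)
  rw [zonalField, norm_smul, hv, mul_one]

theorem integral_smul_zonalField {v : E (m + 1)} (hv : ‖v‖ = 1) {w h : ℝ → ℝ}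
    (hw : AEStronglyMeasurable w (zonal m)) (hh : AEStronglyMeasurable h (zonal m)) :
    ∫ ζ : S (m + 1), h (inner ℝ v (ζ : E (m + 1))) • zonalField v w ζ ∂(σ (m + 1)) =
      (∫ t, h t * w t ∂(zonal m)) • v := by
  simp only [zonalField, smul_smul]
  rw [integral_smul_const]
  congr 1
  exact integral_inner hv (hh.mul hw)

theorem admissible_zonalField {v : E (m + 1)} (hv : ‖v‖ = 1) {w : ℝ → ℝ} {p : ℝ≥0∞}
    (hw : MemLp w p (zonal m)) (h0 : ∫ t, w t ∂(zonal m) = 0) :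
    Admissible (m + 1) p (zonalField v w) := by
  refine ⟨memLp_zonalField hv hw, ?_⟩
  have := integral_smul_zonalField hv (h := fun _ => 1) hw.1 aestronglyMeasurable_const
  simp only [one_smul, one_mul, h0, zero_smul] at this
  rw [poisson_zero, this]

theorem poisson_zonalField {v : E (m + 1)} (hv : ‖v‖ = 1) {w : ℝ → ℝ}
    (hw : AEStronglyMeasurable w (zonal m)) (s : ℝ) :
    poisson (m + 1) (zonalField v w) (Real.tanh (s / 2) • v) =
      (∫ t, ratio s t ^ m * w t ∂(zonal m)) • v := by
  have hc : ContinuousOn (fun t => ratio s t ^ m) (Set.Icc (-1) 1) := (continuousOn_ratio s).pow m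
  rw [← integral_smul_zonalField hv hw (integrable_zonal_of_continuousOn (m := m) hc).1, poisson]
  simp only [kernel_tanh_smul hv]

theorem memLp_signedPow {q : ℝ} (hq : 1 ≤ q) {w : ℝ → ℝ} (hwm : Measurable w)
    (hw : ContinuousOn w (Set.Icc (-1) 1)) (p : ℝ≥0∞) :
    MemLp (fun t => signedPow q (w t)) p (zonal m) := by
  obtain ⟨R, hR⟩ := isCompact_Icc.exists_bound_of_continuousOn hw
  refine MemLp.of_bound ((measurable_signedPow q).comp hwm).aestronglyMeasurable
    (max R 0 ^ (q - 1)) ?_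
  filter_upwards [ae_zonal_mem_Icc m] with t ht
  rcases eq_or_ne (w t) 0 with h | h
  · rw [h, signedPow_zero, norm_zero]
    positivity
  · rw [Real.norm_eq_abs, abs_signedPow q h]
    exact Real.rpow_le_rpow (abs_nonneg _) ((hR t ht).trans (le_max_left _ _)) (by linarith)

theorem one_div_toReal_add {p q : ℝ≥0∞} (hpq : ENNReal.HolderConjugate p q) :
    1 / p.toReal + 1 / q.toReal = 1 := by
  have h := congrArg ENNReal.toReal (ENNReal.HolderConjugate.inv_add_inv_eq_one p q)
  have hp : p ≠ 0 := ENNReal.HolderConjugate.ne_zero p q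
  have hq : q ≠ 0 := ENNReal.HolderConjugate.ne_zero q p
  rw [ENNReal.toReal_add (ENNReal.inv_ne_top.2 hp) (ENNReal.inv_ne_top.2 hq), ENNReal.toReal_inv,
    ENNReal.toReal_inv, ENNReal.toReal_one] at h
  rw [one_div, one_div, h]

/-- The equality case of Hölder: `(q - 1) p = q`. For `p = ∞`, `q = 1`, the signed power is a sign,
of modulus one only where `w ≠ 0`, hence the last hypothesis. -/
theorem toReal_eLpNorm_signedPow {p q : ℝ≥0∞} (hpq : ENNReal.HolderConjugate p q) (hq : q ≠ ⊤)
    {w : ℝ → ℝ} (hwm : Measurable w) (hw : ContinuousOn w (Set.Icc (-1) 1))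
    (hw0 : ∀ᵐ t ∂(zonal m), w t ≠ 0) :
    (eLpNorm (fun t => signedPow q.toReal (w t)) p (zonal m)).toReal =
      (∫ t, |w t| ^ q.toReal ∂(zonal m)) ^ (1 / p.toReal) := by
  have hsum := one_div_toReal_add hpq
  have hp0 : p ≠ 0 := ENNReal.HolderConjugate.ne_zero p q
  have hq0 : q ≠ 0 := ENNReal.HolderConjugate.ne_zero q p
  have hqr : 0 < q.toReal := ENNReal.toReal_pos hq0 hq
  have hq1 : 1 ≤ q.toReal := by
    have h1 : 0 ≤ 1 / p.toReal := by positivity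
    rw [← div_le_one₀ hqr]
    linarith
  by_cases hp : p = ⊤
  · subst hp
    simp only [ENNReal.toReal_top, div_zero, zero_add] at hsum
    have hq' : q.toReal = 1 := by
      field_simp at hsum
      exact hsum.symm
    have h2 : eLpNorm (fun t => signedPow q.toReal (w t)) ⊤ (zonal m) =
        eLpNorm (fun _ : ℝ => (1 : ℝ)) ⊤ (zonal m) := by
      refine eLpNorm_congr_norm_ae ?_
      filter_upwards [hw0] with t ht
      rw [Real.norm_eq_abs, abs_signedPow _ ht, hq', sub_self, Real.rpow_zero, norm_one]
    rw [h2, eLpNorm_const _ (by simp) (NeZero.ne _)]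
    simp
  · have hpr : 0 < p.toReal := ENNReal.toReal_pos hp0 hp
    have hmem := memLp_signedPow (m := m) hq1 hwm hw p
    rw [toReal_eLpNorm_eq hp0 hp hmem]
    congr 1
    refine integral_congr_ae ?_
    filter_upwards [hw0] with t ht
    rw [abs_signedPow _ ht, ← Real.rpow_mul (abs_nonneg _)]
    congr 1
    field_simp at hsum
    linarith

theorem signedPow_one_eq {x y : ℝ} (hx : 0 < x) (hy : 0 < y) : signedPow 1 x = signedPow 1 y := by
  rw [signedPow_of_pos 1 hx, signedPow_of_pos 1 hy]
  simp

theorem signedPow_one_diffQuot (s : ℝ) {t : ℝ} (ht : t ∈ Set.Icc (-1 : ℝ) 1) :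
    signedPow 1 (diffQuot m s 0 t) = signedPow 1 t := by
  have h0 : (0 : ℝ) ∈ Set.Icc (-1 : ℝ) 1 := by norm_num
  rcases lt_trichotomy t 0 with h | rfl | h
  · have := signedPow_one_eq (neg_pos.2 (diffQuot_neg (m := m) dim_pos s ht h0 h)) (neg_pos.2 h)
    simpa only [signedPow_neg, neg_inj] using this
  · simp [diffQuot]
  · exact signedPow_one_eq (diffQuot_pos dim_pos s ht h0 h) h

theorem integral_signedPow_zonal {m : ℕ} (q : ℝ) : ∫ t, signedPow q t ∂(zonal m) = 0 := by
  have h := integral_zonal_neg (m := m) (signedPow q)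
  simp only [signedPow_neg, integral_neg] at h
  linarith

/-- For `q = 1` only the sign of the quotient counts, and relative to the height `0` it is the sign
of `t`, which is odd under a symmetric law: the best constant is the median. -/
theorem eulerLagrange_one_zero (s : ℝ) : eulerLagrange m 1 s 0 = 0 := by
  refine (integral_congr_ae ?_).trans (integral_signedPow_zonal (m := m) 1)
  filter_upwards [ae_zonal_mem_Icc m] with t ht
  exact signedPow_one_diffQuot (m := m) s ht

theorem exists_mem_Icc_eulerLagrange_eq_zero {q : ℝ} (hq : 1 ≤ q) (s : ℝ) :
    ∃ t₀ ∈ Set.Icc (-1 : ℝ) 1, eulerLagrange m q s t₀ = 0 := by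
  rcases hq.eq_or_lt with rfl | hq
  · exact ⟨0, by norm_num, eulerLagrange_one_zero s⟩
  · exact ⟨_, tanh_mem_Icc _, eulerLagrange_critPoint hq s⟩

theorem one_le_toReal {p q : ℝ≥0∞} (hpq : ENNReal.HolderConjugate p q) (hq : q ≠ ⊤) :
    1 ≤ q.toReal := by
  have := (ENNReal.toReal_le_toReal ENNReal.one_ne_top hq).2 (ENNReal.HolderConjugate.one_le q p)
  simpa using this

/-! ### The function `G` in the hyperbolic parameter -/

theorem integral_kernel_e {q : ℝ} (hq : 0 ≤ q) (s a : ℝ) :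
    ∫ η, |kernel (m + 1) (Real.tanh (s / 2) • e (m + 1)) η - a| ^ q ∂(σ (m + 1)) =
      ∫ t, |ratio s t ^ m - a| ^ q ∂(zonal m) := by
  have he : ‖e (m + 1)‖ = 1 := norm_e (by omega)
  simp only [kernel_tanh_smul he]
  exact integral_inner he (f := fun t => |ratio s t ^ m - a| ^ q)
    (integrable_zonal_of_continuousOn (m := m) (continuousOn_abs_ratio_sub_rpow hq s a)).1

/-- The lower bound holds for every real constant and the minimizer `ratio s t₀ ^ m` is positive, so
restricting the infimum to `[0, ∞)` changes nothing. -/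
theorem G_tanh {q : ℝ≥0∞} (hq : q ≠ ⊤) (hq1 : 1 ≤ q.toReal) {s : ℝ} (hs : 0 ≤ s) {t₀ : ℝ}
    (ht₀ : t₀ ∈ Set.Icc (-1 : ℝ) 1) (h : eulerLagrange m q.toReal s t₀ = 0) :
    G (m + 1) q (Real.tanh (s / 2)) =
      Real.sinh s * distPow m q.toReal s t₀ ^ (1 / q.toReal) := by
  have hq0 : 0 < q.toReal := by linarith
  have hS := Real.sinh_nonneg_iff.2 hs
  have hH := (distPow_pos (m := m) hq0.le s ht₀).le
  have hpow : (Real.sinh s ^ q.toReal * distPow m q.toReal s t₀) ^ (1 / q.toReal) =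
      Real.sinh s * distPow m q.toReal s t₀ ^ (1 / q.toReal) := by
    rw [Real.mul_rpow (by positivity) hH, ← Real.rpow_mul hS, mul_one_div_cancel hq0.ne',
      Real.rpow_one]
  rw [G, if_neg hq, ← hpow]
  simp only [integral_kernel_e hq0.le]
  refine le_antisymm ?_ ?_
  · refine (ciInf_le ⟨0, ?_⟩ (⟨ratio s t₀ ^ m, (pow_pos (ratio_pos s ht₀) m).le⟩ : Set.Ici (0 : ℝ))).trans
      (le_of_eq ?_)
    · rintro _ ⟨a, rfl⟩
      exact Real.rpow_nonneg (integral_nonneg fun t => by positivity) _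
    · rw [integral_abs_ratio_sub_rpow hs ht₀]
  · refine le_ciInf fun a => Real.rpow_le_rpow (by positivity) ?_ (by positivity)
    exact distPow_le_integral hq1 hs ht₀ h a

theorem G_tanh_eq_distConst {q : ℝ≥0∞} (hq : q ≠ ⊤) (hq1 : 1 < q.toReal) {s : ℝ} (hs : 0 ≤ s) :
    G (m + 1) q (Real.tanh (s / 2)) = distConst m hq1 s :=
  G_tanh hq hq1.le hs (tanh_mem_Icc _) (eulerLagrange_critPoint hq1 s)

/-- The absolute value is the difference times `sign t`; the constant `ratio s 0 ^ m` then drops out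
because the sign has mean zero. -/
theorem G_one_tanh {s : ℝ} (hs : 0 ≤ s) :
    G (m + 1) 1 (Real.tanh (s / 2)) = halfSphereIntegral m s := by
  have h0 : (0 : ℝ) ∈ Set.Icc (-1 : ℝ) 1 := by norm_num
  have h1 : (1 : ℝ≥0∞).toReal = 1 := ENNReal.toReal_one
  rw [G_tanh ENNReal.one_ne_top h1.ge hs h0 (by rw [h1, eulerLagrange_one_zero]), h1, div_one,
    Real.rpow_one, ← integral_sign_mul_ratio, distPow, ← integral_const_mul]
  have hi : ∀ a, Integrable (fun t => signedPow 1 t * a) (zonal m) := fun a =>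
    (integrable_signedPow_of_continuousOn le_rfl measurable_id continuousOn_id).mul_const a
  have hi' : Integrable (fun t => signedPow 1 t * ratio s t ^ m) (zonal m) := by
    obtain ⟨R, hR⟩ := isCompact_Icc.exists_bound_of_continuousOn ((continuousOn_ratio s).pow m)
    refine (integrable_signedPow_of_continuousOn le_rfl measurable_id continuousOn_id).mul_bdd (c := R)
      (integrable_zonal_of_continuousOn (m := m) ((continuousOn_ratio s).pow m)).1 ?_
    filter_upwards [ae_zonal_mem_Icc m] with t ht
    exact hR t ht
  have h2 := integral_sub hi' (hi (ratio s 0 ^ m))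
  rw [integral_mul_const, integral_signedPow_zonal, zero_mul, sub_zero] at h2
  rw [← h2]
  refine integral_congr_ae ?_
  filter_upwards [ae_zonal_mem_Icc m] with t ht
  rw [← signedPow_mul_self one_ne_zero, signedPow_one_diffQuot s ht, ← mul_sub,
    ← sinh_mul_diffQuot m s ht h0]
  ring

theorem ratio_one (s : ℝ) : ratio s 1 = Real.exp s := by
  rw [ratio, moebDen, Real.cosh_neg, Real.sinh_neg, mul_one, ← sub_eq_add_neg, Real.cosh_sub_sinh,
    Real.exp_neg, inv_inv]

theorem ratio_neg_one (s : ℝ) : ratio s (-1) = Real.exp (-s) := by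
  rw [ratio, moebDen, Real.cosh_neg, Real.sinh_neg, neg_mul_neg, mul_one, Real.cosh_add_sinh,
    Real.exp_neg]

theorem abs_ratio_pow_sub_cosh_le {m : ℕ} {s : ℝ} (hs : 0 ≤ s) {t : ℝ} (ht : t ∈ Set.Icc (-1 : ℝ) 1) :
    |ratio s t ^ m - Real.cosh (m * s)| ≤ Real.sinh (m * s) := by
  have h1 := pow_le_pow_left₀ (ratio_pos s ht).le (ratio_mono hs (by norm_num) ht.2) m
  have h2 := pow_le_pow_left₀ (ratio_pos s (by norm_num)).le (ratio_mono hs ht ht.1) m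
  rw [ratio_one, ← Real.exp_nat_mul] at h1
  rw [ratio_neg_one, ← Real.exp_nat_mul, mul_neg] at h2
  have h3 := Real.cosh_add_sinh (m * s)
  have h4 := Real.cosh_sub_sinh (m * s)
  rw [abs_le]
  constructor <;> linarith

/-- The kernel ranges between `exp (-m s)` and `exp (m s)`, attained at `-e` and `e`. The best
uniform constant is the midpoint `cosh (m s)`, and the error is half the oscillation. -/
theorem G_top_tanh {m : ℕ} {s : ℝ} (hs : 0 ≤ s) : G (m + 1) ⊤ (Real.tanh (s / 2)) = Real.sinh (m * s) := by
  have he : ‖e (m + 1)‖ = 1 := norm_e (by omega)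
  have hee : inner ℝ (e (m + 1)) (e (m + 1)) = 1 := by
    rw [real_inner_self_eq_norm_sq, he, one_pow]
  let η₁ : S (m + 1) := ⟨e (m + 1), by simpa using he⟩
  let η₂ : S (m + 1) := ⟨-e (m + 1), by simpa using he⟩
  have : Nonempty (S (m + 1)) := ⟨η₁⟩
  rw [G, if_pos rfl]
  simp only [kernel_tanh_smul he]
  refine le_antisymm ?_ (le_ciInf fun a => ?_)
  · refine (ciInf_le ⟨0, ?_⟩ (⟨Real.cosh (m * s), (Real.cosh_pos _).le⟩ : Set.Ici (0 : ℝ))).trans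
      (ciSup_le fun η => abs_ratio_pow_sub_cosh_le hs (inner_mem_Icc he η))
    rintro _ ⟨a, rfl⟩
    exact Real.iSup_nonneg fun η => abs_nonneg _
  · have hb : BddAbove (Set.range fun η : S (m + 1) =>
        |ratio s (inner ℝ (e (m + 1)) (η : E (m + 1))) ^ m - a|) := by
      refine ⟨Real.sinh (m * s) + |Real.cosh (m * s) - a|, ?_⟩
      rintro _ ⟨η, rfl⟩
      exact (abs_sub_le _ (Real.cosh (m * s)) _).trans
        (add_le_add_left (abs_ratio_pow_sub_cosh_le hs (inner_mem_Icc he η)) _)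
    have h1 := le_ciSup hb η₁
    have h2 := le_ciSup hb η₂
    simp only [η₁, η₂, inner_neg_right, hee, ratio_one, ratio_neg_one, ← Real.exp_nat_mul,
      mul_neg] at h1 h2
    have h3 := Real.cosh_add_sinh (m * s)
    have h4 := Real.cosh_sub_sinh (m * s)
    have h5 := le_abs_self (Real.exp (m * s) - a)
    have h6 := neg_abs_le (Real.exp (-(m * s)) - a)
    linarith

theorem U_tanh (s : ℝ) :
    U (m + 1) (Real.tanh (s / 2) • e (m + 1)) = halfSphereIntegral m s := by
  have he : ‖e (m + 1)‖ = 1 := norm_e (by omega)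
  have hc : ContinuousOn (fun t => ratio s t ^ m) (Set.Icc (-1) 1) := (continuousOn_ratio s).pow m
  rw [← integral_sign_mul_ratio, ← integral_inner he (f := fun t => signedPow 1 t * ratio s t ^ m)
    ((measurable_signedPow 1).aestronglyMeasurable.mul (integrable_zonal_of_continuousOn hc).1), U,
    poisson]
  refine integral_congr_ae (Filter.Eventually.of_forall fun ζ => ?_)
  simp only [kernel_tanh_smul he, smul_eq_mul]
  rw [mul_comm]
  congr 1
  simp only [Set.indicator_apply, upper, lower, Set.mem_ofPred_eq,
    real_inner_comm (e (m + 1)) (ζ : E (m + 1))]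
  rcases lt_trichotomy (inner ℝ (e (m + 1)) (ζ : E (m + 1))) 0 with h | h | h
  · rw [if_neg h.not_ge, if_pos h.le, ← neg_neg (inner ℝ (e (m + 1)) (ζ : E (m + 1))),
      signedPow_neg, signedPow_of_pos 1 (neg_pos.2 h)]
    simp
  · rw [h]
    simp [signedPow_zero]
  · rw [if_pos h.le, if_neg h.not_ge, signedPow_of_pos 1 h]
    simp

/-! ### The pointwise estimate and its equality case -/

/-- The distance of the kernel from the constants is attained. -/
theorem exists_eLpNorm_ratio_sub_le {p q : ℝ≥0∞} (hpq : ENNReal.HolderConjugate p q) {s : ℝ}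
    (hs : 0 ≤ s) : ∃ a : ℝ, (eLpNorm (fun t => ratio s t ^ m - a) q (zonal m)).toReal ≤
      G (m + 1) q (Real.tanh (s / 2)) := by
  by_cases hq : q = ⊤
  · subst hq
    refine ⟨Real.cosh (m * s), ?_⟩
    rw [G_top_tanh hs]
    refine ENNReal.toReal_le_of_le_ofReal (Real.sinh_nonneg_iff.2 (by positivity)) ?_
    rw [eLpNorm_exponent_top]
    refine eLpNormEssSup_le_of_ae_bound ?_
    filter_upwards [ae_zonal_mem_Icc m] with t ht
    exact abs_ratio_pow_sub_cosh_le hs ht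
  · have hq1 := one_le_toReal hpq hq
    obtain ⟨t₀, ht₀, h⟩ := exists_mem_Icc_eulerLagrange_eq_zero (m := m) hq1 s
    refine ⟨ratio s t₀ ^ m, le_of_eq ?_⟩
    have hH := (distPow_pos (m := m) (by linarith : 0 ≤ q.toReal) s ht₀).le
    have hS := Real.sinh_nonneg_iff.2 hs
    rw [toReal_eLpNorm_eq (ENNReal.HolderConjugate.ne_zero q p) hq
      (memLp_of_continuousOn (continuousOn_ratio_pow_sub s _) q), integral_abs_ratio_sub_rpow hs ht₀,
      G_tanh hq hq1 hs ht₀ h, Real.mul_rpow (by positivity) hH, ← Real.rpow_mul hS,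
      mul_one_div_cancel (by linarith), Real.rpow_one]

theorem norm_poisson_le_G {p q : ℝ≥0∞} (hpq : ENNReal.HolderConjugate p q)
    {φ : S (m + 1) → E (m + 1)} (hφ : Admissible (m + 1) p φ) {x : E (m + 1)}
    (hx : x ∈ ball (0 : E (m + 1)) 1) :
    ‖poisson (m + 1) φ x‖ ≤ G (m + 1) q ‖x‖ * normLp (m + 1) p φ := by
  obtain ⟨s, v, hs, hv, rfl, hxs⟩ := exists_eq_tanh_smul hx
  obtain ⟨a, ha⟩ := exists_eLpNorm_ratio_sub_le (m := m) hpq hs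
  rw [hxs]
  exact (norm_poisson_le hpq hφ hv s a).trans
    (mul_le_mul_of_nonneg_right ha ENNReal.toReal_nonneg)

theorem rpow_one_div_mul_rpow_one_div {p q : ℝ≥0∞} (hpq : ENNReal.HolderConjugate p q) {x : ℝ}
    (hx : 0 < x) : x ^ (1 / q.toReal) * x ^ (1 / p.toReal) = x := by
  rw [← Real.rpow_add hx, add_comm, one_div_toReal_add hpq, Real.rpow_one]

/-- The field has length `signedPow q (diffQuot m s t₀ t)`: the Euler-Lagrange equation is its
admissibility, and Hölder is an equality for it. Using the quotient rather than the kernel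
difference keeps the field nonzero at `x = 0`. -/
theorem exists_norm_poisson_eq {p q : ℝ≥0∞} (hpq : ENNReal.HolderConjugate p q) (hq : q ≠ ⊤)
    {x : E (m + 1)} (hx : x ∈ ball (0 : E (m + 1)) 1) :
    ∃ φ : S (m + 1) → E (m + 1), Admissible (m + 1) p φ ∧ normLp (m + 1) p φ ≠ 0 ∧
      ‖poisson (m + 1) φ x‖ = G (m + 1) q ‖x‖ * normLp (m + 1) p φ := by
  obtain ⟨s, v, hs, hv, rfl, hxs⟩ := exists_eq_tanh_smul hx
  have hq1 := one_le_toReal hpq hq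
  have hq0 : 0 < q.toReal := by linarith
  obtain ⟨t₀, ht₀, h⟩ := exists_mem_Icc_eulerLagrange_eq_zero (m := m) hq1 s
  have hD := continuousOn_diffQuot m s ht₀
  have hDm := measurable_diffQuot m s t₀
  have hH := distPow_pos (m := m) hq0.le s ht₀
  have hS := Real.sinh_nonneg_iff.2 hs
  have hmem := memLp_signedPow (m := m) hq1 hDm hD p
  have hN : normLp (m + 1) p (zonalField v fun t => signedPow q.toReal (diffQuot m s t₀ t)) =
      distPow m q.toReal s t₀ ^ (1 / p.toReal) := by
    rw [normLp_zonalField hv hmem.1, toReal_eLpNorm_signedPow hpq hq hDm hD ?_, distPow]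
    filter_upwards [ae_zonal_mem_Icc m, ae_zonal_ne t₀] with t ht hne
    exact diffQuot_ne_zero (m := m) dim_pos s ht ht₀ hne
  have hi := integrable_signedPow_of_continuousOn (m := m) hq1 hDm hD
  have hI : ∫ t, ratio s t ^ m * signedPow q.toReal (diffQuot m s t₀ t) ∂(zonal m) =
      Real.sinh s * distPow m q.toReal s t₀ := by
    have hi2 := integrable_zonal_of_continuousOn (m := m)
      (continuousOn_abs_diffQuot_rpow (m := m) hq0.le s ht₀)
    have h1 : ∫ t, (Real.sinh s * |diffQuot m s t₀ t| ^ q.toReal +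
        ratio s t₀ ^ m * signedPow q.toReal (diffQuot m s t₀ t)) ∂(zonal m) =
        Real.sinh s * distPow m q.toReal s t₀ := by
      rw [integral_add (hi2.const_mul _) (hi.const_mul _), integral_const_mul, integral_const_mul,
        ← eulerLagrange, h, mul_zero, add_zero, distPow]
    rw [← h1]
    refine integral_congr_ae ?_
    filter_upwards [ae_zonal_mem_Icc m] with t ht
    rw [← signedPow_mul_self hq0.ne', ← sub_add_cancel (ratio s t ^ m) (ratio s t₀ ^ m),
      ← sinh_mul_diffQuot m s ht ht₀]
    ring
  refine ⟨_, admissible_zonalField hv hmem h, ?_, ?_⟩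
  · rw [hN]
    positivity
  · rw [poisson_zonalField hv hmem.1, hI, norm_smul, hv, mul_one, hxs, hN, G_tanh hq hq1 hs ht₀ h,
      mul_assoc, rpow_one_div_mul_rpow_one_div hpq hH, Real.norm_of_nonneg (by positivity)]

/-! ### Sharpness for `p = 1`: pairs of polar caps -/

/-- The difference of the indicator functions of two opposite polar caps. -/
noncomputable def capPair (τ t : ℝ) : ℝ :=
  (Set.Ioi τ).indicator 1 t - (Set.Iio (-τ)).indicator 1 t

theorem measurable_capPair (τ : ℝ) : Measurable (capPair τ) :=
  (measurable_one.indicator measurableSet_Ioi).sub (measurable_one.indicator measurableSet_Iio)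

theorem capPair_neg (τ t : ℝ) : capPair τ (-t) = -capPair τ t := by
  simp only [capPair, Set.indicator, Set.mem_Ioi, Set.mem_Iio, lt_neg, neg_lt_neg_iff]
  simp

theorem capPair_eq_or {τ : ℝ} (hτ : 0 ≤ τ) (t : ℝ) :
    (τ < t ∧ capPair τ t = 1) ∨ (t < -τ ∧ capPair τ t = -1) ∨ capPair τ t = 0 := by
  by_cases h1 : τ < t
  · exact Or.inl ⟨h1, by simp [capPair, h1, show ¬ t < -τ by linarith]⟩
  · by_cases h2 : t < -τ
    · exact Or.inr (Or.inl ⟨h2, by simp [capPair, h1, h2]⟩)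
    · exact Or.inr (Or.inr (by simp [capPair, h1, h2]))

theorem memLp_capPair {τ : ℝ} (hτ : 0 ≤ τ) (p : ℝ≥0∞) : MemLp (capPair τ) p (zonal m) := by
  refine MemLp.of_bound (measurable_capPair τ).aestronglyMeasurable 1
    (Filter.Eventually.of_forall fun t => ?_)
  rcases capPair_eq_or hτ t with ⟨-, h⟩ | ⟨-, h⟩ | h <;> simp [h]

theorem integral_capPair {m : ℕ} (τ : ℝ) : ∫ t, capPair τ t ∂(zonal m) = 0 := by
  have h := integral_zonal_neg (m := m) (capPair τ)
  simp only [capPair_neg, integral_neg] at h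
  linarith

theorem integral_abs_capPair_pos {τ : ℝ} (h0 : 0 ≤ τ) (h1 : τ < 1) :
    0 < ∫ t, |capPair τ t| ∂(zonal m) := by
  have hi := (memLp_one_iff_integrable.1 (memLp_capPair (m := m) h0 1)).abs
  rw [integral_pos_iff_support_of_nonneg (fun t => abs_nonneg _) hi]
  refine (zonal_Ioo_pos h1 (by linarith) le_rfl).trans_le (measure_mono fun t ht => ?_)
  rcases capPair_eq_or h0 t with ⟨-, h⟩ | ⟨h, -⟩ | h
  · simp [h]
  · linarith [ht.1]
  · simp [capPair, ht.1, show ¬ t < -τ by linarith [ht.1]] at h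

theorem normLp_capPair {v : E (m + 1)} (hv : ‖v‖ = 1) {τ : ℝ} (hτ : 0 ≤ τ) :
    normLp (m + 1) 1 (zonalField v (capPair τ)) = ∫ t, |capPair τ t| ∂(zonal m) := by
  rw [normLp_zonalField hv (memLp_capPair (m := m) hτ 1).1,
    toReal_eLpNorm_eq one_ne_zero ENNReal.one_ne_top (memLp_capPair hτ 1)]
  simp

/-- On the caps `h` lies above `h τ`, respectively below `h (-τ)`. Splitting these bounds into
half-difference and mean, the mean multiplies `capPair`, whose integral is zero. -/
theorem le_integral_mul_capPair {h : ℝ → ℝ} (hc : ContinuousOn h (Set.Icc (-1) 1))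
    (hm : MonotoneOn h (Set.Icc (-1) 1)) {τ : ℝ} (h0 : 0 ≤ τ) (h1 : τ < 1) :
    (h τ - h (-τ)) / 2 * ∫ t, |capPair τ t| ∂(zonal m) ≤ ∫ t, h t * capPair τ t ∂(zonal m) := by
  have hi := memLp_one_iff_integrable.1 (memLp_capPair (m := m) h0 1)
  have hi2 : Integrable (fun t => (h τ - h (-τ)) / 2 * |capPair τ t| +
      (h τ + h (-τ)) / 2 * capPair τ t) (zonal m) := (hi.abs.const_mul _).add (hi.const_mul _)
  have heq : (h τ - h (-τ)) / 2 * ∫ t, |capPair τ t| ∂(zonal m) =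
      ∫ t, ((h τ - h (-τ)) / 2 * |capPair τ t| + (h τ + h (-τ)) / 2 * capPair τ t) ∂(zonal m) := by
    rw [integral_add (hi.abs.const_mul _) (hi.const_mul _), integral_const_mul, integral_const_mul,
      integral_capPair, mul_zero, add_zero]
  rw [heq]
  refine integral_mono_ae hi2 ?_ ?_
  · obtain ⟨R, hR⟩ := isCompact_Icc.exists_bound_of_continuousOn hc
    refine hi.bdd_mul (c := R) (integrable_zonal_of_continuousOn (m := m) hc).1 ?_
    filter_upwards [ae_zonal_mem_Icc m] with t ht
    exact hR t ht
  · filter_upwards [ae_zonal_mem_Icc m] with t ht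
    rcases capPair_eq_or h0 t with ⟨h, hw⟩ | ⟨h, hw⟩ | hw
    · have := hm ⟨by linarith, h1.le⟩ ht h.le
      simp only [hw, abs_one]
      linarith
    · have := hm ht ⟨by linarith, by linarith⟩ h.le
      simp only [hw, abs_neg, abs_one]
      linarith
    · simp [hw]

/-- A bound for the pairing of a monotone function with all pairs of caps bounds its oscillation. -/
theorem sub_div_two_le_of_capPair {h : ℝ → ℝ} (hc : ContinuousOn h (Set.Icc (-1) 1))
    (hm : MonotoneOn h (Set.Icc (-1) 1)) {C : ℝ}
    (hC : ∀ τ, 0 ≤ τ → τ < 1 →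
      ∫ t, h t * capPair τ t ∂(zonal m) ≤ C * ∫ t, |capPair τ t| ∂(zonal m)) :
    (h 1 - h (-1)) / 2 ≤ C := by
  have h1 : ∀ τ ∈ Set.Ico (0 : ℝ) 1, (h τ - h (-τ)) / 2 ≤ C := fun τ hτ =>
    le_of_mul_le_mul_right ((le_integral_mul_capPair (m := m) hc hm hτ.1 hτ.2).trans
      (hC τ hτ.1 hτ.2)) (integral_abs_capPair_pos hτ.1 hτ.2)
  -- The caps shrink to the poles: the bound for `τ < 1` extends to `τ = 1` by continuity.
  have hcont : ContinuousOn (fun τ => (h τ - h (-τ)) / 2) (Set.Icc 0 1) :=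
    ((hc.mono (Set.Icc_subset_Icc_left (by norm_num))).sub
      (hc.comp continuousOn_neg fun τ hτ => ⟨by linarith [hτ.2], by linarith [hτ.1]⟩)).div_const 2
  have hcl : (1 : ℝ) ∈ closure (Set.Ico (0 : ℝ) 1) := by
    rw [closure_Ico zero_ne_one]
    norm_num
  exact ContinuousWithinAt.closure_le hcl
    ((hcont 1 (by norm_num)).mono Set.Ico_subset_Icc_self) continuousWithinAt_const h1

theorem G_top_le {x : E (m + 1)} (hx : x ∈ ball (0 : E (m + 1)) 1) {C : ℝ}
    (hC : ∀ φ : S (m + 1) → E (m + 1), Admissible (m + 1) 1 φ →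
      ‖poisson (m + 1) φ x‖ ≤ C * normLp (m + 1) 1 φ) : G (m + 1) ⊤ ‖x‖ ≤ C := by
  obtain ⟨s, v, hs, hv, rfl, hxs⟩ := exists_eq_tanh_smul hx
  have hc : ContinuousOn (fun t => ratio s t ^ m) (Set.Icc (-1) 1) := (continuousOn_ratio s).pow m
  have h1 := sub_div_two_le_of_capPair (m := m) hc (C := C)
    (fun t ht t' ht' h => pow_le_pow_left₀ (ratio_pos s ht).le (ratio_mono hs ht' h) m)
    fun τ h0 h1 => by
      have h2 := memLp_capPair (m := m) h0 1
      have h3 := hC _ (admissible_zonalField hv h2 (integral_capPair τ))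
      rw [poisson_zonalField hv h2.1, norm_smul, hv, mul_one, normLp_capPair hv h0] at h3
      exact (Real.le_norm_self _).trans h3
  rwa [ratio_one, ratio_neg_one, ← Real.exp_nat_mul, ← Real.exp_nat_mul, mul_neg, ← Real.sinh_eq,
    ← G_top_tanh hs, ← hxs] at h1

/-! ### The gradient at the origin -/

open scoped ContDiff in
/-- The kernel is Lipschitz near the origin, uniformly on the sphere. -/
theorem exists_lipschitz_kernel (n : ℕ) :
    ∃ L : ℝ, 0 ≤ L ∧ ∀ ζ : S n, ∀ x ∈ closedBall (0 : E n) (1 / 2),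
      ∀ y ∈ closedBall (0 : E n) (1 / 2), |kernel n x ζ - kernel n y ζ| ≤ L * ‖x - y‖ := by
  let K : E n × E n → ℝ := fun z => ((1 - ‖z.1‖ ^ 2) / ‖z.1 - z.2‖ ^ 2) ^ (n - 1)
  have hopen : IsOpen {z : E n × E n | z.1 ≠ z.2} := isOpen_ne_fun continuous_fst continuous_snd
  have hK : ContDiffOn ℝ ∞ K {z : E n × E n | z.1 ≠ z.2} := by
    have h1 : ContDiff ℝ ∞ fun z : E n × E n => 1 - ‖z.1‖ ^ 2 :=
      contDiff_const.sub (contDiff_fst.norm_sq ℝ)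
    have h2 : ContDiff ℝ ∞ fun z : E n × E n => ‖z.1 - z.2‖ ^ 2 :=
      (contDiff_fst.sub contDiff_snd).norm_sq ℝ
    exact (h1.contDiffOn.div h2.contDiffOn fun z hz =>
      pow_ne_zero 2 (norm_ne_zero_iff.2 (sub_ne_zero.2 hz))).pow _
  have hsub : ∀ z ∈ closedBall (0 : E n) (1 / 2) ×ˢ sphere (0 : E n) 1, z.1 ≠ z.2 := by
    rintro ⟨x, z⟩ ⟨hx, hz⟩ (rfl : x = z)
    rw [mem_closedBall_zero_iff] at hx
    rw [mem_sphere_zero_iff_norm] at hz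
    simp only at hx hz
    linarith
  obtain ⟨L, hL⟩ := ((isCompact_closedBall (0 : E n) (1 / 2)).prod
    (isCompact_sphere (0 : E n) 1)).exists_bound_of_continuousOn
    ((hK.continuousOn_fderiv_of_isOpen hopen (by simp)).mono hsub)
  refine ⟨max L 0, le_max_right _ _, fun ζ x hx y hy => ?_⟩
  have hmem : ∀ w ∈ closedBall (0 : E n) (1 / 2) ×ˢ ({(ζ : E n)} : Set (E n)),
      w ∈ closedBall (0 : E n) (1 / 2) ×ˢ sphere (0 : E n) 1 := by
    rintro ⟨w, z⟩ ⟨hw, rfl⟩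
    exact ⟨hw, ζ.2⟩
  have h := Convex.norm_image_sub_le_of_norm_fderiv_le (𝕜 := ℝ) (f := K) (C := max L 0)
    (fun w hw => (hK.contDiffAt (hopen.mem_nhds (hsub w (hmem w hw)))).differentiableAt (by simp))
    (fun w hw => (hL w (hmem w hw)).trans (le_max_left _ _))
    ((convex_closedBall (0 : E n) (1 / 2)).prod (convex_singleton (ζ : E n)))
    (show (y, (ζ : E n)) ∈ _ from ⟨hy, rfl⟩) (show (x, (ζ : E n)) ∈ _ from ⟨hx, rfl⟩)
  simpa [K, kernel, Prod.norm_def] using h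

/-- At the origin the numerator is stationary and the base equals `1`; only `‖x - ζ‖⁻²`, with
gradient `2ζ`, contributes. -/
theorem hasFDerivAt_div_norm_sub_sq_pow {V : Type*} [NormedAddCommGroup V] [InnerProductSpace ℝ V]
    {ζ : V} (hζ : ‖ζ‖ = 1) (m : ℕ) :
    HasFDerivAt (fun x => ((1 - ‖x‖ ^ 2) / ‖x - ζ‖ ^ 2) ^ m) ((2 * m : ℝ) • innerSL ℝ ζ) 0 := by
  have h1 := (hasFDerivAt_id (𝕜 := ℝ) (0 : V)).norm_sq.const_sub 1
  have h2 := ((hasFDerivAt_id (𝕜 := ℝ) (0 : V)).sub_const ζ).norm_sq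
  have h3 := (hasDerivAt_inv (by simp [hζ])).comp_hasFDerivAt (0 : V) h2
  refine ((h1.mul h3).pow m).congr_fderiv ?_
  ext ξ
  simp [hζ]
  ring

theorem hasFDerivAt_kernel_zero {m : ℕ} (ζ : S (m + 1)) :
    HasFDerivAt (fun x => kernel (m + 1) x ζ) ((2 * m : ℝ) • innerSL ℝ (ζ : E (m + 1))) 0 :=
  hasFDerivAt_div_norm_sub_sq_pow (norm_eq_of_mem_sphere ζ) m

theorem measurable_kernel {m : ℕ} (x : E (m + 1)) : Measurable (kernel (m + 1) x) := by
  unfold kernel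
  fun_prop

/-- Differentiation under the integral sign, dominated by the uniform Lipschitz constant of the
kernel times `‖φ‖`. -/
theorem hasFDerivAt_poisson_zero {m : ℕ} {F : Type*} [NormedAddCommGroup F] [NormedSpace ℝ F]
    {φ : S (m + 1) → F} (hφ : Integrable φ (σ (m + 1))) :
    ∃ A : E (m + 1) →L[ℝ] F, HasFDerivAt (poisson (m + 1) φ) A 0 ∧
      ∀ ξ, A ξ = ∫ ζ : S (m + 1), (2 * m * inner ℝ ξ (ζ : E (m + 1))) • φ ζ ∂(σ (m + 1)) := by
  obtain ⟨L, hL0, hL⟩ := exists_lipschitz_kernel (m + 1)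
  have hmeas : AEStronglyMeasurable (fun ζ : S (m + 1) =>
      ((2 * m : ℝ) • innerSL ℝ (ζ : E (m + 1))).smulRight (φ ζ)) (σ (m + 1)) := by
    have h1 : Continuous fun ζ : S (m + 1) => (2 * m : ℝ) • innerSL ℝ (ζ : E (m + 1)) := by fun_prop
    have h2 : Continuous fun z : (E (m + 1) →L[ℝ] ℝ) × F => z.1.smulRight z.2 :=
      (ContinuousLinearMap.smulRightL ℝ (E (m + 1)) F).continuous₂
    have h3 := h2.comp_aestronglyMeasurable (h1.aestronglyMeasurable.prodMk hφ.1)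
    exact h3
  have hlip : ∀ ζ : S (m + 1), LipschitzOnWith (Real.nnabs (L * ‖φ ζ‖))
      (fun x => kernel (m + 1) x ζ • φ ζ) (closedBall 0 (1 / 2)) := by
    refine fun ζ => LipschitzOnWith.of_dist_le_mul fun x hx y hy => ?_
    rw [dist_eq_norm, dist_eq_norm, ← sub_smul, norm_smul, Real.norm_eq_abs, Real.coe_nnabs,
      abs_of_nonneg (mul_nonneg hL0 (norm_nonneg _))]
    calc _ ≤ L * ‖x - y‖ * ‖φ ζ‖ := mul_le_mul_of_nonneg_right (hL ζ x hx y hy) (norm_nonneg _)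
      _ = _ := by ring
  have hd : ∀ ζ : S (m + 1), HasFDerivAt (fun x => kernel (m + 1) x ζ • φ ζ)
      (((2 * m : ℝ) • innerSL ℝ (ζ : E (m + 1))).smulRight (φ ζ)) 0 :=
    fun ζ => (hasFDerivAt_kernel_zero ζ).smul_const (φ ζ)
  obtain ⟨hi, hd⟩ := hasFDerivAt_integral_of_dominated_loc_of_lip (𝕜 := ℝ)
    (F := fun x ζ => kernel (m + 1) x ζ • φ ζ)
    (closedBall_mem_nhds (0 : E (m + 1)) (by norm_num : (0 : ℝ) < 1 / 2))
    (Filter.Eventually.of_forall fun x =>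
      (measurable_kernel x).aestronglyMeasurable.smul hφ.1)
    (by simpa only [kernel_zero, one_smul] using hφ) hmeas (Filter.Eventually.of_forall hlip)
    (hφ.norm.const_mul L) (Filter.Eventually.of_forall hd)
  refine ⟨_, hd, fun ξ => ?_⟩
  rw [ContinuousLinearMap.integral_apply hi]
  refine integral_congr_ae (Filter.Eventually.of_forall fun ζ => ?_)
  simp [real_inner_comm]

theorem fderiv_poisson_zero_apply {m : ℕ} {F : Type*} [NormedAddCommGroup F] [NormedSpace ℝ F]
    {φ : S (m + 1) → F} (hφ : Integrable φ (σ (m + 1))) (ξ : E (m + 1)) :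
    fderiv ℝ (poisson (m + 1) φ) 0 ξ =
      ∫ ζ : S (m + 1), (2 * m * inner ℝ ξ (ζ : E (m + 1))) • φ ζ ∂(σ (m + 1)) := by
  obtain ⟨A, hA, hA'⟩ := hasFDerivAt_poisson_zero hφ
  rw [hA.fderiv, hA']

theorem differentiableAt_poisson_zero {m : ℕ} {F : Type*} [NormedAddCommGroup F] [NormedSpace ℝ F]
    {φ : S (m + 1) → F} (hφ : Integrable φ (σ (m + 1))) :
    DifferentiableAt ℝ (poisson (m + 1) φ) 0 := by
  obtain ⟨A, hA, -⟩ := hasFDerivAt_poisson_zero hφ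
  exact hA.differentiableAt

theorem Admissible.integrable {m : ℕ} {p : ℝ≥0∞} (hp : 1 ≤ p) {φ : S (m + 1) → E (m + 1)}
    (hφ : Admissible (m + 1) p φ) : Integrable φ (σ (m + 1)) :=
  hφ.1.integrable hp

theorem continuousOn_const_mul_id (c : ℝ) :
    ContinuousOn (fun t : ℝ => c * t) (Set.Icc (-1) 1) := by fun_prop

theorem integral_abs_rpow_zonal {q : ℝ} (hq : 0 ≤ q) :
    ∫ t, |t| ^ q ∂(zonal m) = Real.Gamma (((m : ℝ) + 1) / 2) * Real.Gamma ((1 + q) / 2) /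
      (Real.sqrt Real.pi * Real.Gamma (((m : ℝ) + 1 + q) / 2)) := by
  rw [integral_eq_lintegral_of_nonneg_ae (Filter.Eventually.of_forall fun t => by positivity)
    (by fun_prop), lintegral_abs_rpow_zonal two_le_fact hq, ENNReal.toReal_ofReal]
  have h1 := Real.Gamma_pos_of_pos (show (0 : ℝ) < ((m : ℝ) + 1) / 2 by positivity)
  have h2 := Real.Gamma_pos_of_pos (show (0 : ℝ) < (1 + q) / 2 by positivity)
  have h3 := Real.Gamma_pos_of_pos (show (0 : ℝ) < ((m : ℝ) + 1 + q) / 2 by positivity)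
  positivity

theorem gradConst_eq {q : ℝ≥0∞} (hq : q ≠ ⊤) :
    gradConst (m + 1) q = 2 * m * (∫ t, |t| ^ q.toReal ∂(zonal m)) ^ (1 / q.toReal) := by
  rw [gradConst, if_neg hq, integral_abs_rpow_zonal ENNReal.toReal_nonneg]
  push_cast
  ring_nf

theorem gradConst_top {m : ℕ} : gradConst (m + 1) ⊤ = 2 * m := by
  simp [gradConst]

theorem toReal_eLpNorm_mul_le_gradConst {p q : ℝ≥0∞} (hpq : ENNReal.HolderConjugate p q) :
    (eLpNorm (fun t : ℝ => 2 * m * t) q (zonal m)).toReal ≤ gradConst (m + 1) q := by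
  by_cases hq : q = ⊤
  · subst hq
    rw [gradConst_top]
    refine ENNReal.toReal_le_of_le_ofReal (by positivity) ?_
    rw [eLpNorm_exponent_top]
    refine eLpNormEssSup_le_of_ae_bound ?_
    filter_upwards [ae_zonal_mem_Icc m] with t ht
    rw [Real.norm_eq_abs, abs_mul, abs_of_nonneg (by positivity : (0 : ℝ) ≤ 2 * m)]
    exact mul_le_of_le_one_right (by positivity) (abs_le.2 ht)
  · have hq1 := one_le_toReal hpq hq
    rw [toReal_eLpNorm_eq (ENNReal.HolderConjugate.ne_zero q p) hq
      (memLp_of_continuousOn (continuousOn_const_mul_id _) q), gradConst_eq hq]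
    have h : ∀ t : ℝ, |2 * m * t| ^ q.toReal = (2 * m : ℝ) ^ q.toReal * |t| ^ q.toReal := fun t => by
      rw [abs_mul, abs_of_nonneg (by positivity : (0 : ℝ) ≤ 2 * m),
        Real.mul_rpow (by positivity) (abs_nonneg t)]
    simp only [h]
    rw [integral_const_mul, Real.mul_rpow (by positivity)
      (integral_nonneg fun t => by positivity), ← Real.rpow_mul (by positivity),
      mul_one_div_cancel (by linarith), Real.rpow_one]

theorem norm_fderiv_poisson_le {p q : ℝ≥0∞} (hpq : ENNReal.HolderConjugate p q)
    {φ : S (m + 1) → E (m + 1)} (hφ : Admissible (m + 1) p φ) :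
    ‖fderiv ℝ (poisson (m + 1) φ) 0‖ ≤ gradConst (m + 1) q * normLp (m + 1) p φ := by
  have hG := toReal_eLpNorm_mul_le_gradConst (m := m) hpq
  have hN : 0 ≤ normLp (m + 1) p φ := ENNReal.toReal_nonneg
  refine ContinuousLinearMap.opNorm_le_of_unit_norm
    (mul_nonneg (ENNReal.toReal_nonneg.trans hG) hN) fun v hv => ?_
  have hmem := memLp_of_continuousOn (m := m) (continuousOn_const_mul_id (2 * m)) q
  rw [fderiv_poisson_zero_apply (hφ.integrable (ENNReal.HolderConjugate.one_le p q))]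
  refine (norm_integral_smul_le hpq (memLp_comp_inner hv hmem) hφ.1).trans ?_
  rw [eLpNorm_comp_inner hv q hmem.1]
  exact mul_le_mul_of_nonneg_right hG hN

theorem fderiv_poisson_zonalField_apply {v : E (m + 1)} (hv : ‖v‖ = 1) {w : ℝ → ℝ} {p : ℝ≥0∞}
    (hp : 1 ≤ p) (hw : MemLp w p (zonal m)) :
    fderiv ℝ (poisson (m + 1) (zonalField v w)) 0 v = (∫ t, 2 * m * t * w t ∂(zonal m)) • v := by
  rw [fderiv_poisson_zero_apply ((memLp_zonalField hv hw).integrable hp)]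
  have h := integral_smul_zonalField hv hw.1 (h := fun t => 2 * m * t) (by fun_prop)
  exact h

theorem integral_mul_le_norm_fderiv {v : E (m + 1)} (hv : ‖v‖ = 1) {w : ℝ → ℝ} {p : ℝ≥0∞}
    (hp : 1 ≤ p) (hw : MemLp w p (zonal m)) :
    ∫ t, 2 * m * t * w t ∂(zonal m) ≤ ‖fderiv ℝ (poisson (m + 1) (zonalField v w)) 0‖ := by
  have h := (fderiv ℝ (poisson (m + 1) (zonalField v w)) 0).le_opNorm v
  rw [fderiv_poisson_zonalField_apply hv hp hw, norm_smul, hv, mul_one, mul_one] at h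
  exact (Real.le_norm_self _).trans h

/-- The signed power of the height itself is odd, hence admissible, and gives equality in Hölder
against `2 m t`. -/
theorem exists_norm_fderiv_poisson_eq {p q : ℝ≥0∞} (hpq : ENNReal.HolderConjugate p q)
    (hq : q ≠ ⊤) :
    ∃ φ : S (m + 1) → E (m + 1), Admissible (m + 1) p φ ∧ normLp (m + 1) p φ ≠ 0 ∧
      ‖fderiv ℝ (poisson (m + 1) φ) 0‖ = gradConst (m + 1) q * normLp (m + 1) p φ := by
  have hv : ‖e (m + 1)‖ = 1 := norm_e (by omega)
  have hp := ENNReal.HolderConjugate.one_le p q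
  have hq1 := one_le_toReal hpq hq
  have hq0 : 0 < q.toReal := by linarith
  have hi := integrable_zonal_of_continuousOn (m := m) (f := fun t => |t| ^ q.toReal)
    (continuous_abs.continuousOn.rpow_const fun _ _ => Or.inr hq0.le)
  have hI : 0 < ∫ t, |t| ^ q.toReal ∂(zonal m) := by
    refine integral_pos_of_ae_pos hi ?_
    filter_upwards [ae_zonal_ne 0] with t ht
    exact Real.rpow_pos_of_pos (abs_pos.2 ht) _
  have hmem : MemLp (signedPow q.toReal) p (zonal m) :=
    memLp_signedPow hq1 measurable_id continuousOn_id p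
  have hN : normLp (m + 1) p (zonalField (e (m + 1)) (signedPow q.toReal)) =
      (∫ t, |t| ^ q.toReal ∂(zonal m)) ^ (1 / p.toReal) := by
    rw [normLp_zonalField hv hmem.1]
    exact toReal_eLpNorm_signedPow hpq hq measurable_id continuousOn_id (ae_zonal_ne 0)
  have hadm := admissible_zonalField hv hmem (integral_signedPow_zonal _)
  refine ⟨_, hadm, ?_, le_antisymm (norm_fderiv_poisson_le hpq hadm) ?_⟩
  · rw [hN]
    positivity
  · refine le_trans (le_of_eq ?_) (integral_mul_le_norm_fderiv hv hp hmem)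
    rw [hN, gradConst_eq hq, mul_assoc, rpow_one_div_mul_rpow_one_div hpq hI, ← integral_const_mul]
    congr 1
    ext t
    rw [← signedPow_mul_self hq0.ne']
    ring

theorem gradConst_top_le {C : ℝ}
    (hC : ∀ φ : S (m + 1) → E (m + 1), Admissible (m + 1) 1 φ →
      ‖fderiv ℝ (poisson (m + 1) φ) 0‖ ≤ C * normLp (m + 1) 1 φ) : gradConst (m + 1) ⊤ ≤ C := by
  have hv : ‖e (m + 1)‖ = 1 := norm_e (by omega)
  have h1 := sub_div_two_le_of_capPair (m := m) (continuousOn_const_mul_id (2 * m)) (C := C)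
    (fun t ht t' ht' h => mul_le_mul_of_nonneg_left h (by positivity))
    fun τ h0 h1 => by
      have h2 := memLp_capPair (m := m) h0 1
      have h3 := hC _ (admissible_zonalField hv h2 (integral_capPair τ))
      rw [normLp_capPair hv h0] at h3
      exact (integral_mul_le_norm_fderiv hv le_rfl h2).trans h3
  rw [gradConst_top]
  linarith

end HypPoisson

/-! ### Assembly of the theorem -/

theorem theorem1p1 (n : ℕ) (hn : 3 ≤ n) (p q : ℝ≥0∞) (hpq : ENNReal.HolderConjugate p q) :
    -- the two estimates
    (∀ φ : S n → E n, Admissible n p φ →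
      (∀ x ∈ ball (0 : E n) 1, ‖poisson n φ x‖ ≤ G n q ‖x‖ * normLp n p φ) ∧
      DifferentiableAt ℝ (poisson n φ) 0 ∧
      ‖fderiv ℝ (poisson n φ) 0‖ ≤ gradConst n q * normLp n p φ) ∧
    -- sharpness: at every point, the constants cannot be replaced by smaller ones
    (∀ x ∈ ball (0 : E n) 1, ∀ C : ℝ,
      (∀ φ : S n → E n, Admissible n p φ → ‖poisson n φ x‖ ≤ C * normLp n p φ) →
        G n q ‖x‖ ≤ C) ∧
    (∀ C : ℝ,
      (∀ φ : S n → E n, Admissible n p φ →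
        ‖fderiv ℝ (poisson n φ) 0‖ ≤ C * normLp n p φ) →
        gradConst n q ≤ C) ∧
    -- for `p > 1` equality is attained
    (1 < p →
      (∀ x ∈ ball (0 : E n) 1, ∃ φ : S n → E n, Admissible n p φ ∧ normLp n p φ ≠ 0 ∧
        ‖poisson n φ x‖ = G n q ‖x‖ * normLp n p φ) ∧
      (∃ φ : S n → E n, Admissible n p φ ∧ normLp n p φ ≠ 0 ∧
        ‖fderiv ℝ (poisson n φ) 0‖ = gradConst n q * normLp n p φ)) ∧
    -- properties of `G_p`
    (p ≠ ⊤ →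
      G n q 0 = 0 ∧ IsIncreasingDiffeo (G n q) (Set.Ico 0 1) (Set.Ici 0)) ∧
    (p = ⊤ →
      (∀ r ∈ Set.Ico (0 : ℝ) 1, G n q r = U n (r • e n)) ∧
      IsIncreasingDiffeo (G n q) (Set.Ico 0 1) (Set.Ico 0 1)) := by
  obtain ⟨m, rfl⟩ : ∃ m, n = m + 1 := ⟨n - 1, by omega⟩
  have : Fact (2 ≤ m) := ⟨by omega⟩
  have hp1 : q = ⊤ → p = 1 := (ENNReal.HolderConjugate.eq_top_iff_eq_one q p).1
  have hpos : ∀ φ : S (m + 1) → E (m + 1), normLp (m + 1) p φ ≠ 0 → 0 < normLp (m + 1) p φ :=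
    fun φ h => lt_of_le_of_ne ENNReal.toReal_nonneg h.symm
  refine ⟨fun φ hφ => ⟨fun x hx => norm_poisson_le_G hpq hφ hx,
    differentiableAt_poisson_zero (hφ.integrable (ENNReal.HolderConjugate.one_le p q)),
    norm_fderiv_poisson_le hpq hφ⟩, fun x hx C hC => ?_, fun C hC => ?_, fun hp => ?_, fun hp => ?_,
    fun hp => ?_⟩
  · by_cases hq : q = ⊤
    · obtain rfl := hp1 hq
      subst hq
      exact G_top_le hx hC
    · obtain ⟨φ, hφ, hφ0, h⟩ := exists_norm_poisson_eq hpq hq hx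
      exact le_of_mul_le_mul_right (h.symm.trans_le (hC φ hφ)) (hpos φ hφ0)
  · by_cases hq : q = ⊤
    · obtain rfl := hp1 hq
      subst hq
      exact gradConst_top_le hC
    · obtain ⟨φ, hφ, hφ0, h⟩ := exists_norm_fderiv_poisson_eq (m := m) hpq hq
      exact le_of_mul_le_mul_right (h.symm.trans_le (hC φ hφ)) (hpos φ hφ0)
  · have hq : q ≠ ⊤ := fun hq => hp.ne' (hp1 hq)
    exact ⟨fun x hx => exists_norm_poisson_eq hpq hq hx, exists_norm_fderiv_poisson_eq hpq hq⟩
  · have hG : IsIncreasingDiffeo (G (m + 1) q) (Set.Ico 0 1) (Set.Ici 0) := by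
      by_cases hq : q = ⊤
      · subst hq
        have hm : (0 : ℝ) < m := by exact_mod_cast dim_pos (m := m)
        exact (isIncreasingDiffeo_sinh_mul hm).of_comp_tanh_half fun s hs => G_top_tanh hs
      · have hq1 : 1 < q.toReal := by
          have h1 := one_div_toReal_add hpq
          have h2 : 0 < 1 / p.toReal :=
            one_div_pos.2 (ENNReal.toReal_pos (ENNReal.HolderConjugate.ne_zero p q) hp)
          have h3 : 0 < q.toReal := ENNReal.toReal_pos (ENNReal.HolderConjugate.ne_zero q p) hq
          rw [← div_lt_one h3]
          linarith
        exact (isIncreasingDiffeo_distConst hq1).of_comp_tanh_half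
          fun s hs => G_tanh_eq_distConst hq hq1 hs
    -- `G 0 = 0` is read off from the diffeomorphism: `0` is a value, and the value at the left end
    -- point is the smallest.
    obtain ⟨r, hr, h0⟩ := hG.2.1.surjOn (show (0 : ℝ) ∈ Set.Ici (0 : ℝ) from Set.mem_Ici.2 le_rfl)
    have h1 := hG.1.monotoneOn (show (0 : ℝ) ∈ Set.Ico (0 : ℝ) 1 by norm_num) hr hr.1
    exact ⟨le_antisymm (h1.trans_eq h0)
      (hG.2.1.mapsTo (show (0 : ℝ) ∈ Set.Ico (0 : ℝ) 1 by norm_num)), hG⟩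
  · subst hp
    obtain rfl : q = 1 := (ENNReal.HolderConjugate.eq_top_iff_eq_one ⊤ q).1 rfl
    refine ⟨fun r hr => ?_, isIncreasingDiffeo_halfSphereIntegral.of_comp_tanh_half
      fun s hs => G_one_tanh hs⟩
    obtain ⟨s, hs, rfl⟩ := isIncreasingDiffeo_tanh_half.2.1.surjOn hr
    simp only
    rw [G_one_tanh hs, U_tanh]
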